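/- **Setting.** A *Hermitian space* is a complex inner product space $W$, not necessarily complete, with inner product antilinear in the first entry; a *real structure* on it is an antiunitary involution $w\mapsto\overline w$. It gives the bilinear form $b(v,w)=\langle\overline v,w\rangle$ and the Clifford algebra $\mathrm{Cl}(W)$, generated by $W$ with relations $vw+wv=b(v,w)$. $-W$ denotes $W$ with the real structure $w\mapsto-\overline w$; direct sums are orthogonal. A *Lagrangian* in $W$ is a subspace $L$ with $\overline L=L^\perp$ and $W=L\oplus\overline L$ (the second condition is automatic if $W$ is complete). For a Lagrangian $L\subset W_i\oplus -W_j$ the exterior algebra $\Lambda L$, with vacuum $\Omega=1\in\Lambda^0L$, is a module over $\mathrm{Cl}(W_i\oplus -W_j)$: $v\in L$ acts by $\xi\mapsto v\wedge\xi$ and $\overline v$ by insertion $\iota(v)$ of $v$ by means of the inner product. It is a $\mathrm{Cl}(W_i)$-$\mathrm{Cl}(W_j)$-bimodule by $w_i\cdot\xi=(w_i,0)\cdot\xi$ and $\xi\cdot w_j=(-1)^{|\xi|}(0,w_j)\cdot\xi$. For $L\subset W_i\oplus-W_j$ and $L'\subset W_j\oplus-W_k$ put $$L\circ L'=\{(w_i,w_k)\mid\exists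 w_j:(w_i,w_j)\in L,\ (w_j,w_k)\in L'\},\qquad \sigma(L\oplus L')=\{v_j-v_j'\mid (v_i,v_j)\in L,\ (v_j',v_k)\in L'\}\subset W_j,$$ let $U=\{(0,w,w,0)\mid w\in W_j\}$ in $(W_i\oplus-W_j)\oplus(W_j\oplus-W_k)$, so that $\overline U=\{(0,-w,w,0)\}$, and write $P_{L\oplus L'}$ and $P_{\overline{L\oplus L'}}=1-P_{L\oplus L'}$ for the orthogonal projections. The pair $(L,L')$ satisfies the *gluing conditions* if (1) $\sigma(L\oplus L')$ equals its double orthogonal complement $\sigma(L\oplus L')^{\perp\perp}$ in $W_j$ (if $W_j$ is complete: is closed), and (2) $P_{L\oplus L'}\overline U$ and $P_{\overline{L\oplus L'}}U$ are closed. **Theorem.** Let $W_0,W_1,W_2,W_3$ be Hermitian spaces with real structures, let $L_{01}\subset W_0\oplus-W_1$, $L_{12}\subset W_1\oplus-W_2$, $L_{23}\subset W_2\oplus-W_3$ be Lagrangians, and assume that $L_{02}=L_{01}\circ L_{12}$, $L_{13}=L_{12}\circ L_{23}$ and $L_{03}=L_{01}\circ L_{13}$ $(=L_{02}\circ L_{23})$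 are again Lagrangians. For $0\le i<j<k\le3$ assume that $(L_{ij},L_{jk})$ satisfies the gluing conditions and that $$K_{ijk}=\{u\in W_j\mid(0,u)\in L_{ij},\ (u,0)\in L_{jk}\}$$ is finite-dimensional. Then: (a) For all $0\le i<j<k\le3$ there is a unique homomorphism of $\mathrm{Cl}(W_i)$-$\mathrm{Cl}(W_k)$-bimodules $$\alpha_{ijk}:\Lambda L_{ik}\otimes\Lambda^{\mathrm{top}}K_{ijk}\to\Lambda L_{ij}\otimes_{\mathrm{Cl}(W_j)}\Lambda L_{jk},\qquad \Omega_{ik}\otimes u_1\wedge\dots\wedge u_n\mapsto\Omega_{ij}\cdot u_1\cdots u_n\otimes\Omega_{jk}\quad(u_1,\dots,u_n\in K_{ijk},\ n=\dim K_{ijk}),$$ where $\mathrm{Cl}(W_i)$ acts on the left factor and $(\xi\otimes\kappa)\cdot b=(-1)^{|\kappa||b|}\,\xi b\otimes\kappa$, $|\kappa|=n$. (b) One has $K_{012}\subset K_{013}$ and $K_{123}\subset K_{023}$, and $L_{12}\cap\big((K_{012}^\perp\cap K_{013})\oplus(K_{123}^\perp\cap K_{023})\big)$ is the graph of a linear isomorphism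 $\rho_0:K_{012}^\perp\cap K_{013}\to K_{123}^\perp\cap K_{023}$. Let $\rho:K_{013}\oplus K_{123}\to K_{012}\oplus K_{023}$ be the isomorphism $(u_1+v,u_2)\mapsto(u_1,u_2+\rho_0(v))$ for $u_1\in K_{012}$, $v\in K_{012}^\perp\cap K_{013}$, $u_2\in K_{123}$, and let $\rho^*$ be its adjoint for the inner products of the orthogonal direct sums. Then the two linear maps $$\Lambda L_{03}\otimes\Lambda^{\mathrm{top}}(K_{013}\oplus K_{123})\longrightarrow\big(\Lambda L_{01}\otimes_{\mathrm{Cl}(W_1)}\Lambda L_{12}\big)\otimes_{\mathrm{Cl}(W_2)}\Lambda L_{23}$$ given by the following composites are equal. * First composite: the identification $\Lambda^{\mathrm{top}}(K_{013}\oplus K_{123})\cong\Lambda^{\mathrm{top}}K_{013}\otimes\Lambda^{\mathrm{top}}K_{123}$ (inverse to $\kappa\otimes\mu\mapsto\kappa\wedge\mu$), then $\alpha_{013}\otimes\mathrm{id}$, then $(x\otimes y)\otimes\kappa\mapsto x\otimes(y\otimes\kappa)$, then $\mathrm{id}\otimes\alpha_{123}$, then the associator $x\otimes(y\otimes z)\mapsto(x\otimes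 y)\otimes z$. * Second composite: $\mathrm{id}\otimes\dfrac{\Lambda^{\mathrm{top}}\rho}{\det(\rho^*\rho)}$, then the identification $\Lambda^{\mathrm{top}}(K_{012}\oplus K_{023})\cong\Lambda^{\mathrm{top}}K_{012}\otimes\Lambda^{\mathrm{top}}K_{023}\cong\Lambda^{\mathrm{top}}K_{023}\otimes\Lambda^{\mathrm{top}}K_{012}$, then $\alpha_{023}\otimes\mathrm{id}$, then $(x\otimes\xi)\otimes\kappa\mapsto(-1)^{|\kappa||\xi|}(x\otimes\kappa)\otimes\xi$ for $\xi\in\Lambda L_{23}$, $\kappa\in\Lambda^{\mathrm{top}}K_{012}$, then $\alpha_{012}\otimes\mathrm{id}$. Here the exchange of the two determinant lines carries the sign $(-1)^{\dim K_{012}\dim K_{023}}$ of super vector spaces. -/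

import Mathlib

open scoped TensorProduct InnerProductSpace

noncomputable section

/-! ### Real structures, Lagrangians and their composition -/

/-- A real structure on a complex inner product space (not assumed complete): an anti-unitary
involution `w ↦ conj w`.  Mathlib's inner product is antilinear in the first entry. -/
structure RealStructure (W : Type*) [NormedAddCommGroup W] [InnerProductSpace ℂ W] where
  conj : W →ₗ⋆[ℂ] W
  conj_conj : ∀ w, conj (conj w) = w
  inner_conj_conj : ∀ v w, ⟪conj v, conj w⟫_ℂ = ⟪w, v⟫_ℂ

namespace RealStructure

variable {W W₀ W₁ : Type*}
  [NormedAddCommGroup W] [InnerProductSpace ℂ W]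
  [NormedAddCommGroup W₀] [InnerProductSpace ℂ W₀]
  [NormedAddCommGroup W₁] [InnerProductSpace ℂ W₁]

/-- The opposite space `-W`: the same Hermitian space with the real structure `w ↦ - conj w`. -/
def opp (J : RealStructure W) : RealStructure W where
  conj := -J.conj
  conj_conj w := by simp [J.conj_conj]
  inner_conj_conj v w := by simp [J.inner_conj_conj]

/-- The orthogonal direct sum `W₀ ⊕ W₁` with the componentwise real structure. -/
def prod (J₀ : RealStructure W₀) (J₁ : RealStructure W₁) :
    RealStructure (WithLp 2 (W₀ × W₁)) where
  conj :=
    { toFun := fun w => WithLp.toLp 2 (J₀.conj w.fst, J₁.conj w.snd)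
      map_add' := fun v w => by
        apply WithLp.ofLp_injective
        ext <;> simp
      map_smul' := fun c w => by
        apply WithLp.ofLp_injective
        ext <;> simp }
  conj_conj w := by
    apply WithLp.ofLp_injective
    ext <;> simp [J₀.conj_conj, J₁.conj_conj]
  inner_conj_conj v w := by
    simp [WithLp.prod_inner_apply, J₀.inner_conj_conj, J₁.inner_conj_conj]

/-- The complex bilinear form `b(v, w) = ⟪conj v, w⟫`. -/
def form (J : RealStructure W) : W →ₗ[ℂ] W →ₗ[ℂ] ℂ :=
  LinearMap.mk₂ ℂ (fun v w => ⟪J.conj v, w⟫_ℂ)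
    (fun u v w => by simp)
    (fun c v w => by simp [mul_comm])
    (fun u v w => by simp)
    (fun c v w => by simp)

theorem form_apply (J : RealStructure W) (v w : W) : J.form v w = ⟪J.conj v, w⟫_ℂ := rfl

theorem form_comm (J : RealStructure W) (v w : W) : J.form v w = J.form w v := by
  rw [form_apply, form_apply]
  have h := J.inner_conj_conj v (J.conj w)
  rwa [J.conj_conj] at h

/-- The quadratic form `w ↦ b(w, w) / 2`.  Its Clifford algebra is generated by `W` with the
relations `v w + w v = b(v, w)`. -/
def quadForm (J : RealStructure W) : QuadraticForm ℂ W :=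
  (2⁻¹ : ℂ) • LinearMap.BilinMap.toQuadraticMap J.form

theorem quadForm_apply (J : RealStructure W) (w : W) :
    J.quadForm w = 2⁻¹ * J.form w w := rfl

end RealStructure

/-- The Clifford algebra `Cl(W)`, with relations `v w + w v = b(v, w)`. -/
abbrev Cl {W : Type*} [NormedAddCommGroup W] [InnerProductSpace ℂ W] (J : RealStructure W) :
    Type _ :=
  CliffordAlgebra J.quadForm

theorem Cl.relation {W : Type*} [NormedAddCommGroup W] [InnerProductSpace ℂ W]
    (J : RealStructure W) (v w : W) :
    CliffordAlgebra.ι J.quadForm v * CliffordAlgebra.ι J.quadForm w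
      + CliffordAlgebra.ι J.quadForm w * CliffordAlgebra.ι J.quadForm v
      = algebraMap ℂ (Cl J) (J.form v w) := by
  rw [CliffordAlgebra.ι_mul_ι_add_swap]
  congr 1
  simp only [QuadraticMap.polar, RealStructure.quadForm_apply, map_add, LinearMap.add_apply,
    J.form_comm w v]
  ring

/-- A Lagrangian `L ⊆ W`: a subspace with `conj L = Lᗮ`, such that `W = L ⊕ Lᗮ`, that is, every
`w` is `v₁ + conj v₂` with `v₁, v₂ ∈ L` (automatic if `W` is complete). -/
structure Lagrangian {W : Type*} [NormedAddCommGroup W] [InnerProductSpace ℂ W]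
    (J : RealStructure W) where
  carrier : Submodule ℂ W
  conj_mem_iff : ∀ w, J.conj w ∈ carrier ↔ w ∈ carrierᗮ
  hasOrthogonalProjection : carrier.HasOrthogonalProjection

attribute [instance] Lagrangian.hasOrthogonalProjection

/-- Lagrangians in `W₀ ⊕ -W₁`. -/
abbrev LagRel {W₀ W₁ : Type*} [NormedAddCommGroup W₀] [InnerProductSpace ℂ W₀]
    [NormedAddCommGroup W₁] [InnerProductSpace ℂ W₁]
    (J₀ : RealStructure W₀) (J₁ : RealStructure W₁) : Type _ :=
  Lagrangian (J₀.prod J₁.opp)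

section Relations

variable {W₀ W₁ W₂ W₃ : Type*}
  [NormedAddCommGroup W₀] [InnerProductSpace ℂ W₀]
  [NormedAddCommGroup W₁] [InnerProductSpace ℂ W₁]
  [NormedAddCommGroup W₂] [InnerProductSpace ℂ W₂]
  [NormedAddCommGroup W₃] [InnerProductSpace ℂ W₃]

/-- The composition `{(w₀, w₂) | ∃ w₁, (w₀, w₁) ∈ L₀₁ ∧ (w₁, w₂) ∈ L₁₂}`. -/
def relComp (L₀₁ : Submodule ℂ (WithLp 2 (W₀ × W₁))) (L₁₂ : Submodule ℂ (WithLp 2 (W₁ × W₂))) :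
    Submodule ℂ (WithLp 2 (W₀ × W₂)) where
  carrier := {x | ∃ w₁ : W₁, WithLp.toLp 2 (x.fst, w₁) ∈ L₀₁ ∧ WithLp.toLp 2 (w₁, x.snd) ∈ L₁₂}
  zero_mem' := ⟨0, L₀₁.zero_mem, L₁₂.zero_mem⟩
  add_mem' := by
    rintro x y ⟨u, hu, hu'⟩ ⟨v, hv, hv'⟩
    exact ⟨u + v, L₀₁.add_mem hu hv, L₁₂.add_mem hu' hv'⟩
  smul_mem' := by
    rintro c x ⟨u, hu, hu'⟩
    exact ⟨c • u, L₀₁.smul_mem c hu, L₁₂.smul_mem c hu'⟩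

/-- The space `K = {u ∈ W₁ | (0, u) ∈ L₀₁ ∧ (u, 0) ∈ L₁₂}`. -/
def kerSpace (L₀₁ : Submodule ℂ (WithLp 2 (W₀ × W₁)))
    (L₁₂ : Submodule ℂ (WithLp 2 (W₁ × W₂))) : Submodule ℂ W₁ where
  carrier := {u | WithLp.toLp 2 (0, u) ∈ L₀₁ ∧ WithLp.toLp 2 (u, 0) ∈ L₁₂}
  zero_mem' := ⟨L₀₁.zero_mem, L₁₂.zero_mem⟩
  add_mem' := by
    rintro u v ⟨hu, hu'⟩ ⟨hv, hv'⟩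
    have h := L₀₁.add_mem hu hv
    have h' := L₁₂.add_mem hu' hv'
    rw [← WithLp.toLp_add, Prod.mk_add_mk, add_zero] at h h'
    exact ⟨h, h'⟩
  smul_mem' := by
    rintro c u ⟨hu, hu'⟩
    have h := L₀₁.smul_mem c hu
    have h' := L₁₂.smul_mem c hu'
    rw [← WithLp.toLp_smul, Prod.smul_mk, smul_zero] at h h'
    exact ⟨h, h'⟩

/-- The image of `L = L₀₁ ⊕ L₁₂` under `σ(v₀, v₁, v₁', v₂) = v₁ - v₁'`. -/
def sigmaRange (L₀₁ : Submodule ℂ (WithLp 2 (W₀ × W₁)))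
    (L₁₂ : Submodule ℂ (WithLp 2 (W₁ × W₂))) : Submodule ℂ W₁ where
  carrier := {w | ∃ x ∈ L₀₁, ∃ y ∈ L₁₂, w = x.snd - y.fst}
  zero_mem' := ⟨0, L₀₁.zero_mem, 0, L₁₂.zero_mem, by simp⟩
  add_mem' := by
    rintro _ _ ⟨x, hx, y, hy, rfl⟩ ⟨x', hx', y', hy', rfl⟩
    refine ⟨x + x', L₀₁.add_mem hx hx', y + y', L₁₂.add_mem hy hy', ?_⟩
    simp only [WithLp.add_fst, WithLp.add_snd]
    abel
  smul_mem' := by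
    rintro c _ ⟨x, hx, y, hy, rfl⟩
    exact ⟨c • x, L₀₁.smul_mem c hx, c • y, L₁₂.smul_mem c hy, by simp [smul_sub]⟩

/-- The two closedness conditions on a pair of Lagrangians, with `L = L₀₁ ⊕ L₁₂` inside
`W = (W₀ ⊕ -W₁) ⊕ (W₁ ⊕ -W₂)` and `U = {(0, w, w, 0)}`, so that
`conj U = {(0, -w, w, 0)}`, and the projections `P_L` and `P_{conj L} = 1 - P_L` are formed
componentwise. -/
structure GluingConditions {J₀ : RealStructure W₀} {J₁ : RealStructure W₁}
    {J₂ : RealStructure W₂} (L₀₁ : LagRel J₀ J₁) (L₁₂ : LagRel J₁ J₂) : Prop where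
  /-- `σ(L)` is closed, i.e. it is its own biorthogonal complement.  If `W₁` is complete this is
  topological closedness. -/
  closed_sigma : (sigmaRange L₀₁.carrier L₁₂.carrier)ᗮᗮ = sigmaRange L₀₁.carrier L₁₂.carrier
  /-- `P_L (conj U)` is closed. -/
  closed_conj_U : IsClosed (Set.range fun w : W₁ =>
    (WithLp.toLp 2 (L₀₁.carrier.starProjection (WithLp.toLp 2 (0, -w)),
      L₁₂.carrier.starProjection (WithLp.toLp 2 (w, 0))) :
      WithLp 2 (WithLp 2 (W₀ × W₁) × WithLp 2 (W₁ × W₂))))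
  /-- `P_{conj L} U` is closed. -/
  closed_U : IsClosed (Set.range fun w : W₁ =>
    (WithLp.toLp 2 (L₀₁.carrierᗮ.starProjection (WithLp.toLp 2 (0, w)),
      L₁₂.carrierᗮ.starProjection (WithLp.toLp 2 (w, 0))) :
      WithLp 2 (WithLp 2 (W₀ × W₁) × WithLp 2 (W₁ × W₂))))

theorem kerSpace_le_left (L₀₁ : Submodule ℂ (WithLp 2 (W₀ × W₁)))
    (L₁₂ : Submodule ℂ (WithLp 2 (W₁ × W₂))) (L₂₃ : Submodule ℂ (WithLp 2 (W₂ × W₃))) :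
    kerSpace L₀₁ L₁₂ ≤ kerSpace L₀₁ (relComp L₁₂ L₂₃) :=
  fun _ hu => ⟨hu.1, 0, hu.2, L₂₃.zero_mem⟩

theorem kerSpace_le_right (L₀₁ : Submodule ℂ (WithLp 2 (W₀ × W₁)))
    (L₁₂ : Submodule ℂ (WithLp 2 (W₁ × W₂))) (L₂₃ : Submodule ℂ (WithLp 2 (W₂ × W₃))) :
    kerSpace L₁₂ L₂₃ ≤ kerSpace (relComp L₀₁ L₁₂) L₂₃ :=
  fun _ hu => ⟨⟨0, L₀₁.zero_mem, hu.1⟩, hu.2⟩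

end Relations


/-! ### The Fock module of a Lagrangian -/

section Fock

/-- The exterior algebra `ΛL` of a Lagrangian `L`. -/
def Fock {W : Type*} [NormedAddCommGroup W] [InnerProductSpace ℂ W] {J : RealStructure W}
    (L : Lagrangian J) : Type _ :=
  ExteriorAlgebra ℂ L.carrier

namespace Fock

section Single

variable {W : Type*} [NormedAddCommGroup W] [InnerProductSpace ℂ W] {J : RealStructure W}
  (L : Lagrangian J)

instance : AddCommGroup (Fock L) := inferInstanceAs (AddCommGroup (ExteriorAlgebra ℂ L.carrier))

instance : Module ℂ (Fock L) := inferInstanceAs (Module ℂ (ExteriorAlgebra ℂ L.carrier))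

/-- The vacuum vector `1 ∈ Λ⁰L`. -/
def vacuum : Fock L := (1 : ExteriorAlgebra ℂ L.carrier)

/-- The parity operator `ξ ↦ (-1)^|ξ| ξ`. -/
def parity : Fock L →ₗ[ℂ] Fock L :=
  (CliffordAlgebra.involute : ExteriorAlgebra ℂ L.carrier →ₐ[ℂ] _).toLinearMap

/-- The operator of exterior multiplication by `v ∈ L`. -/
def wedge : L.carrier →ₗ[ℂ] Module.End ℂ (Fock L) :=
  (LinearMap.mul ℂ (ExteriorAlgebra ℂ L.carrier)).comp (ExteriorAlgebra.ι ℂ)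

/-- The operator of insertion of a linear functional on `L`: the odd derivation of `ΛL`
extending it. -/
def insertion : Module.Dual ℂ L.carrier →ₗ[ℂ] Module.End ℂ (Fock L) :=
  CliffordAlgebra.contractLeft (Q := (0 : QuadraticForm ℂ L.carrier))

/-- The action of `w = v₁ + conj v₂` (with `v₁, v₂ ∈ L`) on `ΛL`: exterior multiplication by `v₁`
plus insertion of `v₂` by means of the inner product.  Here `v₁ = P_L w`, and
`⟪v₂, ·⟫ = b(w, ·)` on `L`. -/
def cliff : W →ₗ[ℂ] Module.End ℂ (Fock L) :=
  (wedge L).comp (L.carrier.orthogonalProjectionOnto : W →ₗ[ℂ] L.carrier)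
    + (insertion L).comp ((LinearMap.lcomp ℂ ℂ L.carrier.subtype).comp J.form)

variable {L}

theorem wedge_wedge (v : L.carrier) (ξ : Fock L) : wedge L v (wedge L v ξ) = 0 := by
  have h : ∀ x : ExteriorAlgebra ℂ L.carrier,
      ExteriorAlgebra.ι ℂ v * (ExteriorAlgebra.ι ℂ v * x) = 0 := fun x => by
    rw [← mul_assoc, ExteriorAlgebra.ι_sq_zero, zero_mul]
  exact h ξ

theorem insertion_insertion (d : Module.Dual ℂ L.carrier) (ξ : Fock L) :
    insertion L d (insertion L d ξ) = 0 :=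
  CliffordAlgebra.contractLeft_contractLeft d (ξ : ExteriorAlgebra ℂ L.carrier)

theorem insertion_wedge (d : Module.Dual ℂ L.carrier) (v : L.carrier) (ξ : Fock L) :
    insertion L d (wedge L v ξ) = d v • ξ - wedge L v (insertion L d ξ) :=
  CliffordAlgebra.contractLeft_ι_mul d v (ξ : ExteriorAlgebra ℂ L.carrier)

theorem parity_parity (ξ : Fock L) : parity L (parity L ξ) = ξ :=
  CliffordAlgebra.involute_involute (ξ : ExteriorAlgebra ℂ L.carrier)

theorem parity_wedge (v : L.carrier) (ξ : Fock L) :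
    parity L (wedge L v ξ) = -wedge L v (parity L ξ) := by
  have h : ∀ x : ExteriorAlgebra ℂ L.carrier,
      CliffordAlgebra.involute (ExteriorAlgebra.ι ℂ v * x)
        = -(ExteriorAlgebra.ι ℂ v * CliffordAlgebra.involute x) := fun x => by
    rw [map_mul, ExteriorAlgebra.ι, CliffordAlgebra.involute_ι, neg_mul]
  exact h ξ

theorem parity_insertion (d : Module.Dual ℂ L.carrier) (ξ : Fock L) :
    parity L (insertion L d ξ) = -insertion L d (parity L ξ) := by
  have h : ∀ x : ExteriorAlgebra ℂ L.carrier,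
      CliffordAlgebra.involute (CliffordAlgebra.contractLeft d x)
        = -CliffordAlgebra.contractLeft d (CliffordAlgebra.involute x) := fun x => by
    induction x using CliffordAlgebra.left_induction with
    | algebraMap r => simp
    | add x y hx hy => rw [map_add, map_add, map_add, map_add, hx, hy, neg_add]
    | ι_mul x m hx =>
      rw [CliffordAlgebra.contractLeft_ι_mul, map_sub, map_mul, map_mul,
        CliffordAlgebra.involute_ι, neg_mul, neg_mul, map_neg,
        CliffordAlgebra.contractLeft_ι_mul, hx, map_smul]
      simp only [mul_neg]
      abel
  exact h ξ

theorem cliff_apply (w : W) (ξ : Fock L) :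
    cliff L w ξ = wedge L (L.carrier.orthogonalProjectionOnto w) ξ
      + insertion L ((J.form w).comp L.carrier.subtype) ξ := rfl

theorem parity_cliff (w : W) (ξ : Fock L) :
    parity L (cliff L w ξ) = -cliff L w (parity L ξ) := by
  rw [cliff_apply, cliff_apply, map_add, parity_wedge, parity_insertion, neg_add]

theorem form_proj (w : W) :
    J.form w (L.carrier.orthogonalProjectionOnto w : W) = J.quadForm w := by
  set p : W := (L.carrier.orthogonalProjectionOnto w : W) with hp
  have hpL : p ∈ L.carrier := Submodule.coe_mem _
  have hq : w - p ∈ L.carrierᗮ := by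
    have := Submodule.sub_starProjection_mem_orthogonal (K := L.carrier) w
    rwa [Submodule.starProjection_apply] at this
  have hpp : J.form p p = 0 := by
    rw [RealStructure.form_apply]
    have h1 : J.conj p ∈ L.carrierᗮ := by
      rw [← L.conj_mem_iff, J.conj_conj]
      exact hpL
    exact Submodule.inner_left_of_mem_orthogonal hpL h1
  have hqq : J.form (w - p) (w - p) = 0 := by
    rw [RealStructure.form_apply]
    exact Submodule.inner_right_of_mem_orthogonal ((L.conj_mem_iff _).2 hq) hq
  rw [RealStructure.quadForm_apply]
  have hc := J.form_comm p w
  simp only [map_sub, LinearMap.sub_apply] at hqq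
  rw [hpp, hc] at hqq
  linear_combination (-2⁻¹ : ℂ) * hqq

/-- The Clifford relation `w · (w · ξ) = (b(w, w) / 2) ξ`. -/
theorem cliff_cliff (w : W) (ξ : Fock L) : cliff L w (cliff L w ξ) = J.quadForm w • ξ := by
  have h := form_proj (L := L) w
  simp only [cliff_apply, map_add, wedge_wedge, insertion_insertion, insertion_wedge,
    LinearMap.comp_apply, Submodule.subtype_apply, h]
  abel

theorem cliff_cliff_add_swap (v w : W) (ξ : Fock L) :
    cliff L v (cliff L w ξ) + cliff L w (cliff L v ξ) = J.form v w • ξ := by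
  have h := cliff_cliff (L := L) (v + w) ξ
  have hp : J.quadForm (v + w) = J.quadForm v + J.quadForm w + J.form v w := by
    simp only [RealStructure.quadForm_apply, map_add, LinearMap.add_apply, J.form_comm w v]
    ring
  simp only [map_add, LinearMap.add_apply, hp, add_smul, cliff_cliff] at h
  have h' := sub_eq_zero.2 h
  rw [← sub_eq_zero, ← h']
  abel

end Single

section Bimodule

variable {W₀ W₁ : Type*}
  [NormedAddCommGroup W₀] [InnerProductSpace ℂ W₀]
  [NormedAddCommGroup W₁] [InnerProductSpace ℂ W₁]
  {J₀ : RealStructure W₀} {J₁ : RealStructure W₁} (L : LagRel J₀ J₁)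

/-- `w₀ · ξ = (w₀, 0) · ξ`. -/
def leftGen : W₀ →ₗ[ℂ] Module.End ℂ (Fock L) :=
  (cliff L).comp ((WithLp.linearEquiv 2 ℂ (W₀ × W₁)).symm.toLinearMap.comp
    (LinearMap.inl ℂ W₀ W₁))

/-- `ξ · w₁ = (-1)^|ξ| (0, w₁) · ξ`. -/
def rightGen : W₁ →ₗ[ℂ] Module.End ℂ (Fock L) :=
  (LinearMap.lcomp ℂ (Fock L) (parity L)).comp
    ((cliff L).comp ((WithLp.linearEquiv 2 ℂ (W₀ × W₁)).symm.toLinearMap.comp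
      (LinearMap.inr ℂ W₀ W₁)))

variable {L}

theorem leftGen_apply (w : W₀) (ξ : Fock L) :
    leftGen L w ξ = cliff L (WithLp.toLp 2 (w, 0)) ξ := rfl

theorem rightGen_apply (w : W₁) (ξ : Fock L) :
    rightGen L w ξ = cliff L (WithLp.toLp 2 (0, w)) (parity L ξ) := rfl

theorem form_left (w : W₀) : (J₀.prod J₁.opp).quadForm (WithLp.toLp 2 (w, 0)) = J₀.quadForm w := by
  simp [RealStructure.quadForm_apply, RealStructure.form_apply, RealStructure.prod,
    RealStructure.opp, WithLp.prod_inner_apply]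

theorem form_right (w : W₁) :
    (J₀.prod J₁.opp).quadForm (WithLp.toLp 2 (0, w)) = -J₁.quadForm w := by
  simp [RealStructure.quadForm_apply, RealStructure.form_apply, RealStructure.prod,
    RealStructure.opp, WithLp.prod_inner_apply]

theorem form_left_right (v : W₀) (w : W₁) :
    (J₀.prod J₁.opp).form (WithLp.toLp 2 (v, 0)) (WithLp.toLp 2 (0, w)) = 0 := by
  simp [RealStructure.form_apply, RealStructure.prod, WithLp.prod_inner_apply]

variable (L)

/-- The left action of `Cl(W₀)` on `ΛL`. -/
def leftAction : Cl J₀ →ₐ[ℂ] Module.End ℂ (Fock L) :=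
  CliffordAlgebra.lift J₀.quadForm ⟨leftGen L, fun w => by
    ext ξ
    rw [Module.End.mul_apply, leftGen_apply, leftGen_apply, cliff_cliff, form_left,
      Module.algebraMap_end_apply]⟩

/-- The right action of `Cl(W₁)` on `ΛL`, as a homomorphism to the opposite of the endomorphism
algebra. -/
def rightAction : Cl J₁ →ₐ[ℂ] (Module.End ℂ (Fock L))ᵐᵒᵖ :=
  CliffordAlgebra.lift J₁.quadForm
    ⟨(MulOpposite.opLinearEquiv ℂ).toLinearMap.comp (rightGen L), fun w => by
      apply MulOpposite.unop_injective
      ext ξ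
      change rightGen L w (rightGen L w ξ) = _
      rw [rightGen_apply, rightGen_apply, parity_cliff, map_neg, parity_parity, cliff_cliff,
        form_right, neg_smul, neg_neg]
      rfl⟩

instance : Module (Cl J₀) (Fock L) :=
  Module.compHom (Fock L) ((leftAction L).toRingHom : Cl J₀ →+* Module.End ℂ (Fock L))

instance : Module (Cl J₁)ᵐᵒᵖ (Fock L) :=
  Module.compHom (Fock L)
    ((RingEquiv.opOp (Module.End ℂ (Fock L))).symm.toRingHom.comp
      (RingHom.op (rightAction L).toRingHom))

variable {L}

theorem smul_def (a : Cl J₀) (ξ : Fock L) : a • ξ = leftAction L a ξ := rfl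

theorem op_smul_def (a : Cl J₁) (ξ : Fock L) :
    MulOpposite.op a • ξ = (rightAction L a).unop ξ := rfl

theorem ι_smul (w : W₀) (ξ : Fock L) :
    CliffordAlgebra.ι J₀.quadForm w • ξ = cliff L (WithLp.toLp 2 (w, 0)) ξ := by
  rw [smul_def, leftAction, CliffordAlgebra.lift_ι_apply]
  rfl

theorem op_ι_smul (w : W₁) (ξ : Fock L) :
    MulOpposite.op (CliffordAlgebra.ι J₁.quadForm w) • ξ
      = cliff L (WithLp.toLp 2 (0, w)) (parity L ξ) := by
  rw [op_smul_def, rightAction, CliffordAlgebra.lift_ι_apply]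
  rfl

instance : SMulCommClass ℂ (Cl J₀) (Fock L) :=
  ⟨fun c a ξ => by rw [smul_def, smul_def, map_smul]⟩

instance : SMulCommClass (Cl J₀) ℂ (Fock L) := SMulCommClass.symm _ _ _

instance : IsScalarTower ℂ (Cl J₀) (Fock L) :=
  ⟨fun c a ξ => by rw [smul_def, smul_def, map_smul, LinearMap.smul_apply]⟩

instance : SMulCommClass ℂ (Cl J₁)ᵐᵒᵖ (Fock L) :=
  ⟨fun c a ξ => by
    induction a using MulOpposite.rec' with
    | h a => rw [op_smul_def, op_smul_def, map_smul]⟩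

instance : SMulCommClass (Cl J₁)ᵐᵒᵖ ℂ (Fock L) := SMulCommClass.symm _ _ _

instance : IsScalarTower ℂ (Cl J₁)ᵐᵒᵖ (Fock L) :=
  ⟨fun c a ξ => by
    induction a using MulOpposite.rec' with
    | h a => rw [← MulOpposite.op_smul, op_smul_def, op_smul_def, map_smul, MulOpposite.unop_smul,
        LinearMap.smul_apply]⟩

theorem ι_smul_op_ι_smul (v : W₀) (w : W₁) (ξ : Fock L) :
    CliffordAlgebra.ι J₀.quadForm v • MulOpposite.op (CliffordAlgebra.ι J₁.quadForm w) • ξ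
      = MulOpposite.op (CliffordAlgebra.ι J₁.quadForm w) •
        CliffordAlgebra.ι J₀.quadForm v • ξ := by
  simp only [ι_smul, op_ι_smul, parity_cliff, map_neg]
  rw [eq_neg_iff_add_eq_zero, cliff_cliff_add_swap, form_left_right, zero_smul]

theorem smul_op_smul_comm (a : Cl J₀) (b : Cl J₁) (ξ : Fock L) :
    a • MulOpposite.op b • ξ = MulOpposite.op b • a • ξ := by
  induction a using CliffordAlgebra.induction generalizing ξ with
  | algebraMap r => rw [algebraMap_smul, algebraMap_smul, smul_comm]
  | add x y hx hy => rw [add_smul, add_smul, smul_add, hx, hy]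
  | mul x y hx hy => rw [mul_smul, mul_smul, hy, hx]
  | ι v =>
    induction b using CliffordAlgebra.induction generalizing ξ with
    | algebraMap r =>
      rw [← MulOpposite.algebraMap_apply, algebraMap_smul, algebraMap_smul, smul_comm]
    | add x y hx hy => rw [MulOpposite.op_add, add_smul, add_smul, smul_add, hx, hy]
    | mul x y hx hy => rw [MulOpposite.op_mul, mul_smul, mul_smul, hy, hx]
    | ι w => exact ι_smul_op_ι_smul v w ξ

instance : SMulCommClass (Cl J₀) (Cl J₁)ᵐᵒᵖ (Fock L) :=
  ⟨fun a b ξ => smul_op_smul_comm a b.unop ξ⟩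

theorem parity_smul (a : Cl J₀) (ξ : Fock L) :
    parity L (a • ξ) = CliffordAlgebra.involute a • parity L ξ := by
  induction a using CliffordAlgebra.induction generalizing ξ with
  | algebraMap r => rw [AlgHom.commutes, algebraMap_smul, algebraMap_smul, map_smul]
  | add x y hx hy => rw [add_smul, map_add, map_add, add_smul, hx, hy]
  | mul x y hx hy => rw [mul_smul, map_mul, mul_smul, hx, hy]
  | ι v => rw [CliffordAlgebra.involute_ι, neg_smul, ι_smul, ι_smul, parity_cliff]

end Bimodule

end Fock

end Fock

/-! ### Tensor products over a noncommutative algebra, and bimodule homomorphisms -/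

section Balanced

open MulOpposite

/-- The subspace of `M ⊗ N` spanned by the elements `m a ⊗ n - m ⊗ a n`. -/
def balancedRelations (A M N : Type*) [Ring A] [AddCommGroup M] [Module ℂ M] [Module Aᵐᵒᵖ M]
    [AddCommGroup N] [Module ℂ N] [Module A N] : Submodule ℂ (M ⊗[ℂ] N) :=
  Submodule.span ℂ {x | ∃ (m : M) (a : A) (n : N), x = (op a • m) ⊗ₜ[ℂ] n - m ⊗ₜ[ℂ] (a • n)}

/-- The tensor product `M ⊗_A N` of a right `A`-module and a left `A`-module. -/
def BalTensor (A M N : Type*) [Ring A] [AddCommGroup M] [Module ℂ M] [Module Aᵐᵒᵖ M]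
    [AddCommGroup N] [Module ℂ N] [Module A N] : Type _ :=
  (M ⊗[ℂ] N) ⧸ balancedRelations A M N

namespace BalTensor

section Basic

variable (A M N : Type*) [Ring A] [AddCommGroup M] [Module ℂ M] [Module Aᵐᵒᵖ M]
  [AddCommGroup N] [Module ℂ N] [Module A N]

instance : AddCommGroup (BalTensor A M N) :=
  inferInstanceAs (AddCommGroup ((M ⊗[ℂ] N) ⧸ balancedRelations A M N))

instance : Module ℂ (BalTensor A M N) :=
  inferInstanceAs (Module ℂ ((M ⊗[ℂ] N) ⧸ balancedRelations A M N))

/-- The class `m ⊗ n`. -/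
def mk : M →ₗ[ℂ] N →ₗ[ℂ] BalTensor A M N :=
  (TensorProduct.mk ℂ M N).compr₂ (balancedRelations A M N).mkQ

variable {A M N}

theorem mk_op_smul (m : M) (a : A) (n : N) : mk A M N (op a • m) n = mk A M N m (a • n) :=
  (Submodule.Quotient.eq (balancedRelations A M N)).2 (Submodule.subset_span ⟨m, a, n, rfl⟩)

theorem ext {P : Type*} [AddCommGroup P] [Module ℂ P] {f g : BalTensor A M N →ₗ[ℂ] P}
    (h : ∀ m n, f (mk A M N m n) = g (mk A M N m n)) : f = g := by
  apply Submodule.linearMap_qext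
  apply TensorProduct.ext'
  exact h

/-- The linear map out of `M ⊗_A N` given by a balanced bilinear map. -/
def lift {P : Type*} [AddCommGroup P] [Module ℂ P] (f : M →ₗ[ℂ] N →ₗ[ℂ] P)
    (hf : ∀ m (a : A) n, f (op a • m) n = f m (a • n)) : BalTensor A M N →ₗ[ℂ] P :=
  (balancedRelations A M N).liftQ (TensorProduct.lift f) (by
    rw [balancedRelations, Submodule.span_le]
    rintro _ ⟨m, a, n, rfl⟩
    simp [hf])

@[simp] theorem lift_mk {P : Type*} [AddCommGroup P] [Module ℂ P] (f : M →ₗ[ℂ] N →ₗ[ℂ] P)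
    (hf : ∀ m (a : A) n, f (op a • m) n = f m (a • n)) (m : M) (n : N) :
    lift f hf (mk A M N m n) = f m n := rfl

end Basic

section Actions

variable {A M N : Type*} [Ring A] [AddCommGroup M] [Module ℂ M] [Module Aᵐᵒᵖ M]
  [AddCommGroup N] [Module ℂ N] [Module A N]
  {V : Type*} [AddCommGroup V] [Module ℂ V] {Q : QuadraticForm ℂ V}

/-- The left action `b (m ⊗ n) = b m ⊗ n`. -/
instance leftModule [Module (CliffordAlgebra Q) M] [SMulCommClass (CliffordAlgebra Q) ℂ M]
    [SMulCommClass (CliffordAlgebra Q) Aᵐᵒᵖ M] :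
    Module (CliffordAlgebra Q) (BalTensor A M N) :=
  Module.compHom (BalTensor A M N)
    ({ toFun := fun b => lift ((mk A M N).comp (Module.toModuleEnd ℂ M b))
        (fun m a n => by
          change mk A M N (b • op a • m) n = mk A M N (b • m) (a • n)
          rw [smul_comm, mk_op_smul])
       map_one' := ext fun m n => by simp
       map_mul' := fun a b => ext fun m n => by simp [mul_smul]
       map_zero' := ext fun m n => by simp
       map_add' := fun a b => ext fun m n => by simp [add_smul] } :
      CliffordAlgebra Q →+* Module.End ℂ (BalTensor A M N))

/-- The right action `(m ⊗ n) b = m ⊗ n b`. -/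
instance rightModule [Module (CliffordAlgebra Q)ᵐᵒᵖ N] [SMulCommClass (CliffordAlgebra Q)ᵐᵒᵖ ℂ N]
    [SMulCommClass A (CliffordAlgebra Q)ᵐᵒᵖ N] :
    Module (CliffordAlgebra Q)ᵐᵒᵖ (BalTensor A M N) :=
  Module.compHom (BalTensor A M N)
    ({ toFun := fun b => lift ((mk A M N).compl₂ (Module.toModuleEnd ℂ N b))
        (fun m a n => by
          change mk A M N (op a • m) (b • n) = mk A M N m (b • a • n)
          rw [← smul_comm, mk_op_smul])
       map_one' := ext fun m n => by simp
       map_mul' := fun a b => ext fun m n => by simp [mul_smul]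
       map_zero' := ext fun m n => by simp
       map_add' := fun a b => ext fun m n => by simp [add_smul] } :
      (CliffordAlgebra Q)ᵐᵒᵖ →+* Module.End ℂ (BalTensor A M N))

theorem smul_mk [Module (CliffordAlgebra Q) M] [SMulCommClass (CliffordAlgebra Q) ℂ M]
    [SMulCommClass (CliffordAlgebra Q) Aᵐᵒᵖ M] (b : CliffordAlgebra Q) (m : M) (n : N) :
    b • mk A M N m n = mk A M N (b • m) n := rfl

theorem op_smul_mk_right [Module (CliffordAlgebra Q)ᵐᵒᵖ N]
    [SMulCommClass (CliffordAlgebra Q)ᵐᵒᵖ ℂ N] [SMulCommClass A (CliffordAlgebra Q)ᵐᵒᵖ N]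
    (b : CliffordAlgebra Q) (m : M) (n : N) :
    op b • mk A M N m n = mk A M N m (op b • n) := rfl

instance [Module (CliffordAlgebra Q) M] [SMulCommClass (CliffordAlgebra Q) ℂ M]
    [SMulCommClass (CliffordAlgebra Q) Aᵐᵒᵖ M] :
    SMulCommClass (CliffordAlgebra Q) ℂ (BalTensor A M N) :=
  ⟨fun b c x => LinearMap.map_smul
    (lift ((mk A M N).comp (Module.toModuleEnd ℂ M b)) (fun m a n => by
      change mk A M N (b • op a • m) n = mk A M N (b • m) (a • n)
      rw [smul_comm, mk_op_smul])) c x⟩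

end Actions

end BalTensor

/-- Homomorphisms of `A`-`B`-bimodules. -/
structure BimodHom (A B M N : Type*) [Ring A] [Ring B]
    [AddCommGroup M] [Module ℂ M] [Module A M] [Module Bᵐᵒᵖ M]
    [AddCommGroup N] [Module ℂ N] [Module A N] [Module Bᵐᵒᵖ N] extends M →ₗ[ℂ] N where
  map_left : ∀ (a : A) (x : M), toFun (a • x) = a • toFun x
  map_right : ∀ (b : B) (x : M), toFun (op b • x) = op b • toFun x

namespace BalTensor

variable {A B M N M' N' : Type*} [Ring A] [Ring B]
  [AddCommGroup M] [Module ℂ M] [AddCommGroup N] [Module ℂ N]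
  [AddCommGroup M'] [Module ℂ M'] [AddCommGroup N'] [Module ℂ N']

/-- `id ⊗ f : M ⊗_A N → M ⊗_A N'`. -/
def idTensor (M : Type*) [AddCommGroup M] [Module ℂ M] [Module Aᵐᵒᵖ M] [Module A N]
    [Module Bᵐᵒᵖ N] [Module A N'] [Module Bᵐᵒᵖ N'] (f : BimodHom A B N N') :
    BalTensor A M N →ₗ[ℂ] BalTensor A M N' :=
  lift ((mk A M N').compl₂ f.toLinearMap) (fun m a n => by
    change mk A M N' (op a • m) (f.toLinearMap n) = mk A M N' m (f.toLinearMap (a • n))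
    rw [mk_op_smul]
    exact congrArg _ (f.map_left a n).symm)

/-- `f ⊗ id : M ⊗_B N → M' ⊗_B N`. -/
def tensorId [Module A M] [Module Bᵐᵒᵖ M] [Module A M'] [Module Bᵐᵒᵖ M']
    (f : BimodHom A B M M') (N : Type*) [AddCommGroup N] [Module ℂ N] [Module B N] :
    BalTensor B M N →ₗ[ℂ] BalTensor B M' N :=
  lift ((mk B M' N).comp f.toLinearMap) (fun m b n => by
    change mk B M' N (f.toLinearMap (op b • m)) n = mk B M' N (f.toLinearMap m) (b • n)
    rw [← mk_op_smul]
    exact congrArg (fun x => mk B M' N x n) (f.map_right b m))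

end BalTensor

section Associator

variable {V₁ V₂ : Type*} [AddCommGroup V₁] [Module ℂ V₁] [AddCommGroup V₂] [Module ℂ V₂]
  (Q₁ : QuadraticForm ℂ V₁) (Q₂ : QuadraticForm ℂ V₂) (M N P : Type*)
  [AddCommGroup M] [Module ℂ M] [AddCommGroup N] [Module ℂ N] [AddCommGroup P] [Module ℂ P]
  [Module (CliffordAlgebra Q₁)ᵐᵒᵖ M]
  [Module (CliffordAlgebra Q₁) N] [SMulCommClass (CliffordAlgebra Q₁) ℂ N]
  [Module (CliffordAlgebra Q₂)ᵐᵒᵖ N] [SMulCommClass (CliffordAlgebra Q₂)ᵐᵒᵖ ℂ N]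
  [SMulCommClass (CliffordAlgebra Q₁) (CliffordAlgebra Q₂)ᵐᵒᵖ N]
  [Module (CliffordAlgebra Q₂) P]

/-- The map `n ⊗ p ↦ (m ⊗ n) ⊗ p` for a fixed `m`. -/
def BalTensor.assocHomAux (m : M) : BalTensor (CliffordAlgebra Q₂) N P →ₗ[ℂ]
    BalTensor (CliffordAlgebra Q₂) (BalTensor (CliffordAlgebra Q₁) M N) P :=
  BalTensor.lift
    ((BalTensor.mk (CliffordAlgebra Q₂) (BalTensor (CliffordAlgebra Q₁) M N) P).comp
      (BalTensor.mk (CliffordAlgebra Q₁) M N m))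
    (fun n b p => BalTensor.mk_op_smul (BalTensor.mk (CliffordAlgebra Q₁) M N m n) b p)

/-- The associator `M ⊗ (N ⊗ P) → (M ⊗ N) ⊗ P`, `m ⊗ (n ⊗ p) ↦ (m ⊗ n) ⊗ p`. -/
def BalTensor.assocHom :
    BalTensor (CliffordAlgebra Q₁) M (BalTensor (CliffordAlgebra Q₂) N P) →ₗ[ℂ]
      BalTensor (CliffordAlgebra Q₂) (BalTensor (CliffordAlgebra Q₁) M N) P :=
  BalTensor.lift
    ({ toFun := BalTensor.assocHomAux Q₁ Q₂ M N P
       map_add' := fun m m' => BalTensor.ext fun n p => by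
         simp [BalTensor.assocHomAux]
         rfl
       map_smul' := fun c m => BalTensor.ext fun n p => by
         simp [BalTensor.assocHomAux]
         rfl } :
      M →ₗ[ℂ] BalTensor (CliffordAlgebra Q₂) N P →ₗ[ℂ]
        BalTensor (CliffordAlgebra Q₂) (BalTensor (CliffordAlgebra Q₁) M N) P)
    (fun m a x => by
      have h : BalTensor.assocHomAux Q₁ Q₂ M N P (op a • m)
          = (BalTensor.assocHomAux Q₁ Q₂ M N P m).comp
            (Module.toModuleEnd ℂ (BalTensor (CliffordAlgebra Q₂) N P) a) := by
        refine BalTensor.ext fun n p => ?_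
        change BalTensor.mk (CliffordAlgebra Q₂) (BalTensor (CliffordAlgebra Q₁) M N) P
            (BalTensor.mk (CliffordAlgebra Q₁) M N (op a • m) n) p
          = BalTensor.mk (CliffordAlgebra Q₂) (BalTensor (CliffordAlgebra Q₁) M N) P
            (BalTensor.mk (CliffordAlgebra Q₁) M N m (a • n)) p
        rw [BalTensor.mk_op_smul]
      exact LinearMap.congr_fun h x)

theorem BalTensor.assocHom_mk (m : M) (n : N) (p : P) :
    BalTensor.assocHom Q₁ Q₂ M N P
        (BalTensor.mk (CliffordAlgebra Q₁) M (BalTensor (CliffordAlgebra Q₂) N P) m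
          (BalTensor.mk (CliffordAlgebra Q₂) N P n p))
      = BalTensor.mk (CliffordAlgebra Q₂) (BalTensor (CliffordAlgebra Q₁) M N) P
          (BalTensor.mk (CliffordAlgebra Q₁) M N m n) p := rfl

end Associator

end Balanced

/-! ### Top exterior powers -/

section Top

variable (E F : Type*) [AddCommGroup E] [Module ℂ E] [AddCommGroup F] [Module ℂ F]

/-- The determinant line `Λ^top E`. -/
abbrev TopPower : Type _ := ⋀[ℂ]^(Module.finrank ℂ E) E

variable {E F}

/-- The map `Λ^top e` induced by a linear isomorphism `e`. -/
def topMap (e : E ≃ₗ[ℂ] F) : TopPower E →ₗ[ℂ] TopPower F :=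
  (LinearEquiv.ofEq (⋀[ℂ]^(Module.finrank ℂ E) F) (⋀[ℂ]^(Module.finrank ℂ F) F)
      (by rw [e.finrank_eq])).toLinearMap.comp
    (exteriorPower.map (Module.finrank ℂ E) e.toLinearMap)

theorem finrank_topPower [FiniteDimensional ℂ E] : Module.finrank ℂ (TopPower E) = 1 := by
  rw [exteriorPower.finrank_eq, Nat.choose_self]

/-- The exchange `Λ^top E ⊗ Λ^top F → Λ^top F ⊗ Λ^top E` of super vector spaces, with the sign
`(-1)^(dim E dim F)`. -/
def topSwap : TopPower E ⊗[ℂ] TopPower F →ₗ[ℂ] TopPower F ⊗[ℂ] TopPower E :=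
  ((-1 : ℂ) ^ (Module.finrank ℂ E * Module.finrank ℂ F)) •
    (TensorProduct.comm ℂ (TopPower E) (TopPower F)).toLinearMap

end Top

section TopProd

variable (E F : Type*) [NormedAddCommGroup E] [InnerProductSpace ℂ E] [FiniteDimensional ℂ E]
  [NormedAddCommGroup F] [InnerProductSpace ℂ F] [FiniteDimensional ℂ F]

/-- The inclusion `E → E ⊕ F`. -/
def sumInl : E →ₗ[ℂ] WithLp 2 (E × F) :=
  (WithLp.linearEquiv 2 ℂ (E × F)).symm.toLinearMap.comp (LinearMap.inl ℂ E F)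

/-- The inclusion `F → E ⊕ F`. -/
def sumInr : F →ₗ[ℂ] WithLp 2 (E × F) :=
  (WithLp.linearEquiv 2 ℂ (E × F)).symm.toLinearMap.comp (LinearMap.inr ℂ E F)

theorem finrank_sum : Module.finrank ℂ (WithLp 2 (E × F))
    = Module.finrank ℂ E + Module.finrank ℂ F := by
  rw [(WithLp.linearEquiv 2 ℂ (E × F)).finrank_eq, Module.finrank_prod]

/-- The wedge product `Λ^top E ⊗ Λ^top F → Λ^top (E ⊕ F)`, `κ ⊗ μ ↦ κ ∧ μ`. -/
def topWedge : TopPower E ⊗[ℂ] TopPower F →ₗ[ℂ] TopPower (WithLp 2 (E × F)) :=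
  TensorProduct.lift (LinearMap.mk₂ ℂ
    (fun κ μ => ⟨(exteriorPower.map _ (sumInl E F) κ : ExteriorAlgebra ℂ (WithLp 2 (E × F)))
        * (exteriorPower.map _ (sumInr E F) μ : ExteriorAlgebra ℂ (WithLp 2 (E × F))), by
      rw [finrank_sum, ExteriorAlgebra.exteriorPower, pow_add]
      exact Submodule.mul_mem_mul (Subtype.property _) (Subtype.property _)⟩)
    (fun κ κ' μ => Subtype.ext (by simp [add_mul]))
    (fun c κ μ => Subtype.ext (by simp))
    (fun κ μ μ' => Subtype.ext (by simp [mul_add]))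
    (fun c κ μ => Subtype.ext (by simp)))

theorem topWedge_tmul_coe (κ : TopPower E) (μ : TopPower F) :
    (topWedge E F (κ ⊗ₜ μ) : ExteriorAlgebra ℂ (WithLp 2 (E × F)))
      = (exteriorPower.map _ (sumInl E F) κ : ExteriorAlgebra ℂ (WithLp 2 (E × F)))
        * (exteriorPower.map _ (sumInr E F) μ : ExteriorAlgebra ℂ (WithLp 2 (E × F))) := rfl

theorem topWedge_ne_zero : topWedge E F ≠ 0 := by
  intro h
  set b := Module.finBasis ℂ E
  set c := Module.finBasis ℂ F
  let e := (((b.prod c).reindex finSumFinEquiv).map (WithLp.linearEquiv 2 ℂ (E × F)).symm)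
  have h1 := congrArg (fun f => (f (exteriorPower.ιMulti ℂ _ b ⊗ₜ exteriorPower.ιMulti ℂ _ c) :
    ExteriorAlgebra ℂ (WithLp 2 (E × F)))) h
  simp only [topWedge_tmul_coe, exteriorPower.map_apply_ιMulti, exteriorPower.ιMulti_apply_coe,
    ExteriorAlgebra.ιMulti_apply, LinearMap.zero_apply, ZeroMemClass.coe_zero] at h1
  rw [← List.prod_append, ← List.ofFn_fin_append] at h1
  have h2 : exteriorPower.ιMulti ℂ (Module.finrank ℂ E + Module.finrank ℂ F) e = 0 := by
    apply Subtype.ext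
    rw [exteriorPower.ιMulti_apply_coe, ExteriorAlgebra.ιMulti_apply, ZeroMemClass.coe_zero, ← h1]
    congr 2
    funext i
    refine Fin.addCases (fun i => ?_) (fun i => ?_) i
    · simp [e, sumInl]
    · simp [e, sumInr]
  have h3 := congrArg (exteriorPower.alternatingMapLinearEquiv e.det) h2
  rw [exteriorPower.alternatingMapLinearEquiv_apply_ιMulti, map_zero, Module.Basis.det_self] at h3
  exact one_ne_zero h3

/-- The isomorphism `Λ^top E ⊗ Λ^top F ≃ Λ^top (E ⊕ F)`, `κ ⊗ μ ↦ κ ∧ μ`. -/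
def topWedgeEquiv : TopPower E ⊗[ℂ] TopPower F ≃ₗ[ℂ] TopPower (WithLp 2 (E × F)) :=
  LinearEquiv.ofBijective (topWedge E F) (by
    obtain ⟨x, hx⟩ : ∃ x, topWedge E F x ≠ 0 := by
      by_contra! h
      exact topWedge_ne_zero E F (LinearMap.ext h)
    have hx0 : x ≠ 0 := by
      rintro rfl
      exact hx (map_zero _)
    have h1 : Module.finrank ℂ (TopPower E ⊗[ℂ] TopPower F) = 1 := by
      rw [Module.finrank_tensorProduct, finrank_topPower, finrank_topPower]
    constructor
    · intro y z hyz
      obtain ⟨c, rfl⟩ := exists_smul_eq_of_finrank_eq_one h1 hx0 y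
      obtain ⟨d, rfl⟩ := exists_smul_eq_of_finrank_eq_one h1 hx0 z
      rw [map_smul, map_smul] at hyz
      rw [smul_left_injective ℂ hx hyz]
    · intro y
      obtain ⟨c, rfl⟩ := exists_smul_eq_of_finrank_eq_one finrank_topPower hx y
      exact ⟨c • x, map_smul _ c x⟩)

end TopProd

/-! ### Twisting a bimodule by a determinant line -/

section Twist

open MulOpposite

/-- `M ⊗ Λ^top E`, where `M` is a (super) bimodule. -/
def Twist (M E : Type*) [AddCommGroup M] [Module ℂ M] [AddCommGroup E] [Module ℂ E] : Type _ :=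
  M ⊗[ℂ] TopPower E

namespace Twist

variable {M N E F : Type*} [AddCommGroup M] [Module ℂ M] [AddCommGroup N] [Module ℂ N]
  [AddCommGroup E] [Module ℂ E] [AddCommGroup F] [Module ℂ F]
  {V : Type*} [AddCommGroup V] [Module ℂ V] {Q : QuadraticForm ℂ V}

instance : AddCommGroup (Twist M E) := inferInstanceAs (AddCommGroup (M ⊗[ℂ] TopPower E))

instance : Module ℂ (Twist M E) := inferInstanceAs (Module ℂ (M ⊗[ℂ] TopPower E))

variable (M E) in
/-- The element `m ⊗ κ`. -/
def tmul : M →ₗ[ℂ] TopPower E →ₗ[ℂ] Twist M E := TensorProduct.mk ℂ M (TopPower E)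

/-- The left action `a (m ⊗ κ) = a m ⊗ κ`. -/
instance leftModule [Module (CliffordAlgebra Q) M] [SMulCommClass ℂ (CliffordAlgebra Q) M] :
    Module (CliffordAlgebra Q) (Twist M E) :=
  inferInstanceAs (Module (CliffordAlgebra Q) (M ⊗[ℂ] TopPower E))

/-- The right action `(m ⊗ κ) b = (-1)^(|κ| |b|) m b ⊗ κ`, where `|κ| = dim E` and
`b ↦ (-1)^|b| b` is the grading involution of the Clifford algebra. -/
instance rightModule [Module (CliffordAlgebra Q)ᵐᵒᵖ M] [SMulCommClass ℂ (CliffordAlgebra Q)ᵐᵒᵖ M] :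
    Module (CliffordAlgebra Q)ᵐᵒᵖ (Twist M E) :=
  Module.compHom (M ⊗[ℂ] TopPower E)
    (RingHom.op ((CliffordAlgebra.involute ^ Module.finrank ℂ E :
      CliffordAlgebra Q →ₐ[ℂ] CliffordAlgebra Q) : CliffordAlgebra Q →+* CliffordAlgebra Q))

theorem smul_tmul [Module (CliffordAlgebra Q) M] [SMulCommClass ℂ (CliffordAlgebra Q) M]
    (a : CliffordAlgebra Q) (m : M) (κ : TopPower E) : a • tmul M E m κ = tmul M E (a • m) κ := rfl

theorem op_smul_tmul [Module (CliffordAlgebra Q)ᵐᵒᵖ M]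
    [SMulCommClass ℂ (CliffordAlgebra Q)ᵐᵒᵖ M] (b : CliffordAlgebra Q) (m : M) (κ : TopPower E) :
    op b • tmul M E m κ
      = tmul M E (op ((CliffordAlgebra.involute ^ Module.finrank ℂ E :
          CliffordAlgebra Q →ₐ[ℂ] CliffordAlgebra Q) b) • m) κ := rfl

/-- `M ⊗ (Λ^top E ⊗ Λ^top F) → (M ⊗ Λ^top E) ⊗ Λ^top F`. -/
def assoc (M E F : Type*) [AddCommGroup M] [Module ℂ M]
    [AddCommGroup E] [Module ℂ E] [AddCommGroup F] [Module ℂ F] :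
    M ⊗[ℂ] (TopPower E ⊗[ℂ] TopPower F) →ₗ[ℂ] Twist M E ⊗[ℂ] TopPower F :=
  (TensorProduct.assoc ℂ M (TopPower E) (TopPower F)).symm.toLinearMap

/-- `(M ⊗_A N) ⊗ Λ^top E → M ⊗_A (N ⊗ Λ^top E)`, `(m ⊗ n) ⊗ κ ↦ m ⊗ (n ⊗ κ)`. -/
def moveRight (M N E : Type*) [AddCommGroup M] [Module ℂ M] [AddCommGroup N] [Module ℂ N]
    [AddCommGroup E] [Module ℂ E] [Module (CliffordAlgebra Q)ᵐᵒᵖ M] [Module (CliffordAlgebra Q) N]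
    [SMulCommClass ℂ (CliffordAlgebra Q) N] :
    BalTensor (CliffordAlgebra Q) M N ⊗[ℂ] TopPower E →ₗ[ℂ]
      BalTensor (CliffordAlgebra Q) M (Twist N E) :=
  TensorProduct.lift (LinearMap.flip
    ({ toFun := fun κ => BalTensor.lift
        ((BalTensor.mk (CliffordAlgebra Q) M (Twist N E)).compl₂ ((tmul N E).flip κ))
        (fun m a n => BalTensor.mk_op_smul m a (tmul N E n κ))
       map_add' := fun κ μ => BalTensor.ext fun m n => by
         simp
         rfl
       map_smul' := fun c κ => BalTensor.ext fun m n => by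
         simp
         rfl } :
      TopPower E →ₗ[ℂ] BalTensor (CliffordAlgebra Q) M N →ₗ[ℂ]
        BalTensor (CliffordAlgebra Q) M (Twist N E)))

theorem moveRight_mk [Module (CliffordAlgebra Q)ᵐᵒᵖ M] [Module (CliffordAlgebra Q) N]
    [SMulCommClass ℂ (CliffordAlgebra Q) N] (m : M) (n : N) (κ : TopPower E) :
    moveRight M N E (BalTensor.mk (CliffordAlgebra Q) M N m n ⊗ₜ κ)
      = BalTensor.mk (CliffordAlgebra Q) M (Twist N E) m (tmul N E n κ) := rfl

end Twist

theorem Fock.parity_pow_smul {W₀ W₁ : Type*} [NormedAddCommGroup W₀] [InnerProductSpace ℂ W₀]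
    [NormedAddCommGroup W₁] [InnerProductSpace ℂ W₁]
    {J₀ : RealStructure W₀} {J₁ : RealStructure W₁} (L : LagRel J₀ J₁) (n : ℕ) (a : Cl J₀)
    (ξ : Fock L) :
    (Fock.parity L ^ n) (a • ξ)
      = ((CliffordAlgebra.involute ^ n : Cl J₀ →ₐ[ℂ] Cl J₀) a) • (Fock.parity L ^ n) ξ := by
  induction n with
  | zero => rfl
  | succ n ih =>
    rw [pow_succ', pow_succ']
    change Fock.parity L ((Fock.parity L ^ n) (a • ξ)) = _
    rw [ih, Fock.parity_smul]
    rfl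

theorem involute_pow_involute_pow {V : Type*} [AddCommGroup V] [Module ℂ V]
    {Q : QuadraticForm ℂ V} (n : ℕ) (a : CliffordAlgebra Q) :
    (CliffordAlgebra.involute ^ n : CliffordAlgebra Q →ₐ[ℂ] CliffordAlgebra Q)
      ((CliffordAlgebra.involute ^ n : CliffordAlgebra Q →ₐ[ℂ] CliffordAlgebra Q) a) = a := by
  have h : (CliffordAlgebra.involute * CliffordAlgebra.involute :
      CliffordAlgebra Q →ₐ[ℂ] CliffordAlgebra Q) = 1 :=
    CliffordAlgebra.involute_comp_involute
  rw [← AlgHom.mul_apply, ← (Commute.refl _).mul_pow, h, one_pow, AlgHom.one_apply]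

/-- `(M ⊗_A ΛL) ⊗ Λ^top E → (M ⊗ Λ^top E) ⊗_A ΛL`,
`(m ⊗ ξ) ⊗ κ ↦ (-1)^(|κ| |ξ|) (m ⊗ κ) ⊗ ξ`, the exchange of `κ` and `ξ` as elements of super
vector spaces. -/
def Twist.moveLeft {W₀ W₁ : Type*} [NormedAddCommGroup W₀] [InnerProductSpace ℂ W₀]
    [NormedAddCommGroup W₁] [InnerProductSpace ℂ W₁]
    {J₀ : RealStructure W₀} {J₁ : RealStructure W₁} (M E : Type*) [AddCommGroup M] [Module ℂ M]
    [Module (Cl J₀)ᵐᵒᵖ M] [SMulCommClass ℂ (Cl J₀)ᵐᵒᵖ M] (L : LagRel J₀ J₁)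
    [AddCommGroup E] [Module ℂ E] :
    BalTensor (Cl J₀) M (Fock L) ⊗[ℂ] TopPower E →ₗ[ℂ] BalTensor (Cl J₀) (Twist M E) (Fock L) :=
  TensorProduct.lift (LinearMap.flip
    ({ toFun := fun κ => BalTensor.lift
        (((BalTensor.mk (Cl J₀) (Twist M E) (Fock L)).comp ((Twist.tmul M E).flip κ)).compl₂
          (Fock.parity L ^ Module.finrank ℂ E))
        (fun m a ξ => by
          change BalTensor.mk (Cl J₀) (Twist M E) (Fock L) (Twist.tmul M E (op a • m) κ)
              ((Fock.parity L ^ Module.finrank ℂ E) ξ)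
            = BalTensor.mk (Cl J₀) (Twist M E) (Fock L) (Twist.tmul M E m κ)
              ((Fock.parity L ^ Module.finrank ℂ E) (a • ξ))
          rw [Fock.parity_pow_smul, ← BalTensor.mk_op_smul, Twist.op_smul_tmul]
          rw [involute_pow_involute_pow])
       map_add' := fun κ μ => BalTensor.ext fun m n => by simp
       map_smul' := fun c κ => BalTensor.ext fun m n => by simp } :
      TopPower E →ₗ[ℂ] BalTensor (Cl J₀) M (Fock L) →ₗ[ℂ]
        BalTensor (Cl J₀) (Twist M E) (Fock L)))

end Twist

/-! ### Gluing homomorphisms and the development map -/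

section Gluing

variable {W₀ W₁ W₂ W₃ : Type*}
  [NormedAddCommGroup W₀] [InnerProductSpace ℂ W₀]
  [NormedAddCommGroup W₁] [InnerProductSpace ℂ W₁]
  [NormedAddCommGroup W₂] [InnerProductSpace ℂ W₂]
  [NormedAddCommGroup W₃] [InnerProductSpace ℂ W₃]
  {J₀ : RealStructure W₀} {J₁ : RealStructure W₁} {J₂ : RealStructure W₂}

/-- The homomorphisms of `Cl(W₀)`-`Cl(W₂)`-bimodules
`ΛL₀₂ ⊗ Λ^top K → ΛL₀₁ ⊗_{Cl(W₁)} ΛL₁₂`, where `K` is the space belonging to `L₀₁, L₁₂`. -/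
abbrev GluingHom (L₀₁ : LagRel J₀ J₁) (L₁₂ : LagRel J₁ J₂) (L₀₂ : LagRel J₀ J₂) : Type _ :=
  BimodHom (Cl J₀) (Cl J₂) (Twist (Fock L₀₂) (kerSpace L₀₁.carrier L₁₂.carrier))
    (BalTensor (Cl J₁) (Fock L₀₁) (Fock L₁₂))

/-- The normalization
`α(Ω₀₂ ⊗ (u₁ ∧ ⋯ ∧ uₙ)) = (Ω₀₁ · u₁ ⋯ uₙ) ⊗ Ω₁₂` for `u₁, …, uₙ ∈ K`, where `n = dim K`. -/
def IsGluing {L₀₁ : LagRel J₀ J₁} {L₁₂ : LagRel J₁ J₂} {L₀₂ : LagRel J₀ J₂}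
    (α : GluingHom L₀₁ L₁₂ L₀₂) : Prop :=
  ∀ u : Fin (Module.finrank ℂ (kerSpace L₀₁.carrier L₁₂.carrier)) →
      kerSpace L₀₁.carrier L₁₂.carrier,
    α.toLinearMap (Twist.tmul _ _ (Fock.vacuum L₀₂) (exteriorPower.ιMulti ℂ _ u))
      = BalTensor.mk (Cl J₁) (Fock L₀₁) (Fock L₁₂)
          (MulOpposite.op
              (List.ofFn fun i => CliffordAlgebra.ι J₁.quadForm (u i : W₁)).prod •
            Fock.vacuum L₀₁)
          (Fock.vacuum L₁₂)

section Development

variable (L₀₁ : Submodule ℂ (WithLp 2 (W₀ × W₁))) (L₁₂ : Submodule ℂ (WithLp 2 (W₁ × W₂)))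
  (L₂₃ : Submodule ℂ (WithLp 2 (W₂ × W₃))) (L₀₂ : Submodule ℂ (WithLp 2 (W₀ × W₂)))
  (L₁₃ : Submodule ℂ (WithLp 2 (W₁ × W₃)))

/-- The space `K₀₁₂ᗮ ∩ K₀₁₃`. -/
abbrev devSource : Submodule ℂ W₁ := (kerSpace L₀₁ L₁₂)ᗮ ⊓ kerSpace L₀₁ L₁₃

/-- The space `K₁₂₃ᗮ ∩ K₀₂₃`. -/
abbrev devTarget : Submodule ℂ W₂ := (kerSpace L₁₂ L₂₃)ᗮ ⊓ kerSpace L₀₂ L₂₃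

/-- The relation `L₁₂ ∩ ((K₀₁₂ᗮ ∩ K₀₁₃) ⊕ (K₁₂₃ᗮ ∩ K₀₂₃))`. -/
def devRel : Submodule ℂ (devSource L₀₁ L₁₂ L₁₃ × devTarget L₁₂ L₂₃ L₀₂) :=
  L₁₂.comap ((WithLp.linearEquiv 2 ℂ (W₁ × W₂)).symm.toLinearMap.comp
    (LinearMap.prodMap (Submodule.subtype _) (Submodule.subtype _)))

variable {L₀₁ L₁₂ L₂₃ L₀₂ L₁₃}

theorem mem_devRel (x : devSource L₀₁ L₁₂ L₁₃ × devTarget L₁₂ L₂₃ L₀₂) :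
    x ∈ devRel L₀₁ L₁₂ L₂₃ L₀₂ L₁₃ ↔ WithLp.toLp 2 ((x.1 : W₁), (x.2 : W₂)) ∈ L₁₂ := Iff.rfl

theorem toLp_sub {a a' : W₁} {b b' : W₂} (h : WithLp.toLp 2 (a, b) ∈ L₁₂)
    (h' : WithLp.toLp 2 (a', b') ∈ L₁₂) : WithLp.toLp 2 (a - a', b - b') ∈ L₁₂ := by
  have := L₁₂.sub_mem h h'
  rwa [← WithLp.toLp_sub, Prod.mk_sub_mk] at this

/-- The projection of `w` to `Sᗮ ∩ T`, where `S ⊆ T`. -/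
theorem sub_proj_mem {W : Type*} [NormedAddCommGroup W] [InnerProductSpace ℂ W]
    {S T : Submodule ℂ W} [FiniteDimensional ℂ S] (hST : S ≤ T) {w : W} (hw : w ∈ T) :
    w - S.orthogonalProjectionOnto w ∈ Sᗮ ⊓ T := by
  refine ⟨?_, T.sub_mem hw (hST (Submodule.coe_mem _))⟩
  have := Submodule.sub_starProjection_mem_orthogonal (K := S) w
  rwa [Submodule.starProjection_apply] at this

theorem devRel_fst_bijective [FiniteDimensional ℂ (kerSpace L₁₂ L₂₃)]
    (h₀₂ : L₀₂ = relComp L₀₁ L₁₂) (h₁₃ : L₁₃ = relComp L₁₂ L₂₃) : Function.Bijective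
    ((LinearMap.fst ℂ _ _).comp (devRel L₀₁ L₁₂ L₂₃ L₀₂ L₁₃).subtype) := by
  constructor
  · rw [← LinearMap.ker_eq_bot, LinearMap.ker_eq_bot']
    rintro ⟨⟨u, v⟩, hx⟩ h
    obtain rfl : u = 0 := h
    have hv : (v : W₂) ∈ kerSpace L₁₂ L₂₃ := ⟨hx, v.2.2.2⟩
    have hv0 : (v : W₂) = 0 := inner_self_eq_zero.1 (v.2.1 _ hv)
    apply Subtype.ext
    exact Prod.ext rfl (Subtype.ext hv0)
  · rintro ⟨u, hu, hu'⟩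
    obtain ⟨h1, h2⟩ := hu'
    rw [h₁₃] at h2
    obtain ⟨w, hw, hw'⟩ := h2
    have hwK : w ∈ kerSpace L₀₂ L₂₃ := ⟨h₀₂ ▸ ⟨u, h1, hw⟩, hw'⟩
    have hle : kerSpace L₁₂ L₂₃ ≤ kerSpace L₀₂ L₂₃ := h₀₂ ▸ kerSpace_le_right L₀₁ L₁₂ L₂₃
    refine ⟨⟨(⟨u, hu, ⟨h1, h₁₃ ▸ ⟨w, hw, hw'⟩⟩⟩, ⟨_, sub_proj_mem hle hwK⟩), ?_⟩, rfl⟩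
    have hp := ((kerSpace L₁₂ L₂₃).orthogonalProjectionOnto w).2.1
    have := toLp_sub hw hp
    rwa [sub_zero] at this

theorem devRel_snd_bijective [FiniteDimensional ℂ (kerSpace L₀₁ L₁₂)]
    (h₀₂ : L₀₂ = relComp L₀₁ L₁₂) (h₁₃ : L₁₃ = relComp L₁₂ L₂₃) : Function.Bijective
    ((LinearMap.snd ℂ _ _).comp (devRel L₀₁ L₁₂ L₂₃ L₀₂ L₁₃).subtype) := by
  constructor
  · rw [← LinearMap.ker_eq_bot, LinearMap.ker_eq_bot']
    rintro ⟨⟨u, v⟩, hx⟩ h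
    obtain rfl : v = 0 := h
    have hu : (u : W₁) ∈ kerSpace L₀₁ L₁₂ := ⟨u.2.2.1, hx⟩
    have hu0 : (u : W₁) = 0 := inner_self_eq_zero.1 (u.2.1 _ hu)
    apply Subtype.ext
    exact Prod.ext (Subtype.ext hu0) rfl
  · rintro ⟨v, hv, hv'⟩
    obtain ⟨h1, h2⟩ := hv'
    rw [h₀₂] at h1
    obtain ⟨w, hw, hw'⟩ := h1
    have hwK : w ∈ kerSpace L₀₁ L₁₃ := ⟨hw, h₁₃ ▸ ⟨v, hw', h2⟩⟩
    have hle : kerSpace L₀₁ L₁₂ ≤ kerSpace L₀₁ L₁₃ := h₁₃ ▸ kerSpace_le_left L₀₁ L₁₂ L₂₃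
    refine ⟨⟨(⟨_, sub_proj_mem hle hwK⟩, ⟨v, hv, ⟨h₀₂ ▸ ⟨w, hw, hw'⟩, h2⟩⟩), ?_⟩, rfl⟩
    have hp := ((kerSpace L₀₁ L₁₂).orthogonalProjectionOnto w).2.2
    have := toLp_sub hw' hp
    rwa [sub_zero] at this

/-- The isomorphism `ρ₀ : K₀₁₂ᗮ ∩ K₀₁₃ ≃ K₁₂₃ᗮ ∩ K₀₂₃` whose graph is the relation `devRel`. -/
def devIso₀ [FiniteDimensional ℂ (kerSpace L₀₁ L₁₂)] [FiniteDimensional ℂ (kerSpace L₁₂ L₂₃)]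
    (h₀₂ : L₀₂ = relComp L₀₁ L₁₂) (h₁₃ : L₁₃ = relComp L₁₂ L₂₃) :
    devSource L₀₁ L₁₂ L₁₃ ≃ₗ[ℂ] devTarget L₁₂ L₂₃ L₀₂ :=
  (LinearEquiv.ofBijective _ (devRel_fst_bijective h₀₂ h₁₃)).symm ≪≫ₗ
    LinearEquiv.ofBijective _ (devRel_snd_bijective h₀₂ h₁₃)

theorem devIso₀_mem [FiniteDimensional ℂ (kerSpace L₀₁ L₁₂)]
    [FiniteDimensional ℂ (kerSpace L₁₂ L₂₃)]
    (h₀₂ : L₀₂ = relComp L₀₁ L₁₂) (h₁₃ : L₁₃ = relComp L₁₂ L₂₃) (u : devSource L₀₁ L₁₂ L₁₃) :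
    WithLp.toLp 2 ((u : W₁), (devIso₀ h₀₂ h₁₃ u : W₂)) ∈ L₁₂ := by
  set x := (LinearEquiv.ofBijective _ (devRel_fst_bijective h₀₂ h₁₃)).symm u with hx
  have h := x.2
  have hu : x.1.1 = u :=
    (LinearEquiv.ofBijective _ (devRel_fst_bijective h₀₂ h₁₃)).apply_symm_apply u
  rw [mem_devRel, hu] at h
  exact h

/-- The orthogonal decomposition `T = S ⊕ (Sᗮ ∩ T)`, where `S ⊆ T`. -/
def splitEquiv {W : Type*} [NormedAddCommGroup W] [InnerProductSpace ℂ W]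
    {S T : Submodule ℂ W} [FiniteDimensional ℂ S] (hST : S ≤ T) :
    T ≃ₗ[ℂ] S × (Sᗮ ⊓ T : Submodule ℂ W) where
  toFun w := (S.orthogonalProjectionOnto w,
    ⟨w - S.orthogonalProjectionOnto (w : W), sub_proj_mem hST w.2⟩)
  invFun x := ⟨x.1 + x.2, T.add_mem (hST x.1.2) x.2.2.2⟩
  map_add' v w := by
    refine Prod.ext (by simp) (Subtype.ext ?_)
    simp only [Submodule.coe_add, map_add, Prod.snd_add]
    abel
  map_smul' c w := by
    refine Prod.ext (by simp) (Subtype.ext ?_)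
    simp [smul_sub]
  left_inv w := Subtype.ext (by simp)
  right_inv x := by
    have h : S.orthogonalProjectionOnto ((x.1 : W) + (x.2 : W)) = x.1 := by
      rw [map_add, Submodule.orthogonalProjectionOnto_mem_subspace_eq_self,
        Submodule.orthogonalProjectionOnto_apply_of_mem_orthogonal x.2.2.1,
        add_zero]
    refine Prod.ext h (Subtype.ext ?_)
    simp [h]

/-- The development map `ρ : K₀₁₃ ⊕ K₁₂₃ ≃ K₀₁₂ ⊕ K₀₂₃`,
`(u₁ + v, u₂) ↦ (u₁, u₂ + ρ₀ v)` for `u₁ ∈ K₀₁₂`, `v ∈ K₀₁₂ᗮ ∩ K₀₁₃` and `u₂ ∈ K₁₂₃`. -/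
def devMap [FiniteDimensional ℂ (kerSpace L₀₁ L₁₂)] [FiniteDimensional ℂ (kerSpace L₁₂ L₂₃)]
    (h₀₂ : L₀₂ = relComp L₀₁ L₁₂) (h₁₃ : L₁₃ = relComp L₁₂ L₂₃) :
    WithLp 2 (kerSpace L₀₁ L₁₃ × kerSpace L₁₂ L₂₃) ≃ₗ[ℂ]
      WithLp 2 (kerSpace L₀₁ L₁₂ × kerSpace L₀₂ L₂₃) :=
  WithLp.linearEquiv 2 ℂ _ ≪≫ₗ
    ((splitEquiv (h₁₃ ▸ kerSpace_le_left L₀₁ L₁₂ L₂₃ :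
        kerSpace L₀₁ L₁₂ ≤ kerSpace L₀₁ L₁₃)).prodCongr (LinearEquiv.refl ℂ _)) ≪≫ₗ
    LinearEquiv.prodAssoc ℂ _ _ _ ≪≫ₗ
    ((LinearEquiv.refl ℂ _).prodCongr
      (((devIso₀ h₀₂ h₁₃).prodCongr (LinearEquiv.refl ℂ _)) ≪≫ₗ
        LinearEquiv.prodComm ℂ _ _ ≪≫ₗ
        (splitEquiv (h₀₂ ▸ kerSpace_le_right L₀₁ L₁₂ L₂₃ :
          kerSpace L₁₂ L₂₃ ≤ kerSpace L₀₂ L₂₃)).symm)) ≪≫ₗ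
    (WithLp.linearEquiv 2 ℂ _).symm

/-- The defining formula of the development map. -/
theorem devMap_apply [FiniteDimensional ℂ (kerSpace L₀₁ L₁₂)]
    [FiniteDimensional ℂ (kerSpace L₁₂ L₂₃)]
    (h₀₂ : L₀₂ = relComp L₀₁ L₁₂) (h₁₃ : L₁₃ = relComp L₁₂ L₂₃)
    (x : kerSpace L₀₁ L₁₃) (u₁ : kerSpace L₀₁ L₁₂) (v : devSource L₀₁ L₁₂ L₁₃)
    (u₂ : kerSpace L₁₂ L₂₃) (hx : (x : W₁) = u₁ + v) :
    (devMap h₀₂ h₁₃ (WithLp.toLp 2 (x, u₂))).fst = u₁ ∧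
      ((devMap h₀₂ h₁₃ (WithLp.toLp 2 (x, u₂))).snd : W₂) = u₂ + devIso₀ h₀₂ h₁₃ v := by
  have hle : kerSpace L₀₁ L₁₂ ≤ kerSpace L₀₁ L₁₃ := h₁₃ ▸ kerSpace_le_left L₀₁ L₁₂ L₂₃
  have hs : splitEquiv hle x = (u₁, v) := by
    rw [← LinearEquiv.eq_symm_apply]
    exact Subtype.ext hx
  have e : devMap h₀₂ h₁₃ (WithLp.toLp 2 (x, u₂))
      = WithLp.toLp 2 ((splitEquiv hle x).1,
        (splitEquiv (h₀₂ ▸ kerSpace_le_right L₀₁ L₁₂ L₂₃ :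
          kerSpace L₁₂ L₂₃ ≤ kerSpace L₀₂ L₂₃)).symm
            (u₂, devIso₀ h₀₂ h₁₃ (splitEquiv hle x).2)) := rfl
  rw [e, hs]
  exact ⟨rfl, rfl⟩

/-- The scalar `det (ρ* ρ)`, with `ρ*` the adjoint with respect to the inner products on the
orthogonal direct sums. -/
def devDet [FiniteDimensional ℂ (kerSpace L₀₁ L₁₂)] [FiniteDimensional ℂ (kerSpace L₁₂ L₂₃)]
    [FiniteDimensional ℂ (kerSpace L₀₁ L₁₃)] [FiniteDimensional ℂ (kerSpace L₀₂ L₂₃)]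
    (h₀₂ : L₀₂ = relComp L₀₁ L₁₂) (h₁₃ : L₁₃ = relComp L₁₂ L₂₃) : ℂ :=
  LinearMap.det ((LinearMap.adjoint (devMap h₀₂ h₁₃).toLinearMap).comp
    (devMap h₀₂ h₁₃).toLinearMap)

end Development

end Gluing

end

/-!
The gluing homomorphism exists because `ΛL₀₂` is the Clifford module of `W₀ ⊕ -W₂` induced from a
vacuum killed by `conj L₀₂ = L₀₂ᗮ`: a vector `n` of any Clifford module that is killed by
`conj L₀₂` extends to a module homomorphism `ΛL₀₂ → N` (`Fock.liftOfAction_cliff`). The bimodule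
`ΛL₀₁ ⊗_{Cl(W₁)} ΛL₁₂` is such a module, `(w₀, w₂)` acting by `x ↦ w₀ x + (-1)^|x| x w₂`
(`Fock.pairAction_pairAction`), and `Ω₀₁ · κ ⊗ Ω₁₂` is killed by `conj L₀₂`: an element
`(v₀, v₂) ∈ L₀₂` passes through some `v₁ ∈ W₁`, which can be taken orthogonal to the
finite-dimensional space `K`, so that `conj v₁` supercommutes with `κ ∈ Λ^top K` and moves from one
vacuum to the other (`Fock.pairAction_gluedVacuum`). Uniqueness holds since the vacuum generates
`ΛL₀₂` as a bimodule (`Fock.span_smul_vacuum`).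

For the coherence statement it is enough to evaluate both composites on `a · Ω₀₃ · b` tensored with
one nonzero element of the determinant line. That element is `κ ∧ σ ∧ μ`, with `κ` and `μ` spanning
`Λ^top K₀₁₂` and `Λ^top K₁₂₃`, and `σ = v₁ ∧ ⋯ ∧ v_q` for an orthonormal basis of
`K₀₁₂ᗮ ∩ K₀₁₃` that diagonalizes `ρ₀* ρ₀`. With `wᵢ = ρ₀ vᵢ` the two values are
`Ω₀₁ κ v₁ ⋯ v_q ⊗ Ω₁₂ μ ⊗ Ω₂₃` and `det(ρ* ρ)⁻¹ Ω₀₁ κ ⊗ Ω₁₂ w₁ ⋯ w_q μ ⊗ Ω₂₃`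
(`left_composite_apply`, `right_composite_apply`). As `(vᵢ, wᵢ) ∈ L₁₂`, the element `conj vᵢ` on the
left of `Ω₁₂` equals `conj wᵢ` on its right. Inserting `conj wᵢ · wᵢ` and moving `conj wᵢ` in either
direction shows that replacing `vᵢ` by `wᵢ` costs the factor `|wᵢ|²`
(`tripleTensor_move`), and the product of these factors is `det(ρ₀* ρ₀) = det(ρ* ρ)`
(`devDet_eq`).
-/

noncomputable section

open MulOpposite

/-! ### Exterior algebras of isotropic subspaces inside Clifford algebras -/

theorem ExteriorAlgebra.involute_of_mem {E : Type*} [AddCommGroup E] [Module ℂ E] {n : ℕ}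
    {x : ExteriorAlgebra ℂ E} (hx : x ∈ ⋀[ℂ]^n E) :
    (CliffordAlgebra.involute x : ExteriorAlgebra ℂ E) = (-1 : ℂ) ^ n • x := by
  induction n generalizing x with
  | zero =>
    rw [ExteriorAlgebra.exteriorPower, pow_zero] at hx
    obtain ⟨r, rfl⟩ := Submodule.mem_one.1 hx
    rw [pow_zero, one_smul]
    exact AlgHom.commutes _ r
  | succ n ih =>
    rw [ExteriorAlgebra.exteriorPower, pow_succ'] at hx
    induction hx using Submodule.mul_induction_on' with
    | mem_mul_mem y hy z hz =>
      obtain ⟨v, rfl⟩ := hy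
      have h : (CliffordAlgebra.involute (ExteriorAlgebra.ι ℂ v) : ExteriorAlgebra ℂ E)
          = -ExteriorAlgebra.ι ℂ v := CliffordAlgebra.involute_ι v
      refine (map_mul CliffordAlgebra.involute _ _).trans ?_
      rw [h, ih hz, pow_succ', mul_smul_comm, neg_mul, neg_one_mul, neg_smul, smul_neg]
    | add y hy z hz h1 h2 =>
      refine (map_add CliffordAlgebra.involute _ _).trans ?_
      rw [h1, h2, smul_add]

section Isotropic

variable {W : Type*} [NormedAddCommGroup W] [InnerProductSpace ℂ W] (J : RealStructure W)
  {E F : Type*} [AddCommGroup E] [Module ℂ E] [AddCommGroup F] [Module ℂ F]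

/-- The algebra homomorphism `ΛE → Cl(W)` extending a linear map `φ : E → W` with isotropic
image. -/
def isotropicHom (φ : E →ₗ[ℂ] W) (hφ : ∀ e, J.quadForm (φ e) = 0) :
    ExteriorAlgebra ℂ E →ₐ[ℂ] Cl J :=
  ExteriorAlgebra.lift ℂ ⟨(CliffordAlgebra.ι J.quadForm).comp φ, fun e => by
    rw [LinearMap.comp_apply, CliffordAlgebra.ι_sq_scalar, hφ, map_zero]⟩

variable {J}

theorem isotropicHom_ι {φ : E →ₗ[ℂ] W} (hφ : ∀ e, J.quadForm (φ e) = 0) (e : E) :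
    isotropicHom J φ hφ (ExteriorAlgebra.ι ℂ e) = CliffordAlgebra.ι J.quadForm (φ e) :=
  ExteriorAlgebra.lift_ι_apply _ _ _ _

theorem isotropicHom_map {φ : E →ₗ[ℂ] W} (hφ : ∀ e, J.quadForm (φ e) = 0) (g : F →ₗ[ℂ] E)
    {ψ : F →ₗ[ℂ] W} (hψ : ∀ e, J.quadForm (ψ e) = 0) (h : φ ∘ₗ g = ψ)
    (x : ExteriorAlgebra ℂ F) :
    isotropicHom J φ hφ (ExteriorAlgebra.map g x) = isotropicHom J ψ hψ x := by
  subst h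
  refine AlgHom.congr_fun (φ₁ := (isotropicHom J φ hφ).comp (ExteriorAlgebra.map g)) ?_ x
  ext e
  simp [isotropicHom_ι]

theorem involute_isotropicHom {φ : E →ₗ[ℂ] W} (hφ : ∀ e, J.quadForm (φ e) = 0)
    (x : ExteriorAlgebra ℂ E) :
    CliffordAlgebra.involute (isotropicHom J φ hφ x)
      = isotropicHom J φ hφ (CliffordAlgebra.involute x) := by
  refine AlgHom.congr_fun (φ₁ := CliffordAlgebra.involute.comp (isotropicHom J φ hφ))
    (φ₂ := (isotropicHom J φ hφ).comp CliffordAlgebra.involute) ?_ x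
  refine ExteriorAlgebra.hom_ext (LinearMap.ext fun e => ?_)
  have h : (CliffordAlgebra.involute (ExteriorAlgebra.ι ℂ e) : ExteriorAlgebra ℂ E)
      = -ExteriorAlgebra.ι ℂ e := CliffordAlgebra.involute_ι e
  change CliffordAlgebra.involute (isotropicHom J φ hφ (ExteriorAlgebra.ι ℂ e))
    = isotropicHom J φ hφ (CliffordAlgebra.involute (ExteriorAlgebra.ι ℂ e))
  rw [h, map_neg, isotropicHom_ι, CliffordAlgebra.involute_ι]

theorem involute_isotropicHom_of_mem {φ : E →ₗ[ℂ] W} (hφ : ∀ e, J.quadForm (φ e) = 0) {n : ℕ}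
    {x : ExteriorAlgebra ℂ E} (hx : x ∈ ⋀[ℂ]^n E) :
    CliffordAlgebra.involute (isotropicHom J φ hφ x) = (-1 : ℂ) ^ n • isotropicHom J φ hφ x := by
  rw [involute_isotropicHom, ExteriorAlgebra.involute_of_mem hx, map_smul]

theorem involute_pow_isotropicHom {φ : E →ₗ[ℂ] W} (hφ : ∀ e, J.quadForm (φ e) = 0) {n : ℕ}
    {x : ExteriorAlgebra ℂ E} (hx : x ∈ ⋀[ℂ]^n E) (p : ℕ) :
    (CliffordAlgebra.involute ^ p : Cl J →ₐ[ℂ] Cl J) (isotropicHom J φ hφ x)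
      = (-1 : ℂ) ^ (p * n) • isotropicHom J φ hφ x := by
  induction p with
  | zero => rw [zero_mul, pow_zero (-1 : ℂ), one_smul]; rfl
  | succ p ih =>
    rw [pow_succ, AlgHom.mul_apply, involute_isotropicHom_of_mem hφ hx, map_smul, ih, smul_smul,
      ← pow_add, Nat.succ_mul, add_comm]

theorem Cl.ι_mul_ι (v w : W) :
    CliffordAlgebra.ι J.quadForm v * CliffordAlgebra.ι J.quadForm w
      = algebraMap ℂ (Cl J) (J.form v w)
        - CliffordAlgebra.ι J.quadForm w * CliffordAlgebra.ι J.quadForm v :=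
  eq_sub_of_add_eq (Cl.relation J v w)

/-- A vector that is `b`-orthogonal to the image of `φ` supercommutes with the image of `ΛE`. -/
theorem ι_mul_isotropicHom {φ : E →ₗ[ℂ] W} (hφ : ∀ e, J.quadForm (φ e) = 0) {z : W}
    (hz : ∀ e, J.form z (φ e) = 0) (x : ExteriorAlgebra ℂ E) :
    CliffordAlgebra.ι J.quadForm z * isotropicHom J φ hφ x
      = isotropicHom J φ hφ (CliffordAlgebra.involute x) * CliffordAlgebra.ι J.quadForm z := by
  induction x using CliffordAlgebra.left_induction with
  | algebraMap r =>
    have h : isotropicHom J φ hφ (algebraMap ℂ (ExteriorAlgebra ℂ E) r) = algebraMap ℂ (Cl J) r :=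
      AlgHom.commutes _ _
    rw [AlgHom.commutes, AlgHom.commutes]
    exact (Algebra.commutes _ _).symm.trans
      (congrArg (· * CliffordAlgebra.ι J.quadForm z) h.symm)
  | add x y hx hy =>
    rw [map_add, map_add, mul_add, hx, hy, ← add_mul, ← map_add, ← map_add]
  | ι_mul x e hx =>
    have h1 : isotropicHom J φ hφ (CliffordAlgebra.ι 0 e * x)
        = CliffordAlgebra.ι J.quadForm (φ e) * isotropicHom J φ hφ x :=
      (map_mul _ _ _).trans (by rw [← isotropicHom_ι hφ])
    have h2 : isotropicHom J φ hφ (CliffordAlgebra.involute (CliffordAlgebra.ι 0 e * x))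
        = -(CliffordAlgebra.ι J.quadForm (φ e)
          * isotropicHom J φ hφ (CliffordAlgebra.involute x)) := by
      rw [← involute_isotropicHom, h1, map_mul, CliffordAlgebra.involute_ι,
        involute_isotropicHom, neg_mul]
    rw [h1, h2, ← mul_assoc, Cl.ι_mul_ι, hz, map_zero, zero_sub, neg_mul, mul_assoc, hx, neg_mul,
      mul_assoc]

/-- The Clifford product of a family of vectors with isotropic span. -/
theorem isotropicHom_ιMulti {φ : E →ₗ[ℂ] W} (hφ : ∀ e, J.quadForm (φ e) = 0) {n : ℕ}
    (u : Fin n → E) :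
    isotropicHom J φ hφ (exteriorPower.ιMulti ℂ n u : ExteriorAlgebra ℂ E)
      = (List.ofFn fun i => CliffordAlgebra.ι J.quadForm (φ (u i))).prod := by
  rw [exteriorPower.ιMulti_apply_coe, ExteriorAlgebra.ιMulti_apply, map_list_prod,
    List.map_ofFn]
  congr 2
  funext i
  exact isotropicHom_ι hφ (u i)

end Isotropic

/-! ### The Fock module as an induced Clifford module -/

namespace Fock

section Single

variable {W : Type*} [NormedAddCommGroup W] [InnerProductSpace ℂ W] {J : RealStructure W}
  (L : Lagrangian J)

theorem parity_vacuum : parity L (vacuum L) = vacuum L :=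
  map_one (CliffordAlgebra.involute : ExteriorAlgebra ℂ L.carrier →ₐ[ℂ] _)

theorem insertion_vacuum (d : Module.Dual ℂ L.carrier) : insertion L d (vacuum L) = 0 :=
  CliffordAlgebra.contractLeft_one _ d

variable {L}

theorem form_eq_zero_of_mem {v w : W} (hv : v ∈ L.carrier) (hw : w ∈ L.carrier) :
    J.form v w = 0 := by
  rw [J.form_comm, RealStructure.form_apply]
  have h1 : J.conj w ∈ L.carrierᗮ := by
    rwa [← L.conj_mem_iff, J.conj_conj]
  exact Submodule.inner_left_of_mem_orthogonal hv h1

theorem quadForm_eq_zero_of_mem {v : W} (hv : v ∈ L.carrier) : J.quadForm v = 0 := by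
  rw [RealStructure.quadForm_apply, form_eq_zero_of_mem hv hv, mul_zero]

theorem cliff_of_mem {v : W} (hv : v ∈ L.carrier) (ξ : Fock L) :
    cliff L v ξ = wedge L ⟨v, hv⟩ ξ := by
  have h : (J.form v).comp L.carrier.subtype = 0 :=
    LinearMap.ext fun x => form_eq_zero_of_mem hv x.2
  rw [cliff_apply, h, map_zero, LinearMap.zero_apply, add_zero,
    Submodule.orthogonalProjectionOnto_mem_subspace_eq_self (⟨v, hv⟩ : L.carrier)]

theorem cliff_of_mem_orthogonal {w : W} (hw : w ∈ L.carrierᗮ) (ξ : Fock L) :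
    cliff L w ξ = insertion L ((J.form w).comp L.carrier.subtype) ξ := by
  rw [cliff_apply, Submodule.orthogonalProjectionOnto_apply_of_mem_orthogonal hw, map_zero,
    LinearMap.zero_apply, zero_add]

theorem cliff_vacuum_of_mem_orthogonal {w : W} (hw : w ∈ L.carrierᗮ) :
    cliff L w (vacuum L) = 0 := by
  rw [cliff_of_mem_orthogonal hw, insertion_vacuum]

theorem wedge_induction {p : Fock L → Prop} (vac : p (vacuum L))
    (smul : ∀ (c : ℂ) ξ, p ξ → p (c • ξ)) (add : ∀ ξ η, p ξ → p η → p (ξ + η))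
    (wedge : ∀ v ξ, p ξ → p (wedge L v ξ)) (ξ : Fock L) : p ξ := by
  change ExteriorAlgebra ℂ L.carrier at ξ
  refine CliffordAlgebra.left_induction (Q := (0 : QuadraticForm ℂ L.carrier)) (P := p)
    (fun r => ?_) add
    (fun x (v : L.carrier) h => wedge v x h) ξ
  have := smul r _ vac
  change p (r • (1 : ExteriorAlgebra ℂ L.carrier)) at this
  rwa [← Algebra.algebraMap_eq_smul_one] at this

/-- The algebra homomorphism `ΛL → End N` given by an action of `W` on `N` by operators that
satisfy the Clifford relations; on `L` these operators anticommute. -/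
def actionHom {N : Type*} [AddCommGroup N] [Module ℂ N] (c : W →ₗ[ℂ] Module.End ℂ N)
    (hc : ∀ w x, c w (c w x) = J.quadForm w • x) :
    ExteriorAlgebra ℂ L.carrier →ₐ[ℂ] Module.End ℂ N :=
  ExteriorAlgebra.lift ℂ ⟨c ∘ₗ L.carrier.subtype, fun v => by
    ext x
    change c v (c v x) = 0
    rw [hc, quadForm_eq_zero_of_mem v.2, zero_smul]⟩

/-- A Clifford module homomorphism out of `ΛL`: for an action `c` of `W` by operators that satisfy
the Clifford relations and a family `n` of vectors killed by `Lᗮ = conj L`, the map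
`v₁ ∧ ⋯ ∧ vₘ ⊗ κ ↦ c(v₁) ⋯ c(vₘ) n(κ)`. -/
def liftOfAction {N T : Type*} [AddCommGroup N] [Module ℂ N] [AddCommGroup T] [Module ℂ T]
    (c : W →ₗ[ℂ] Module.End ℂ N)
    (hc : ∀ w x, c w (c w x) = J.quadForm w • x) (n : T →ₗ[ℂ] N) : Fock L →ₗ[ℂ] T →ₗ[ℂ] N :=
  (LinearMap.lcomp ℂ N n).comp (actionHom (L := L) c hc).toLinearMap

section Lift

variable {N T : Type*} [AddCommGroup N] [Module ℂ N] [AddCommGroup T] [Module ℂ T]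
    {c : W →ₗ[ℂ] Module.End ℂ N} (hc : ∀ w x, c w (c w x) = J.quadForm w • x) {n : T →ₗ[ℂ] N}

theorem liftOfAction_vacuum (t : T) : liftOfAction (L := L) c hc n (vacuum L) t = n t := by
  change actionHom (L := L) c hc 1 (n t) = _
  rw [map_one, Module.End.one_apply]

theorem liftOfAction_wedge (v : L.carrier) (ξ : Fock L) (t : T) :
    liftOfAction c hc n (wedge L v ξ) t = c v (liftOfAction c hc n ξ t) := by
  have h : ∀ x : ExteriorAlgebra ℂ L.carrier, actionHom c hc (ExteriorAlgebra.ι ℂ v * x) (n t)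
      = c v (actionHom c hc x (n t)) := fun x => by
    rw [map_mul, actionHom, ExteriorAlgebra.lift_ι_apply, Module.End.mul_apply]
    rfl
  exact h ξ

theorem action_add_swap (hc : ∀ w x, c w (c w x) = J.quadForm w • x) (v w : W) (x : N) :
    c v (c w x) = J.form v w • x - c w (c v x) := by
  have h := hc (v + w) x
  have hp : J.quadForm (v + w) = J.quadForm v + J.quadForm w + J.form v w := by
    simp only [RealStructure.quadForm_apply, map_add, LinearMap.add_apply, J.form_comm w v]
    ring
  simp only [map_add, LinearMap.add_apply, hp, add_smul, hc] at h
  rw [eq_sub_iff_add_eq]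
  have h' := sub_eq_zero.2 h
  rw [← sub_eq_zero, ← h']
  abel

theorem liftOfAction_cliff (hn : ∀ w ∈ L.carrierᗮ, ∀ t, c w (n t) = 0) (w : W) (ξ : Fock L)
    (t : T) : liftOfAction c hc n (cliff L w ξ) t = c w (liftOfAction c hc n ξ t) := by
  have hperp : ∀ w ∈ L.carrierᗮ,
      liftOfAction c hc n (cliff L w ξ) t = c w (liftOfAction c hc n ξ t) := fun w hw => by
    induction ξ using wedge_induction with
    | vac =>
      rw [cliff_vacuum_of_mem_orthogonal hw, map_zero, liftOfAction_vacuum, hn w hw,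
        LinearMap.zero_apply]
    | smul r ξ ih => simp only [map_smul, LinearMap.smul_apply, ih]
    | add ξ η h1 h2 => simp only [map_add, LinearMap.add_apply, h1, h2]
    | wedge v ξ ih =>
      rw [cliff_of_mem_orthogonal hw] at ih ⊢
      rw [insertion_wedge, map_sub, LinearMap.sub_apply, liftOfAction_wedge, ih,
        liftOfAction_wedge, action_add_swap hc w v, map_smul]
      rfl
  have hsplit : w = L.carrier.starProjection w + (w - L.carrier.starProjection w) := by abel
  have hmem : L.carrier.starProjection w ∈ L.carrier := by
    rw [Submodule.starProjection_apply]
    exact Submodule.coe_mem _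
  rw [hsplit, map_add, LinearMap.add_apply, map_add, LinearMap.add_apply,
    hperp _ (Submodule.sub_starProjection_mem_orthogonal (K := L.carrier) w),
    cliff_of_mem hmem, liftOfAction_wedge, map_add, LinearMap.add_apply]

end Lift

end Single

section Bimodule

variable {W₀ W₁ : Type*}
  [NormedAddCommGroup W₀] [InnerProductSpace ℂ W₀]
  [NormedAddCommGroup W₁] [InnerProductSpace ℂ W₁]
  {J₀ : RealStructure W₀} {J₁ : RealStructure W₁} {L : LagRel J₀ J₁}

theorem parity_op_smul (b : Cl J₁) (ξ : Fock L) :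
    parity L (op b • ξ) = op (CliffordAlgebra.involute b) • parity L ξ := by
  induction b using CliffordAlgebra.induction generalizing ξ with
  | algebraMap r =>
    rw [AlgHom.commutes, ← MulOpposite.algebraMap_apply, algebraMap_smul, algebraMap_smul,
      map_smul]
  | add x y hx hy => rw [op_add, add_smul, map_add, map_add, op_add, add_smul, hx, hy]
  | mul x y hx hy => rw [op_mul, mul_smul, map_mul, op_mul, mul_smul, hy, hx]
  | ι v => rw [CliffordAlgebra.involute_ι, op_neg, neg_smul, op_ι_smul, op_ι_smul, parity_cliff]

theorem parity_pow_op_smul_vacuum (n : ℕ) (b : Cl J₁) :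
    (parity L ^ n) (op b • vacuum L)
      = op ((CliffordAlgebra.involute ^ n : Cl J₁ →ₐ[ℂ] Cl J₁) b) • vacuum L := by
  induction n with
  | zero => rfl
  | succ n ih =>
    rw [pow_succ', pow_succ', Module.End.mul_apply, ih, parity_op_smul, parity_vacuum]
    rfl

/-- The element `(w₀, w₁) ∈ W₀ ⊕ -W₁` acts as `ξ ↦ w₀ ξ + (-1)^|ξ| ξ w₁`. -/
theorem cliff_toLp (w₀ : W₀) (w₁ : W₁) (ξ : Fock L) :
    cliff L (WithLp.toLp 2 (w₀, w₁)) ξ = CliffordAlgebra.ι J₀.quadForm w₀ • ξ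
      + op (CliffordAlgebra.ι J₁.quadForm w₁) • parity L ξ := by
  rw [ι_smul, op_ι_smul, parity_parity, ← LinearMap.add_apply, ← map_add, ← WithLp.toLp_add,
    Prod.mk_add_mk, add_zero, zero_add]

theorem ι_smul_vacuum {w₀ : W₀} {w₁ : W₁} (h : WithLp.toLp 2 (w₀, w₁) ∈ L.carrierᗮ) :
    CliffordAlgebra.ι J₀.quadForm w₀ • vacuum L
      = -(op (CliffordAlgebra.ι J₁.quadForm w₁) • vacuum L) := by
  have h' := cliff_vacuum_of_mem_orthogonal h
  rwa [cliff_toLp, parity_vacuum, ← eq_neg_iff_add_eq_zero] at h'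

theorem conj_mem_orthogonal {w₀ : W₀} {w₁ : W₁} (h : WithLp.toLp 2 (w₀, w₁) ∈ L.carrier) :
    WithLp.toLp 2 (J₀.conj w₀, -J₁.conj w₁) ∈ L.carrierᗮ := by
  rw [← L.conj_mem_iff]
  convert h using 1
  apply WithLp.ofLp_injective
  ext <;> simp [RealStructure.prod, RealStructure.opp, J₀.conj_conj, J₁.conj_conj]

/-- As a bimodule, `ΛL` is generated by the vacuum. -/
theorem span_smul_vacuum :
    Submodule.span ℂ {ξ : Fock L | ∃ (a : Cl J₀) (b : Cl J₁), ξ = a • op b • vacuum L} = ⊤ := by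
  set S := Submodule.span ℂ {ξ : Fock L | ∃ (a : Cl J₀) (b : Cl J₁), ξ = a • op b • vacuum L}
    with hS
  have hl : ∀ (a : Cl J₀), ∀ ξ ∈ S, a • ξ ∈ S := fun a ξ hξ => by
    induction hξ using Submodule.span_induction with
    | mem x hx =>
      obtain ⟨a', b', rfl⟩ := hx
      exact Submodule.subset_span ⟨a * a', b', by rw [mul_smul]⟩
    | zero => rw [smul_zero]; exact S.zero_mem
    | add x y _ _ hx hy => rw [smul_add]; exact S.add_mem hx hy
    | smul c x _ hx => rw [smul_comm]; exact S.smul_mem c hx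
  have hr : ∀ (b : Cl J₁), ∀ ξ ∈ S, op b • ξ ∈ S := fun b ξ hξ => by
    induction hξ using Submodule.span_induction with
    | mem x hx =>
      obtain ⟨a', b', rfl⟩ := hx
      exact Submodule.subset_span ⟨a', b' * b, by rw [op_mul, mul_smul, ← smul_op_smul_comm]⟩
    | zero => rw [smul_zero]; exact S.zero_mem
    | add x y _ _ hx hy => rw [smul_add]; exact S.add_mem hx hy
    | smul c x _ hx => rw [smul_comm]; exact S.smul_mem c hx
  have hp : ∀ ξ ∈ S, parity L ξ ∈ S := fun ξ hξ => by
    induction hξ using Submodule.span_induction with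
    | mem x hx =>
      obtain ⟨a', b', rfl⟩ := hx
      exact Submodule.subset_span ⟨CliffordAlgebra.involute a', CliffordAlgebra.involute b', by
        rw [parity_smul, parity_op_smul, parity_vacuum]⟩
    | zero => rw [map_zero]; exact S.zero_mem
    | add x y _ _ hx hy => rw [map_add]; exact S.add_mem hx hy
    | smul c x _ hx => rw [map_smul]; exact S.smul_mem c hx
  refine eq_top_iff.2 fun ξ _ => ?_
  induction ξ using wedge_induction with
  | vac => exact Submodule.subset_span ⟨1, 1, by rw [op_one, one_smul, one_smul]⟩
  | smul c ξ h => exact S.smul_mem c (h trivial)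
  | add ξ η h1 h2 => exact S.add_mem (h1 trivial) (h2 trivial)
  | wedge v ξ h =>
    have e := cliff_toLp (L := L) (v : WithLp 2 (W₀ × W₁)).fst (v : WithLp 2 (W₀ × W₁)).snd ξ
    have e' := cliff_of_mem v.2 ξ
    rw [Subtype.coe_eta] at e'
    rw [← e']
    refine e.symm ▸ ?_
    exact S.add_mem (hl _ _ (h trivial)) (hr _ _ (hp _ (h trivial)))

theorem linearMap_ext {N : Type*} [AddCommGroup N] [Module ℂ N] {f g : Fock L →ₗ[ℂ] N}
    (h : ∀ (a : Cl J₀) (b : Cl J₁), f (a • op b • vacuum L) = g (a • op b • vacuum L)) :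
    f = g :=
  LinearMap.ext_on span_smul_vacuum (by
    rintro _ ⟨a, b, rfl⟩
    exact h a b)

end Bimodule

end Fock

/-! ### Existence and uniqueness of the gluing homomorphism -/

theorem BimodHom.ext {A B M N : Type*} [Ring A] [Ring B]
    [AddCommGroup M] [Module ℂ M] [Module A M] [Module Bᵐᵒᵖ M]
    [AddCommGroup N] [Module ℂ N] [Module A N] [Module Bᵐᵒᵖ N] {f g : BimodHom A B M N}
    (h : f.toLinearMap = g.toLinearMap) : f = g := by
  cases f
  cases g
  cases h
  rfl

namespace Twist

variable {M E P : Type*} [AddCommGroup M] [Module ℂ M] [AddCommGroup E] [Module ℂ E]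
  [AddCommGroup P] [Module ℂ P]

/-- The linear map out of `M ⊗ Λ^top E` given by a bilinear map. -/
def lift (f : M →ₗ[ℂ] TopPower E →ₗ[ℂ] P) : Twist M E →ₗ[ℂ] P := TensorProduct.lift f

theorem induction_on {p : Twist M E → Prop} (x : Twist M E) (zero : p 0)
    (tmul : ∀ m κ, p (tmul M E m κ)) (add : ∀ x y, p x → p y → p (x + y)) : p x :=
  TensorProduct.induction_on x zero tmul add

end Twist

section Gluing

variable {W₀ W₁ W₂ : Type*}
  [NormedAddCommGroup W₀] [InnerProductSpace ℂ W₀]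
  [NormedAddCommGroup W₁] [InnerProductSpace ℂ W₁]
  [NormedAddCommGroup W₂] [InnerProductSpace ℂ W₂]
  {J₀ : RealStructure W₀} {J₁ : RealStructure W₁} {J₂ : RealStructure W₂}

namespace Fock

section Pair

variable (L₀₁ : LagRel J₀ J₁) (L₁₂ : LagRel J₁ J₂)

instance : SMulCommClass (Cl J₂)ᵐᵒᵖ ℂ (BalTensor (Cl J₁) (Fock L₀₁) (Fock L₁₂)) :=
  ⟨fun b c x => LinearMap.map_smul
    (BalTensor.lift ((BalTensor.mk (Cl J₁) (Fock L₀₁) (Fock L₁₂)).compl₂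
      (Module.toModuleEnd ℂ (Fock L₁₂) b)) (fun m a n => by
        change BalTensor.mk (Cl J₁) (Fock L₀₁) (Fock L₁₂) (op a • m) (b • n)
          = BalTensor.mk (Cl J₁) (Fock L₀₁) (Fock L₁₂) m (b • a • n)
        rw [← smul_comm, BalTensor.mk_op_smul])) c x⟩

instance : SMulCommClass (Cl J₀) (Cl J₂)ᵐᵒᵖ (BalTensor (Cl J₁) (Fock L₀₁) (Fock L₁₂)) :=
  ⟨fun a b x => by
    have h : (Module.toModuleEnd ℂ (BalTensor (Cl J₁) (Fock L₀₁) (Fock L₁₂)) a).comp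
        (Module.toModuleEnd ℂ (BalTensor (Cl J₁) (Fock L₀₁) (Fock L₁₂)) b)
      = (Module.toModuleEnd ℂ (BalTensor (Cl J₁) (Fock L₀₁) (Fock L₁₂)) b).comp
        (Module.toModuleEnd ℂ (BalTensor (Cl J₁) (Fock L₀₁) (Fock L₁₂)) a) :=
      BalTensor.ext fun m n => rfl
    exact LinearMap.congr_fun h x⟩

/-- The parity operator of the super vector space `ΛL₀₁ ⊗_{Cl(W₁)} ΛL₁₂`. -/
def pairParity : BalTensor (Cl J₁) (Fock L₀₁) (Fock L₁₂) →ₗ[ℂ]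
    BalTensor (Cl J₁) (Fock L₀₁) (Fock L₁₂) :=
  BalTensor.lift ((BalTensor.mk (Cl J₁) (Fock L₀₁) (Fock L₁₂)).compl₁₂ (parity L₀₁) (parity L₁₂))
    (fun m a n => by
      rw [LinearMap.compl₁₂_apply, LinearMap.compl₁₂_apply, parity_op_smul, parity_smul,
        BalTensor.mk_op_smul])

theorem pairParity_mk (ξ : Fock L₀₁) (η : Fock L₁₂) :
    pairParity L₀₁ L₁₂ (BalTensor.mk (Cl J₁) (Fock L₀₁) (Fock L₁₂) ξ η)
      = BalTensor.mk (Cl J₁) (Fock L₀₁) (Fock L₁₂) (parity L₀₁ ξ) (parity L₁₂ η) := rfl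

theorem pairParity_pairParity (x : BalTensor (Cl J₁) (Fock L₀₁) (Fock L₁₂)) :
    pairParity L₀₁ L₁₂ (pairParity L₀₁ L₁₂ x) = x := by
  refine LinearMap.congr_fun (f := (pairParity L₀₁ L₁₂).comp (pairParity L₀₁ L₁₂))
    (g := LinearMap.id) (BalTensor.ext fun m n => ?_) x
  rw [LinearMap.comp_apply, pairParity_mk, pairParity_mk, parity_parity, parity_parity]
  rfl

theorem pairParity_smul (a : Cl J₀) (x : BalTensor (Cl J₁) (Fock L₀₁) (Fock L₁₂)) :
    pairParity L₀₁ L₁₂ (a • x) = CliffordAlgebra.involute a • pairParity L₀₁ L₁₂ x := by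
  refine LinearMap.congr_fun (f := (pairParity L₀₁ L₁₂).comp (Module.toModuleEnd ℂ _ a))
    (g := (Module.toModuleEnd ℂ _ (CliffordAlgebra.involute a)).comp (pairParity L₀₁ L₁₂))
    (BalTensor.ext fun m n => ?_) x
  change pairParity L₀₁ L₁₂ (BalTensor.mk (Cl J₁) (Fock L₀₁) (Fock L₁₂) (a • m) n) = _
  rw [pairParity_mk, parity_smul]
  rfl

theorem pairParity_op_smul (b : Cl J₂) (x : BalTensor (Cl J₁) (Fock L₀₁) (Fock L₁₂)) :
    pairParity L₀₁ L₁₂ (op b • x) = op (CliffordAlgebra.involute b) • pairParity L₀₁ L₁₂ x := by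
  refine LinearMap.congr_fun (f := (pairParity L₀₁ L₁₂).comp (Module.toModuleEnd ℂ _ (op b)))
    (g := (Module.toModuleEnd ℂ _ (op (CliffordAlgebra.involute b))).comp (pairParity L₀₁ L₁₂))
    (BalTensor.ext fun m n => ?_) x
  change pairParity L₀₁ L₁₂ (BalTensor.mk (Cl J₁) (Fock L₀₁) (Fock L₁₂) m (op b • n)) = _
  rw [pairParity_mk, parity_op_smul]
  rfl

/-- The action of `W₀ ⊕ -W₂` on `ΛL₀₁ ⊗_{Cl(W₁)} ΛL₁₂` that encodes its bimodule structure: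
`(w₀, w₂)` acts as `x ↦ w₀ x + (-1)^|x| x w₂`. -/
def pairAction : WithLp 2 (W₀ × W₂) →ₗ[ℂ]
    Module.End ℂ (BalTensor (Cl J₁) (Fock L₀₁) (Fock L₁₂)) where
  toFun w := Module.toModuleEnd ℂ _ (CliffordAlgebra.ι J₀.quadForm w.fst)
    + (Module.toModuleEnd ℂ _ (op (CliffordAlgebra.ι J₂.quadForm w.snd))).comp
      (pairParity L₀₁ L₁₂)
  map_add' v w := by
    ext x
    simp only [WithLp.add_fst, WithLp.add_snd, map_add, op_add, LinearMap.add_apply,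
      LinearMap.comp_apply]
    exact add_add_add_comm _ _ _ _
  map_smul' c w := by
    refine LinearMap.ext fun x => ?_
    have h₀ : ∀ (a : Cl J₀) (x : BalTensor (Cl J₁) (Fock L₀₁) (Fock L₁₂)),
        (c • a) • x = c • a • x := fun a x => by
      refine LinearMap.congr_fun (f := Module.toModuleEnd ℂ _ (c • a))
        (g := c • Module.toModuleEnd ℂ _ a) (BalTensor.ext fun m n => ?_) x
      change BalTensor.mk (Cl J₁) (Fock L₀₁) (Fock L₁₂) ((c • a) • m) n
        = c • BalTensor.mk (Cl J₁) (Fock L₀₁) (Fock L₁₂) (a • m) n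
      rw [smul_assoc, map_smul, LinearMap.smul_apply]
    have h₂ : ∀ (b : Cl J₂) (x : BalTensor (Cl J₁) (Fock L₀₁) (Fock L₁₂)),
        op (c • b) • x = c • op b • x := fun b x => by
      refine LinearMap.congr_fun (f := Module.toModuleEnd ℂ _ (op (c • b)))
        (g := c • Module.toModuleEnd ℂ _ (op b)) (BalTensor.ext fun m n => ?_) x
      change BalTensor.mk (Cl J₁) (Fock L₀₁) (Fock L₁₂) m (op (c • b) • n)
        = c • BalTensor.mk (Cl J₁) (Fock L₀₁) (Fock L₁₂) m (op b • n)
      rw [op_smul, smul_assoc, map_smul]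
    change CliffordAlgebra.ι J₀.quadForm (c • w).fst • x
        + op (CliffordAlgebra.ι J₂.quadForm (c • w).snd) • pairParity L₀₁ L₁₂ x
      = c • (CliffordAlgebra.ι J₀.quadForm w.fst • x
        + op (CliffordAlgebra.ι J₂.quadForm w.snd) • pairParity L₀₁ L₁₂ x)
    rw [WithLp.smul_fst, WithLp.smul_snd, map_smul, map_smul, h₀, h₂, smul_add]

theorem pairAction_apply (w : WithLp 2 (W₀ × W₂))
    (x : BalTensor (Cl J₁) (Fock L₀₁) (Fock L₁₂)) :
    pairAction L₀₁ L₁₂ w x = CliffordAlgebra.ι J₀.quadForm w.fst • x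
      + op (CliffordAlgebra.ι J₂.quadForm w.snd) • pairParity L₀₁ L₁₂ x := rfl

theorem pairAction_left (w : W₀) (x : BalTensor (Cl J₁) (Fock L₀₁) (Fock L₁₂)) :
    pairAction L₀₁ L₁₂ (WithLp.toLp 2 (w, 0)) x = CliffordAlgebra.ι J₀.quadForm w • x := by
  have h : CliffordAlgebra.ι J₂.quadForm (WithLp.toLp 2 (w, (0 : W₂))).snd = 0 := map_zero _
  rw [pairAction_apply, h, op_zero, zero_smul, add_zero]
  rfl

theorem pairAction_right (w : W₂) (x : BalTensor (Cl J₁) (Fock L₀₁) (Fock L₁₂)) :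
    pairAction L₀₁ L₁₂ (WithLp.toLp 2 (0, w)) x
      = op (CliffordAlgebra.ι J₂.quadForm w) • pairParity L₀₁ L₁₂ x := by
  have h : CliffordAlgebra.ι J₀.quadForm (WithLp.toLp 2 ((0 : W₀), w)).fst = 0 := map_zero _
  rw [pairAction_apply, h, zero_smul, zero_add]
  rfl

theorem pairParity_pairAction (w : WithLp 2 (W₀ × W₂))
    (x : BalTensor (Cl J₁) (Fock L₀₁) (Fock L₁₂)) :
    pairParity L₀₁ L₁₂ (pairAction L₀₁ L₁₂ w x)
      = -pairAction L₀₁ L₁₂ w (pairParity L₀₁ L₁₂ x) := by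
  rw [pairAction_apply, pairAction_apply, map_add, pairParity_smul, pairParity_op_smul,
    CliffordAlgebra.involute_ι, CliffordAlgebra.involute_ι, op_neg, neg_smul, neg_smul, neg_add]

theorem prod_quadForm (w : WithLp 2 (W₀ × W₂)) :
    (J₀.prod J₂.opp).quadForm w = J₀.quadForm w.fst - J₂.quadForm w.snd := by
  simp only [RealStructure.quadForm_apply, RealStructure.form_apply, RealStructure.prod,
    RealStructure.opp, WithLp.prod_inner_apply]
  simp
  ring

theorem pair_algebraMap_smul (r : ℂ) (x : BalTensor (Cl J₁) (Fock L₀₁) (Fock L₁₂)) :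
    algebraMap ℂ (Cl J₀) r • x = r • x := by
  refine LinearMap.congr_fun (f := Module.toModuleEnd ℂ _ (algebraMap ℂ (Cl J₀) r))
    (g := r • LinearMap.id) (BalTensor.ext fun m n => ?_) x
  change BalTensor.mk (Cl J₁) (Fock L₀₁) (Fock L₁₂) (algebraMap ℂ (Cl J₀) r • m) n = _
  rw [algebraMap_smul, map_smul]
  rfl

theorem pair_op_algebraMap_smul (r : ℂ) (x : BalTensor (Cl J₁) (Fock L₀₁) (Fock L₁₂)) :
    op (algebraMap ℂ (Cl J₂) r) • x = r • x := by
  refine LinearMap.congr_fun (f := Module.toModuleEnd ℂ _ (op (algebraMap ℂ (Cl J₂) r)))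
    (g := r • LinearMap.id) (BalTensor.ext fun m n => ?_) x
  change BalTensor.mk (Cl J₁) (Fock L₀₁) (Fock L₁₂) m (op (algebraMap ℂ (Cl J₂) r) • n) = _
  rw [← MulOpposite.algebraMap_apply, algebraMap_smul, map_smul]
  rfl

theorem pairAction_pairAction (w : WithLp 2 (W₀ × W₂))
    (x : BalTensor (Cl J₁) (Fock L₀₁) (Fock L₁₂)) :
    pairAction L₀₁ L₁₂ w (pairAction L₀₁ L₁₂ w x) = (J₀.prod J₂.opp).quadForm w • x := by
  rw [pairAction_apply, pairAction_apply, map_add, pairParity_smul, pairParity_op_smul,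
    pairParity_pairParity, CliffordAlgebra.involute_ι, CliffordAlgebra.involute_ι, smul_add,
    smul_add, ← mul_smul, CliffordAlgebra.ι_sq_scalar, op_neg, neg_smul, neg_smul, smul_neg,
    smul_neg, ← mul_smul (op _) (op _), ← op_mul, CliffordAlgebra.ι_sq_scalar, smul_comm,
    pair_algebraMap_smul, pair_op_algebraMap_smul, prod_quadForm, sub_smul]
  abel

end Pair

section Existence

variable {L₀₁ : LagRel J₀ J₁} {L₁₂ : LagRel J₁ J₂}

theorem quadForm_kerSpace_left (u : kerSpace L₀₁.carrier L₁₂.carrier) :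
    J₁.quadForm ((kerSpace L₀₁.carrier L₁₂.carrier).subtype u) = 0 := by
  have h := quadForm_eq_zero_of_mem u.2.1
  rwa [form_right, neg_eq_zero] at h

variable (L₀₁ L₁₂)

/-- The homomorphism `ΛK → Cl(W₁)`, `u₁ ∧ ⋯ ∧ uₙ ↦ u₁ ⋯ uₙ`, on the isotropic space `K`. -/
def kerHom : ExteriorAlgebra ℂ (kerSpace L₀₁.carrier L₁₂.carrier) →ₐ[ℂ] Cl J₁ :=
  isotropicHom J₁ (kerSpace L₀₁.carrier L₁₂.carrier).subtype quadForm_kerSpace_left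

/-- The map `κ ↦ Ω₀₁ · κ ⊗ Ω₁₂` on `Λ^top K`. -/
def gluedVacuum : TopPower (kerSpace L₀₁.carrier L₁₂.carrier) →ₗ[ℂ]
    BalTensor (Cl J₁) (Fock L₀₁) (Fock L₁₂) where
  toFun κ := BalTensor.mk (Cl J₁) (Fock L₀₁) (Fock L₁₂)
    (op (kerHom L₀₁ L₁₂ (κ : ExteriorAlgebra ℂ _)) • vacuum L₀₁) (vacuum L₁₂)
  map_add' κ μ := by
    rw [Submodule.coe_add, map_add, op_add, add_smul, map_add, LinearMap.add_apply]
  map_smul' c κ := by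
    have h : op (kerHom L₀₁ L₁₂ ((c • κ :
          TopPower (kerSpace L₀₁.carrier L₁₂.carrier)) : ExteriorAlgebra ℂ _)) • vacuum L₀₁
        = c • op (kerHom L₀₁ L₁₂ (κ : ExteriorAlgebra ℂ _)) • vacuum L₀₁ := by
      rw [Submodule.coe_smul, map_smul, op_smul, smul_assoc]
    rw [h, map_smul, LinearMap.smul_apply, RingHom.id_apply]

variable {L₀₁ L₁₂}

theorem gluedVacuum_apply (κ : TopPower (kerSpace L₀₁.carrier L₁₂.carrier)) :
    gluedVacuum L₀₁ L₁₂ κ = BalTensor.mk (Cl J₁) (Fock L₀₁) (Fock L₁₂)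
    (op (kerHom L₀₁ L₁₂ (κ : ExteriorAlgebra ℂ _)) • vacuum L₀₁) (vacuum L₁₂) := rfl

theorem pairParity_gluedVacuum (κ : TopPower (kerSpace L₀₁.carrier L₁₂.carrier)) :
    pairParity L₀₁ L₁₂ (gluedVacuum L₀₁ L₁₂ κ)
      = (-1 : ℂ) ^ Module.finrank ℂ (kerSpace L₀₁.carrier L₁₂.carrier)
        • gluedVacuum L₀₁ L₁₂ κ := by
  rw [gluedVacuum_apply, pairParity_mk, parity_op_smul, parity_vacuum, parity_vacuum, kerHom,
    involute_isotropicHom_of_mem _ κ.2, op_smul, smul_assoc, map_smul, LinearMap.smul_apply]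

/-- The vector `Ω₀₁ · κ ⊗ Ω₁₂` is killed by `conj L₀₂`: a vector `(v₀, v₂) ∈ L₀₂` factors through
some `v₁ ∈ W₁`, which can be chosen orthogonal to `K`, so that `conj v₁` supercommutes with `κ`. -/
theorem pairAction_gluedVacuum {L₀₂ : LagRel J₀ J₂}
    [FiniteDimensional ℂ (kerSpace L₀₁.carrier L₁₂.carrier)]
    (h₀₂ : L₀₂.carrier = relComp L₀₁.carrier L₁₂.carrier)
    (w : WithLp 2 (W₀ × W₂)) (hw : w ∈ L₀₂.carrierᗮ)
    (κ : TopPower (kerSpace L₀₁.carrier L₁₂.carrier)) :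
    pairAction L₀₁ L₁₂ w (gluedVacuum L₀₁ L₁₂ κ) = 0 := by
  obtain ⟨v, hv, hv'⟩ : ∃ v, WithLp.toLp 2 (J₀.conj w.fst, v) ∈ L₀₁.carrier ∧
      WithLp.toLp 2 (v, -J₂.conj w.snd) ∈ L₁₂.carrier := by
    have h := (L₀₂.conj_mem_iff w).2 hw
    rw [h₀₂] at h
    exact h
  obtain ⟨z, hz, hz', hzK⟩ : ∃ z, WithLp.toLp 2 (J₀.conj w.fst, z) ∈ L₀₁.carrier ∧
      WithLp.toLp 2 (z, -J₂.conj w.snd) ∈ L₁₂.carrier ∧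
      z ∈ (kerSpace L₀₁.carrier L₁₂.carrier)ᗮ := by
    have hp := ((kerSpace L₀₁.carrier L₁₂.carrier).orthogonalProjectionOnto v).2
    have h1 := toLp_sub hv hp.1
    have h2 := toLp_sub hv' hp.2
    rw [sub_zero] at h1 h2
    have h3 := Submodule.sub_starProjection_mem_orthogonal 
      (K := kerSpace L₀₁.carrier L₁₂.carrier) v
    rw [Submodule.starProjection_apply] at h3
    exact ⟨_, h1, h2, h3⟩
  have e1 := ι_smul_vacuum (conj_mem_orthogonal hz)
  have e2 := ι_smul_vacuum (conj_mem_orthogonal hz')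
  rw [J₀.conj_conj, map_neg, op_neg, neg_smul, neg_neg] at e1
  rw [map_neg J₂.conj, neg_neg, J₂.conj_conj] at e2
  have e3 : CliffordAlgebra.ι J₁.quadForm (J₁.conj z) 
      * kerHom L₀₁ L₁₂ (κ : ExteriorAlgebra ℂ _)
      = (-1 : ℂ) ^ Module.finrank ℂ (kerSpace L₀₁.carrier L₁₂.carrier) •
        (kerHom L₀₁ L₁₂ (κ : ExteriorAlgebra ℂ _) * CliffordAlgebra.ι J₁.quadForm (J₁.conj z)) := by
    rw [kerHom, ι_mul_isotropicHom, ExteriorAlgebra.involute_of_mem κ.2, map_smul, smul_mul_assoc]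
    intro u
    rw [RealStructure.form_apply, J₁.conj_conj]
    exact Submodule.inner_left_of_mem_orthogonal u.2 hzK
  rw [pairAction_apply, pairParity_gluedVacuum, gluedVacuum_apply, BalTensor.smul_mk,
    smul_op_smul_comm, e1, ← mul_smul, ← op_mul, e3, op_smul, smul_assoc, op_mul, mul_smul,
    map_smul, LinearMap.smul_apply, BalTensor.mk_op_smul _ (CliffordAlgebra.ι J₁.quadForm _), e2,
    smul_comm, BalTensor.op_smul_mk_right, map_neg, smul_neg, neg_add_cancel]

variable (L₀₁ L₁₂) in
/-- The map `ΛL₀₂ ⊗ Λ^top K → ΛL₀₁ ⊗_{Cl(W₁)} ΛL₁₂`, as a bilinear map. -/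
def gluingMap (L₀₂ : LagRel J₀ J₂) : Fock L₀₂ →ₗ[ℂ]
    TopPower (kerSpace L₀₁.carrier L₁₂.carrier) →ₗ[ℂ] BalTensor (Cl J₁) (Fock L₀₁) (Fock L₁₂) :=
  liftOfAction (pairAction L₀₁ L₁₂) (pairAction_pairAction L₀₁ L₁₂) (gluedVacuum L₀₁ L₁₂)

variable {L₀₂ : LagRel J₀ J₂}

theorem pairParity_gluingMap (ξ : Fock L₀₂) (κ : TopPower (kerSpace L₀₁.carrier L₁₂.carrier)) :
    pairParity L₀₁ L₁₂ (gluingMap L₀₁ L₁₂ L₀₂ ξ κ)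
      = (-1 : ℂ) ^ Module.finrank ℂ (kerSpace L₀₁.carrier L₁₂.carrier)
        • gluingMap L₀₁ L₁₂ L₀₂ (parity L₀₂ ξ) κ := by
  induction ξ using wedge_induction with
  | vac => rw [parity_vacuum, gluingMap, liftOfAction_vacuum, pairParity_gluedVacuum]
  | smul r ξ ih => 
    rw [map_smul, LinearMap.smul_apply, map_smul, ih, map_smul, map_smul, LinearMap.smul_apply,
      smul_comm]
  | add ξ η h1 h2 => simp only [map_add, LinearMap.add_apply, h1, h2, smul_add]
  | wedge v ξ ih =>
    rw [parity_wedge, gluingMap, liftOfAction_wedge, pairParity_pairAction, map_neg,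
      LinearMap.neg_apply, liftOfAction_wedge, ← gluingMap, ih, map_smul, smul_neg]

variable [FiniteDimensional ℂ (kerSpace L₀₁.carrier L₁₂.carrier)]

theorem gluingMap_smul (h₀₂ : L₀₂.carrier = relComp L₀₁.carrier L₁₂.carrier)
    (a : Cl J₀) (ξ : Fock L₀₂)
    (κ : TopPower (kerSpace L₀₁.carrier L₁₂.carrier)) :
    gluingMap L₀₁ L₁₂ L₀₂ (a • ξ) κ = a • gluingMap L₀₁ L₁₂ L₀₂ ξ κ := by
  induction a using CliffordAlgebra.induction generalizing ξ with
  | algebraMap r =>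
    rw [algebraMap_smul, map_smul, LinearMap.smul_apply, pair_algebraMap_smul]
  | add x y hx hy => rw [add_smul, map_add, LinearMap.add_apply, add_smul, hx, hy]
  | mul x y hx hy => rw [mul_smul, mul_smul, hx, hy]
  | ι v =>
    rw [ι_smul, gluingMap, liftOfAction_cliff _ (pairAction_gluedVacuum h₀₂), pairAction_left]

theorem gluingMap_op_smul (h₀₂ : L₀₂.carrier = relComp L₀₁.carrier L₁₂.carrier)
    (b : Cl J₂) (ξ : Fock L₀₂)
    (κ : TopPower (kerSpace L₀₁.carrier L₁₂.carrier)) :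
    gluingMap L₀₁ L₁₂ L₀₂ (op ((CliffordAlgebra.involute ^
        Module.finrank ℂ (kerSpace L₀₁.carrier L₁₂.carrier) : Cl J₂ →ₐ[ℂ] Cl J₂) b) • ξ) κ
      = op b • gluingMap L₀₁ L₁₂ L₀₂ ξ κ := by
  induction b using CliffordAlgebra.induction generalizing ξ with
  | algebraMap r =>
    rw [AlgHom.commutes, pair_op_algebraMap_smul, ← MulOpposite.algebraMap_apply,
      algebraMap_smul, map_smul, LinearMap.smul_apply]
  | add x y hx hy =>
    rw [map_add, op_add, add_smul, map_add, LinearMap.add_apply, op_add, add_smul, hx, hy]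
  | mul x y hx hy => rw [map_mul, op_mul, mul_smul, hy, hx, op_mul, mul_smul]
  | ι v =>
    have hι : ∀ n : ℕ, (CliffordAlgebra.involute ^ n : Cl J₂ →ₐ[ℂ] Cl J₂)
        (CliffordAlgebra.ι J₂.quadForm v) = (-1 : ℂ) ^ n • CliffordAlgebra.ι J₂.quadForm v :=
      fun n => by
        induction n with
        | zero => rw [pow_zero (-1 : ℂ), one_smul]; rfl
        | succ n ih =>
          rw [pow_succ, AlgHom.mul_apply, CliffordAlgebra.involute_ι, map_neg, ih, pow_succ,
            mul_neg_one, neg_smul]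
    rw [hι, op_smul, smul_assoc, map_smul, LinearMap.smul_apply, op_ι_smul]
    conv_lhs => rw [gluingMap]
    rw [liftOfAction_cliff _ (pairAction_gluedVacuum h₀₂), pairAction_right,
      ← gluingMap, pairParity_gluingMap, parity_parity,
      smul_comm (op _), smul_smul, ← mul_pow, neg_one_mul, neg_neg, one_pow, one_smul]

/-- The gluing homomorphism. -/
def gluing (h₀₂ : L₀₂.carrier = relComp L₀₁.carrier L₁₂.carrier) : GluingHom L₀₁ L₁₂ L₀₂ where
  toLinearMap := Twist.lift (gluingMap L₀₁ L₁₂ L₀₂)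
  map_left a x := by
    change Twist.lift (gluingMap L₀₁ L₁₂ L₀₂) _ = a • Twist.lift (gluingMap L₀₁ L₁₂ L₀₂) _
    induction x using Twist.induction_on with
    | zero => rw [smul_zero, map_zero, smul_zero]
    | add x y hx hy => rw [smul_add, map_add, map_add, smul_add, hx, hy]
    | tmul ξ κ => exact gluingMap_smul h₀₂ a ξ κ
  map_right b x := by
    change Twist.lift (gluingMap L₀₁ L₁₂ L₀₂) _ = op b • Twist.lift (gluingMap L₀₁ L₁₂ L₀₂) _
    induction x using Twist.induction_on with
    | zero => rw [smul_zero, map_zero, smul_zero]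
    | add x y hx hy => rw [smul_add, map_add, map_add, smul_add, hx, hy]
    | tmul ξ κ => exact gluingMap_op_smul h₀₂ b ξ κ

end Existence

end Fock

variable {L₀₁ : LagRel J₀ J₁} {L₁₂ : LagRel J₁ J₂} {L₀₂ : LagRel J₀ J₂}

open Fock in
/-- The normalization of a gluing homomorphism, for all `κ ∈ Λ^top K`. -/
theorem isGluing_iff {α : GluingHom L₀₁ L₁₂ L₀₂} :
    IsGluing α ↔ ∀ κ, α.toLinearMap (Twist.tmul _ _ (vacuum L₀₂) κ) = gluedVacuum L₀₁ L₁₂ κ := by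
  have key : ∀ u, gluedVacuum L₀₁ L₁₂ (exteriorPower.ιMulti ℂ _ u)
      = BalTensor.mk (Cl J₁) (Fock L₀₁) (Fock L₁₂)
          (op (List.ofFn fun i => CliffordAlgebra.ι J₁.quadForm (u i : W₁)).prod • vacuum L₀₁)
          (vacuum L₁₂) := fun u => by
    rw [gluedVacuum_apply, kerHom, isotropicHom_ιMulti]
    rfl
  constructor
  · intro h κ
    refine LinearMap.congr_fun (f := α.toLinearMap ∘ₗ Twist.tmul _ _ (vacuum L₀₂)) ?_ κ
    refine exteriorPower.linearMap_ext (AlternatingMap.ext fun u => ?_)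
    exact (h u).trans (key u).symm
  · intro h u
    rw [h, key]

/-- The value of a gluing homomorphism on the orbit of the vacuum. -/
theorem IsGluing.apply_smul {α : GluingHom L₀₁ L₁₂ L₀₂} (hα : IsGluing α) (a : Cl J₀) (b : Cl J₂)
    (κ : TopPower (kerSpace L₀₁.carrier L₁₂.carrier)) :
    α.toLinearMap (Twist.tmul _ _ (a • op b • Fock.vacuum L₀₂) κ)
      = a • op ((CliffordAlgebra.involute ^
        Module.finrank ℂ (kerSpace L₀₁.carrier L₁₂.carrier) : Cl J₂ →ₐ[ℂ] Cl J₂) b) •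
          Fock.gluedVacuum L₀₁ L₁₂ κ := by
  have h : Twist.tmul _ _ (op b • Fock.vacuum L₀₂) κ
      = op ((CliffordAlgebra.involute ^
        Module.finrank ℂ (kerSpace L₀₁.carrier L₁₂.carrier) : Cl J₂ →ₐ[ℂ] Cl J₂) b) •
          Twist.tmul _ _ (Fock.vacuum L₀₂) κ := by
    rw [Twist.op_smul_tmul, involute_pow_involute_pow]
  rw [← Twist.smul_tmul, h]
  refine (α.map_left _ _).trans (congrArg (a • ·) ?_)
  refine (α.map_right _ _).trans (congrArg _ ?_)
  exact isGluing_iff.1 hα κ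

theorem existsUnique_isGluing [FiniteDimensional ℂ (kerSpace L₀₁.carrier L₁₂.carrier)]
    (h₀₂ : L₀₂.carrier = relComp L₀₁.carrier L₁₂.carrier) :
    ∃! α : GluingHom L₀₁ L₁₂ L₀₂, IsGluing α := by
  refine ⟨Fock.gluing h₀₂, isGluing_iff.2 fun κ => ?_, fun α hα => BimodHom.ext ?_⟩
  · exact Fock.liftOfAction_vacuum _ κ
  · have hβ : IsGluing (Fock.gluing h₀₂) :=
      isGluing_iff.2 fun κ => Fock.liftOfAction_vacuum _ κ
    refine TensorProduct.ext (Fock.linearMap_ext fun a b => LinearMap.ext fun κ => ?_)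
    exact (hα.apply_smul a b κ).trans (hβ.apply_smul a b κ).symm

end Gluing

/-! ### Top exterior powers of sums -/

section Top

variable {E F G : Type*} [AddCommGroup E] [Module ℂ E] [AddCommGroup F] [Module ℂ F]
  [AddCommGroup G] [Module ℂ G]

theorem exteriorPower.coe_map (n : ℕ) (f : E →ₗ[ℂ] F) (κ : ⋀[ℂ]^n E) :
    (exteriorPower.map n f κ : ExteriorAlgebra ℂ F)
      = ExteriorAlgebra.map f (κ : ExteriorAlgebra ℂ E) := by
  refine LinearMap.congr_fun (f := Submodule.subtype _ ∘ₗ exteriorPower.map n f)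
    (g := (ExteriorAlgebra.map f).toLinearMap ∘ₗ Submodule.subtype _) ?_ κ
  refine exteriorPower.linearMap_ext (AlternatingMap.ext fun u => ?_)
  change (exteriorPower.map n f (exteriorPower.ιMulti ℂ n u) : ExteriorAlgebra ℂ F)
    = ExteriorAlgebra.map f (exteriorPower.ιMulti ℂ n u : ExteriorAlgebra ℂ E)
  rw [exteriorPower.map_apply_ιMulti, exteriorPower.ιMulti_apply_coe,
    exteriorPower.ιMulti_apply_coe, ExteriorAlgebra.map_apply_ιMulti]

theorem ExteriorAlgebra.map_map_apply (f : E →ₗ[ℂ] F) (g : F →ₗ[ℂ] G) (x : ExteriorAlgebra ℂ E) :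
    ExteriorAlgebra.map g (ExteriorAlgebra.map f x) = ExteriorAlgebra.map (g ∘ₗ f) x := by
  rw [← ExteriorAlgebra.map_comp_map]
  rfl

theorem ExteriorAlgebra.map_mem {n : ℕ} (f : E →ₗ[ℂ] F) {x : ExteriorAlgebra ℂ E}
    (hx : x ∈ ⋀[ℂ]^n E) : ExteriorAlgebra.map f x ∈ ⋀[ℂ]^n F := by
  rw [← exteriorPower.coe_map n f ⟨x, hx⟩]
  exact Subtype.property _

theorem coe_topMap (e : E ≃ₗ[ℂ] F) (κ : TopPower E) :
    (topMap e κ : ExteriorAlgebra ℂ F)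
      = ExteriorAlgebra.map e.toLinearMap (κ : ExteriorAlgebra ℂ E) :=
  exteriorPower.coe_map _ _ κ

/-- The product of `κ ∈ Λ^top E` and `μ ∈ Λ^top F` in `Λ^top G`, when `f` and `g` map `E` and `F`
to `G` and the dimensions add up. -/
def topMul (f : E →ₗ[ℂ] G) (g : F →ₗ[ℂ] G)
    (h : Module.finrank ℂ G = Module.finrank ℂ E + Module.finrank ℂ F)
    (κ : TopPower E) (μ : TopPower F) : TopPower G :=
  ⟨ExteriorAlgebra.map f (κ : ExteriorAlgebra ℂ E)
      * ExteriorAlgebra.map g (μ : ExteriorAlgebra ℂ F),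
    by
      rw [h, ExteriorAlgebra.exteriorPower, pow_add]
      exact Submodule.mul_mem_mul (ExteriorAlgebra.map_mem f κ.2) (ExteriorAlgebra.map_mem g μ.2)⟩

theorem ιMulti_basis_ne_zero {n : ℕ} (b : Module.Basis (Fin n) ℂ E) :
    exteriorPower.ιMulti ℂ n b ≠ 0 := fun h => by
  have h3 := congrArg (exteriorPower.alternatingMapLinearEquiv b.det) h
  rw [exteriorPower.alternatingMapLinearEquiv_apply_ιMulti, map_zero, Module.Basis.det_self] at h3
  exact one_ne_zero h3

theorem tmul_topPower_ne_zero {κ : TopPower E}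
    {μ : TopPower F} (hκ : κ ≠ 0) (hμ : μ ≠ 0) : κ ⊗ₜ[ℂ] μ ≠ 0 := by
  intro h
  obtain ⟨f, hf⟩ : ∃ f : Module.Dual ℂ (TopPower E), f κ ≠ 0 := by
    by_contra! hf
    exact hκ ((Module.forall_dual_apply_eq_zero_iff ℂ κ).1 hf)
  obtain ⟨g, hg⟩ : ∃ g : Module.Dual ℂ (TopPower F), g μ ≠ 0 := by
    by_contra! hg
    exact hμ ((Module.forall_dual_apply_eq_zero_iff ℂ μ).1 hg)
  have h' := congrArg (TensorProduct.lift ((LinearMap.mul ℂ ℂ).compl₁₂ f g)) h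
  rw [TensorProduct.lift.tmul, map_zero] at h'
  exact mul_ne_zero hf hg h'

end Top

section TopProd

variable {E F : Type*} [NormedAddCommGroup E] [InnerProductSpace ℂ E] [FiniteDimensional ℂ E]
  [NormedAddCommGroup F] [InnerProductSpace ℂ F] [FiniteDimensional ℂ F]

theorem coe_topWedge (κ : TopPower E) (μ : TopPower F) :
    (topWedge E F (κ ⊗ₜ μ) : ExteriorAlgebra ℂ (WithLp 2 (E × F)))
      = ExteriorAlgebra.map (sumInl E F) (κ : ExteriorAlgebra ℂ E)
        * ExteriorAlgebra.map (sumInr E F) (μ : ExteriorAlgebra ℂ F) := by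
  rw [topWedge_tmul_coe, exteriorPower.coe_map, exteriorPower.coe_map]

theorem topWedgeEquiv_symm_topWedge (κ : TopPower E) (μ : TopPower F) :
    (topWedgeEquiv E F).symm (topWedge E F (κ ⊗ₜ μ)) = κ ⊗ₜ μ :=
  (topWedgeEquiv E F).symm_apply_apply _

theorem topSwap_topWedgeEquiv_symm (c : ℂ) (κ : TopPower E) (μ : TopPower F) :
    topSwap ((topWedgeEquiv E F).symm (c • topWedge E F (κ ⊗ₜ μ)))
      = (c * (-1 : ℂ) ^ (Module.finrank ℂ E * Module.finrank ℂ F)) • (μ ⊗ₜ[ℂ] κ) := by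
  rw [map_smul, topWedgeEquiv_symm_topWedge, map_smul, mul_smul]
  rfl

/-- The maps of determinant lines that follow `Λ^top e` in the second composite: the exchange of
the two lines contributes a sign. -/
theorem lTensor_topSwap_topMap {M G : Type*} [AddCommGroup M] [Module ℂ M] [AddCommGroup G]
    [Module ℂ G] {e : G ≃ₗ[ℂ] WithLp 2 (E × F)} {τ : TopPower G} {κ : TopPower E}
    {μ : TopPower F} (h : topMap e τ = topWedge E F (κ ⊗ₜ μ)) (c : ℂ) (m : M) :
    LinearMap.lTensor M (topSwap ∘ₗ (topWedgeEquiv E F).symm.toLinearMap)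
        (LinearMap.lTensor M (c • topMap e) (m ⊗ₜ τ))
      = (c * (-1 : ℂ) ^ (Module.finrank ℂ E * Module.finrank ℂ F)) • (m ⊗ₜ[ℂ] (μ ⊗ₜ[ℂ] κ)) := by
  rw [LinearMap.lTensor_tmul, LinearMap.lTensor_tmul, LinearMap.smul_apply, h,
    LinearMap.comp_apply, LinearEquiv.coe_coe, topSwap_topWedgeEquiv_symm,
    TensorProduct.tmul_smul]

theorem lTensor_topWedgeEquiv_symm {M : Type*} [AddCommGroup M] [Module ℂ M] (m : M)
    (κ : TopPower E) (μ : TopPower F) :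
    LinearMap.lTensor M (topWedgeEquiv E F).symm.toLinearMap (m ⊗ₜ topWedge E F (κ ⊗ₜ μ))
      = m ⊗ₜ[ℂ] (κ ⊗ₜ[ℂ] μ) := by
  rw [LinearMap.lTensor_tmul, LinearEquiv.coe_coe, topWedgeEquiv_symm_topWedge]

theorem topWedge_tmul_ne_zero {κ : TopPower E} {μ : TopPower F} (hκ : κ ≠ 0) (hμ : μ ≠ 0) :
    topWedge E F (κ ⊗ₜ μ) ≠ 0 := fun h =>
  tmul_topPower_ne_zero hκ hμ ((topWedgeEquiv E F).injective (h.trans (map_zero _).symm))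

theorem topMul_ne_zero {G : Type*} [AddCommGroup G] [Module ℂ G] {f : E →ₗ[ℂ] G}
    {g : F →ₗ[ℂ] G} (h : Module.finrank ℂ G = Module.finrank ℂ E + Module.finrank ℂ F)
    (s : G →ₗ[ℂ] WithLp 2 (E × F)) (hf : s ∘ₗ f = sumInl E F) (hg : s ∘ₗ g = sumInr E F)
    {κ : TopPower E} {μ : TopPower F} (hκ : κ ≠ 0) (hμ : μ ≠ 0) : topMul f g h κ μ ≠ 0 := by
  intro h0
  have h1 : (topMul f g h κ μ : ExteriorAlgebra ℂ G) = 0 := by rw [h0]; rfl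
  have h2 := congrArg (ExteriorAlgebra.map s) h1
  refine topWedge_tmul_ne_zero hκ hμ (Subtype.ext ?_)
  rw [topMul, map_mul, map_zero, ExteriorAlgebra.map_map_apply, ExteriorAlgebra.map_map_apply, hf,
    hg] at h2
  rw [coe_topWedge, h2]
  rfl

end TopProd

/-! ### The development map and its determinant -/

section Development

variable {W₀ W₁ W₂ W₃ : Type*}
  [NormedAddCommGroup W₀] [InnerProductSpace ℂ W₀]
  [NormedAddCommGroup W₁] [InnerProductSpace ℂ W₁]
  [NormedAddCommGroup W₂] [InnerProductSpace ℂ W₂]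
  [NormedAddCommGroup W₃] [InnerProductSpace ℂ W₃]
  {L₀₁ : Submodule ℂ (WithLp 2 (W₀ × W₁))} {L₁₂ : Submodule ℂ (WithLp 2 (W₁ × W₂))}
  {L₂₃ : Submodule ℂ (WithLp 2 (W₂ × W₃))} {L₀₂ : Submodule ℂ (WithLp 2 (W₀ × W₂))}
  {L₁₃ : Submodule ℂ (WithLp 2 (W₁ × W₃))}

theorem relComp_assoc (L₀₁ : Submodule ℂ (WithLp 2 (W₀ × W₁)))
    (L₁₂ : Submodule ℂ (WithLp 2 (W₁ × W₂))) (L₂₃ : Submodule ℂ (WithLp 2 (W₂ × W₃))) :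
    relComp L₀₁ (relComp L₁₂ L₂₃) = relComp (relComp L₀₁ L₁₂) L₂₃ := by
  ext x
  constructor
  · rintro ⟨w₁, h₁, w₂, h₂, h₃⟩
    exact ⟨w₂, ⟨w₁, h₁, h₂⟩, h₃⟩
  · rintro ⟨w₂, ⟨w₁, h₁, h₂⟩, h₃⟩
    exact ⟨w₁, h₁, w₂, h₂, h₃⟩

theorem kerSpace_le_kerSpace_left (h₁₃ : L₁₃ = relComp L₁₂ L₂₃) :
    kerSpace L₀₁ L₁₂ ≤ kerSpace L₀₁ L₁₃ := h₁₃ ▸ kerSpace_le_left L₀₁ L₁₂ L₂₃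

theorem kerSpace_le_kerSpace_right (h₀₂ : L₀₂ = relComp L₀₁ L₁₂) :
    kerSpace L₁₂ L₂₃ ≤ kerSpace L₀₂ L₂₃ := h₀₂ ▸ kerSpace_le_right L₀₁ L₁₂ L₂₃

theorem finrank_kerSpace_left [FiniteDimensional ℂ (kerSpace L₀₁ L₁₂)]
    [FiniteDimensional ℂ (kerSpace L₀₁ L₁₃)] (h₁₃ : L₁₃ = relComp L₁₂ L₂₃) :
    Module.finrank ℂ (kerSpace L₀₁ L₁₃)
      = Module.finrank ℂ (kerSpace L₀₁ L₁₂) + Module.finrank ℂ (devSource L₀₁ L₁₂ L₁₃) := by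
  rw [(splitEquiv (kerSpace_le_kerSpace_left (L₀₁ := L₀₁) h₁₃)).finrank_eq, Module.finrank_prod]

section DevMap

variable [FiniteDimensional ℂ (kerSpace L₀₁ L₁₂)] [FiniteDimensional ℂ (kerSpace L₁₂ L₂₃)]
  (h₀₂ : L₀₂ = relComp L₀₁ L₁₂) (h₁₃ : L₁₃ = relComp L₁₂ L₂₃)

/-- The development map is the identity on `K₀₁₂`. -/
theorem devMap_comp_sumInl_left :
    (devMap h₀₂ h₁₃).toLinearMap ∘ₗ (WithLp.linearEquiv 2 ℂ _).symm.toLinearMap ∘ₗ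
      LinearMap.inl ℂ _ _ ∘ₗ Submodule.inclusion (kerSpace_le_kerSpace_left h₁₃)
      = (WithLp.linearEquiv 2 ℂ _).symm.toLinearMap ∘ₗ LinearMap.inl ℂ _ _ := by
  refine LinearMap.ext fun k => WithLp.ofLp_injective _ ?_
  have h := devMap_apply h₀₂ h₁₃ (Submodule.inclusion (kerSpace_le_kerSpace_left h₁₃) k) k 0 0
    (by simp)
  refine Prod.ext h.1 (Subtype.ext (h.2.trans ?_))
  simp

/-- The development map is `ρ₀` on `K₀₁₂ᗮ ∩ K₀₁₃`. -/
theorem devMap_comp_sumInl_right :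
    (devMap h₀₂ h₁₃).toLinearMap ∘ₗ (WithLp.linearEquiv 2 ℂ _).symm.toLinearMap ∘ₗ
      LinearMap.inl ℂ _ _ ∘ₗ Submodule.inclusion
        (inf_le_right : devSource L₀₁ L₁₂ L₁₃ ≤ kerSpace L₀₁ L₁₃)
      = (WithLp.linearEquiv 2 ℂ _).symm.toLinearMap ∘ₗ LinearMap.inr ℂ _ _ ∘ₗ
        Submodule.inclusion (inf_le_right : devTarget L₁₂ L₂₃ L₀₂ ≤ kerSpace L₀₂ L₂₃) ∘ₗ
        (devIso₀ h₀₂ h₁₃).toLinearMap := by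
  refine LinearMap.ext fun v => WithLp.ofLp_injective _ ?_
  have h := devMap_apply h₀₂ h₁₃ (Submodule.inclusion
    (inf_le_right : devSource L₀₁ L₁₂ L₁₃ ≤ kerSpace L₀₁ L₁₃) v) 0 v 0 (by simp)
  refine Prod.ext h.1 (Subtype.ext (h.2.trans ?_))
  simp

/-- The development map is the identity on `K₁₂₃`. -/
theorem devMap_comp_sumInr :
    (devMap h₀₂ h₁₃).toLinearMap ∘ₗ (WithLp.linearEquiv 2 ℂ _).symm.toLinearMap ∘ₗ
      LinearMap.inr ℂ _ _
      = (WithLp.linearEquiv 2 ℂ _).symm.toLinearMap ∘ₗ LinearMap.inr ℂ _ _ ∘ₗ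
        Submodule.inclusion (kerSpace_le_kerSpace_right h₀₂) := by
  refine LinearMap.ext fun u => WithLp.ofLp_injective _ ?_
  have h := devMap_apply h₀₂ h₁₃ 0 0 0 u (by simp)
  refine Prod.ext h.1 (Subtype.ext (h.2.trans ?_))
  simp

theorem finrank_kerSpace_right [FiniteDimensional ℂ (kerSpace L₀₂ L₂₃)]
    (h₀₂ : L₀₂ = relComp L₀₁ L₁₂) (h₁₃ : L₁₃ = relComp L₁₂ L₂₃) :
    Module.finrank ℂ (kerSpace L₀₂ L₂₃)
      = Module.finrank ℂ (devSource L₀₁ L₁₂ L₁₃) + Module.finrank ℂ (kerSpace L₁₂ L₂₃) := by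
  rw [(splitEquiv (kerSpace_le_kerSpace_right (L₂₃ := L₂₃) h₀₂)).finrank_eq, Module.finrank_prod,
    (devIso₀ h₀₂ h₁₃).finrank_eq, add_comm]

variable [FiniteDimensional ℂ (kerSpace L₀₁ L₁₃)] [FiniteDimensional ℂ (kerSpace L₀₂ L₂₃)]

/-- The operator `ρ₀* ρ₀` on `K₀₁₂ᗮ ∩ K₀₁₃`. -/
def devGram : devSource L₀₁ L₁₂ L₁₃ →ₗ[ℂ] devSource L₀₁ L₁₂ L₁₃ :=
  (LinearMap.adjoint (devIso₀ h₀₂ h₁₃).toLinearMap).comp (devIso₀ h₀₂ h₁₃).toLinearMap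

theorem inner_devGram (v v' : devSource L₀₁ L₁₂ L₁₃) :
    ⟪v, devGram h₀₂ h₁₃ v'⟫_ℂ = ⟪devIso₀ h₀₂ h₁₃ v, devIso₀ h₀₂ h₁₃ v'⟫_ℂ := by
  rw [devGram, LinearMap.comp_apply, LinearMap.adjoint_inner_right, LinearEquiv.coe_coe]

theorem isSymmetric_devGram : (devGram h₀₂ h₁₃).IsSymmetric := fun v v' => by
  rw [inner_devGram, ← inner_conj_symm, inner_devGram, inner_conj_symm]

/-- In the decomposition `K₀₁₃ ⊕ K₁₂₃ = K₀₁₂ ⊕ (K₀₁₂ᗮ ∩ K₀₁₃) ⊕ K₁₂₃`, the operator `ρ* ρ` is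
`id ⊕ ρ₀* ρ₀ ⊕ id`. -/
theorem inner_devMap_devMap (k k' : kerSpace L₀₁ L₁₂) (v v' : devSource L₀₁ L₁₂ L₁₃)
    (u u' : kerSpace L₁₂ L₂₃) :
    ⟪devMap h₀₂ h₁₃ (WithLp.toLp 2
        ((splitEquiv (kerSpace_le_kerSpace_left (L₀₁ := L₀₁) h₁₃)).symm (k, v), u)),
      devMap h₀₂ h₁₃ (WithLp.toLp 2
        ((splitEquiv (kerSpace_le_kerSpace_left (L₀₁ := L₀₁) h₁₃)).symm (k', v'), u'))⟫_ℂ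
      = ⟪(WithLp.toLp 2
        ((splitEquiv (kerSpace_le_kerSpace_left (L₀₁ := L₀₁) h₁₃)).symm (k, v), u) :
          WithLp 2 (kerSpace L₀₁ L₁₃ × kerSpace L₁₂ L₂₃)),
        WithLp.toLp 2 ((splitEquiv (kerSpace_le_kerSpace_left (L₀₁ := L₀₁) h₁₃)).symm
          (k', devGram h₀₂ h₁₃ v'), u')⟫_ℂ := by
  have h1 := devMap_apply h₀₂ h₁₃
    ((splitEquiv (kerSpace_le_kerSpace_left (L₀₁ := L₀₁) h₁₃)).symm (k, v)) k v u rfl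
  have h2 := devMap_apply h₀₂ h₁₃
    ((splitEquiv (kerSpace_le_kerSpace_left (L₀₁ := L₀₁) h₁₃)).symm (k', v')) k' v' u' rfl
  have o1 : ⟪(u : W₂), (devIso₀ h₀₂ h₁₃ v' : W₂)⟫_ℂ = 0 :=
    Submodule.inner_right_of_mem_orthogonal u.2 (devIso₀ h₀₂ h₁₃ v').2.1
  have o2 : ⟪(devIso₀ h₀₂ h₁₃ v : W₂), (u' : W₂)⟫_ℂ = 0 :=
    Submodule.inner_left_of_mem_orthogonal u'.2 (devIso₀ h₀₂ h₁₃ v).2.1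
  have o3 : ⟪(k : W₁), (devGram h₀₂ h₁₃ v' : W₁)⟫_ℂ = 0 :=
    Submodule.inner_right_of_mem_orthogonal k.2 (devGram h₀₂ h₁₃ v').2.1
  have o4 : ⟪(v : W₁), (k' : W₁)⟫_ℂ = 0 :=
    Submodule.inner_left_of_mem_orthogonal k'.2 v.2.1
  have hG : ⟪(v : W₁), (devGram h₀₂ h₁₃ v' : W₁)⟫_ℂ
      = ⟪(devIso₀ h₀₂ h₁₃ v : W₂), (devIso₀ h₀₂ h₁₃ v' : W₂)⟫_ℂ := inner_devGram h₀₂ h₁₃ v v'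
  rw [WithLp.prod_inner_apply, WithLp.prod_inner_apply]
  change ⟪(devMap h₀₂ h₁₃ _).fst, (devMap h₀₂ h₁₃ _).fst⟫_ℂ
    + ⟪((devMap h₀₂ h₁₃ _).snd : W₂), ((devMap h₀₂ h₁₃ _).snd : W₂)⟫_ℂ
    = ⟪(k : W₁) + v, (k' : W₁) + devGram h₀₂ h₁₃ v'⟫_ℂ + ⟪(u : W₂), (u' : W₂)⟫_ℂ
  rw [h1.1, h1.2, h2.1, h2.2]
  simp only [inner_add_left, inner_add_right, o1, o2, o3, o4, hG, Submodule.coe_inner]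
  ring

/-- Since `ρ` is the identity on `K₀₁₂` and `K₁₂₃`, `det (ρ* ρ) = det (ρ₀* ρ₀)`. -/
theorem devDet_eq : devDet h₀₂ h₁₃ = LinearMap.det (devGram h₀₂ h₁₃) := by
  let Φ : WithLp 2 (kerSpace L₀₁ L₁₃ × kerSpace L₁₂ L₂₃) ≃ₗ[ℂ]
      (kerSpace L₀₁ L₁₂ × devSource L₀₁ L₁₂ L₁₃) × kerSpace L₁₂ L₂₃ :=
    WithLp.linearEquiv 2 ℂ _ ≪≫ₗ
      (splitEquiv (kerSpace_le_kerSpace_left (L₀₁ := L₀₁) h₁₃)).prodCongr (LinearEquiv.refl ℂ _)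
  have h : Φ.toLinearMap ∘ₗ ((LinearMap.adjoint (devMap h₀₂ h₁₃).toLinearMap).comp
      (devMap h₀₂ h₁₃).toLinearMap) ∘ₗ Φ.symm.toLinearMap
      = (LinearMap.id.prodMap (devGram h₀₂ h₁₃)).prodMap LinearMap.id := by
    refine LinearMap.ext fun x => ?_
    obtain ⟨⟨k', v'⟩, u'⟩ := x
    rw [LinearMap.comp_apply, LinearEquiv.coe_coe, ← LinearEquiv.eq_symm_apply]
    refine ext_inner_left ℂ fun y => ?_
    obtain ⟨⟨⟨k, v⟩, u⟩, rfl⟩ := Φ.symm.surjective y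
    rw [LinearMap.comp_apply, LinearMap.comp_apply, LinearMap.adjoint_inner_right]
    exact inner_devMap_devMap h₀₂ h₁₃ k k' v v' u u'
  rw [devDet, ← LinearMap.det_conj _ Φ, h, LinearMap.det_prodMap, LinearMap.det_prodMap,
    LinearMap.det_id, LinearMap.det_id, one_mul, mul_one]

end DevMap

end Development

/-! ### Moving vectors through the middle factor -/

section Move

/-- If `z` anticommutes with the vectors `x₁, …, xₙ`, then `z B p = 0` implies
`z x₁ ⋯ xₙ B p = 0`. -/
theorem ι_mul_prod_smul_eq_zero {W : Type*} [NormedAddCommGroup W] [InnerProductSpace ℂ W]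
    {J : RealStructure W} {P : Type*} [AddCommGroup P] [Module (Cl J) P] {p : P} {z : W}
    {B : Cl J} (hB : (CliffordAlgebra.ι J.quadForm z * B) • p = 0) {n : ℕ} (x : Fin n → W)
    (hx : ∀ i, J.form z (x i) = 0) :
    (CliffordAlgebra.ι J.quadForm z *
      ((List.ofFn fun i => CliffordAlgebra.ι J.quadForm (x i)).prod * B)) • p = 0 := by
  induction n with
  | zero => simpa using hB
  | succ n ih =>
    have h := ih (fun i => x i.succ) fun i => hx i.succ
    rw [List.ofFn_succ, List.prod_cons, mul_assoc, ← mul_assoc, Cl.ι_mul_ι, hx, map_zero, zero_sub,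
      neg_mul, mul_assoc, neg_smul, mul_smul, h, smul_zero, neg_zero]

variable {W₀ W₁ W₂ W₃ : Type*}
  [NormedAddCommGroup W₀] [InnerProductSpace ℂ W₀]
  [NormedAddCommGroup W₁] [InnerProductSpace ℂ W₁]
  [NormedAddCommGroup W₂] [InnerProductSpace ℂ W₂]
  [NormedAddCommGroup W₃] [InnerProductSpace ℂ W₃]
  {J₀ : RealStructure W₀} {J₁ : RealStructure W₁} {J₂ : RealStructure W₂}
  {J₃ : RealStructure W₃}
  (L₀₁ : LagRel J₀ J₁) (L₁₂ : LagRel J₁ J₂) (L₂₃ : LagRel J₂ J₃)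

/-- The element `(m ⊗ n) ⊗ p` of the iterated tensor product of Fock modules. -/
def tripleTensor (m : Fock L₀₁) (n : Fock L₁₂) (p : Fock L₂₃) :
    BalTensor (Cl J₂) (BalTensor (Cl J₁) (Fock L₀₁) (Fock L₁₂)) (Fock L₂₃) :=
  BalTensor.mk (Cl J₂) (BalTensor (Cl J₁) (Fock L₀₁) (Fock L₁₂)) (Fock L₂₃)
    (BalTensor.mk (Cl J₁) (Fock L₀₁) (Fock L₁₂) m n) p

variable {L₀₁ L₁₂ L₂₃}

theorem tripleTensor_op_smul_left (m : Fock L₀₁) (A : Cl J₁) (n : Fock L₁₂) (p : Fock L₂₃) :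
    tripleTensor L₀₁ L₁₂ L₂₃ (op A • m) n p = tripleTensor L₀₁ L₁₂ L₂₃ m (A • n) p := by
  rw [tripleTensor, BalTensor.mk_op_smul, tripleTensor]

theorem tripleTensor_op_smul_right (m : Fock L₀₁) (n : Fock L₁₂) (B : Cl J₂) (p : Fock L₂₃) :
    tripleTensor L₀₁ L₁₂ L₂₃ m (op B • n) p = tripleTensor L₀₁ L₁₂ L₂₃ m n (B • p) := by
  rw [tripleTensor, tripleTensor, ← BalTensor.mk_op_smul, BalTensor.op_smul_mk_right]

theorem tripleTensor_smul_left (c : ℂ) (m : Fock L₀₁) (n : Fock L₁₂) (p : Fock L₂₃) :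
    tripleTensor L₀₁ L₁₂ L₂₃ (c • m) n p = c • tripleTensor L₀₁ L₁₂ L₂₃ m n p := by
  rw [tripleTensor, map_smul, LinearMap.smul_apply, map_smul, LinearMap.smul_apply, tripleTensor]

theorem tripleTensor_smul_mid (c : ℂ) (m : Fock L₀₁) (n : Fock L₁₂) (p : Fock L₂₃) :
    tripleTensor L₀₁ L₁₂ L₂₃ m (c • n) p = c • tripleTensor L₀₁ L₁₂ L₂₃ m n p := by
  rw [tripleTensor, map_smul, map_smul, LinearMap.smul_apply, tripleTensor]

theorem tripleTensor_smul_right (c : ℂ) (m : Fock L₀₁) (n : Fock L₁₂) (p : Fock L₂₃) :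
    tripleTensor L₀₁ L₁₂ L₂₃ m n (c • p) = c • tripleTensor L₀₁ L₁₂ L₂₃ m n p := by
  rw [tripleTensor, map_smul, tripleTensor]

theorem form_conj_left {W : Type*} [NormedAddCommGroup W] [InnerProductSpace ℂ W]
    (J : RealStructure W) (v w : W) : J.form (J.conj v) w = ⟪v, w⟫_ℂ := by
  rw [RealStructure.form_apply, J.conj_conj]

/-- Moving a single vector: if `(v, w) ∈ L₁₂`, then `conj v · Ω₁₂ = Ω₁₂ · conj w`.  Evaluating
`m A v ⊗ Ω₁₂ ⊗ conj w · w B p` by moving `conj w` to the right or to the left yields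
`|w|² (m A v ⊗ Ω₁₂ ⊗ B p)` and `|v|² (m A ⊗ Ω₁₂ ⊗ w B p)`, if `m A (conj v)` and `(conj w) B p`
vanish. -/
theorem tripleTensor_move {v : W₁} {w : W₂} (hvw : WithLp.toLp 2 (v, w) ∈ L₁₂.carrier)
    {m : Fock L₀₁} {p : Fock L₂₃} {A : Cl J₁} {B : Cl J₂}
    (hA : op (A * CliffordAlgebra.ι J₁.quadForm (J₁.conj v)) • m = 0)
    (hB : (CliffordAlgebra.ι J₂.quadForm (J₂.conj w) * B) • p = 0) :
    ⟪w, w⟫_ℂ • tripleTensor L₀₁ L₁₂ L₂₃ (op (A * CliffordAlgebra.ι J₁.quadForm v) • m)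
        (Fock.vacuum L₁₂) (B • p)
      = ⟪v, v⟫_ℂ • tripleTensor L₀₁ L₁₂ L₂₃ (op A • m) (Fock.vacuum L₁₂)
        ((CliffordAlgebra.ι J₂.quadForm w * B) • p) := by
  have e1 : CliffordAlgebra.ι J₂.quadForm (J₂.conj w) •
      (CliffordAlgebra.ι J₂.quadForm w * B) • p = ⟪w, w⟫_ℂ • B • p := by
    rw [← mul_smul, ← mul_assoc, Cl.ι_mul_ι, sub_mul, mul_assoc, sub_smul, mul_smul (_ : Cl J₂) _ p,
      mul_smul (_ : Cl J₂) _ p, hB, smul_zero, sub_zero, algebraMap_smul, form_conj_left]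
  have e2 : op (CliffordAlgebra.ι J₁.quadForm (J₁.conj v)) •
      op (A * CliffordAlgebra.ι J₁.quadForm v) • m = ⟪v, v⟫_ℂ • op A • m := by
    have h : A * CliffordAlgebra.ι J₁.quadForm v * CliffordAlgebra.ι J₁.quadForm (J₁.conj v)
        = ⟪v, v⟫_ℂ • A - A * CliffordAlgebra.ι J₁.quadForm (J₁.conj v)
          * CliffordAlgebra.ι J₁.quadForm v := by
      rw [mul_assoc, Cl.ι_mul_ι, J₁.form_comm, form_conj_left, mul_sub, mul_assoc,
        ← Algebra.commutes, ← Algebra.smul_def]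
    rw [← mul_smul, ← op_mul, h, op_sub, sub_smul, op_mul (A * _), mul_smul _ _ m, hA, smul_zero,
      sub_zero, op_smul, smul_assoc]
  have e3 : CliffordAlgebra.ι J₁.quadForm (J₁.conj v) • Fock.vacuum L₁₂
      = op (CliffordAlgebra.ι J₂.quadForm (J₂.conj w)) • Fock.vacuum L₁₂ := by
    have := Fock.ι_smul_vacuum (Fock.conj_mem_orthogonal hvw)
    rwa [map_neg, op_neg, neg_smul, neg_neg] at this
  rw [← tripleTensor_smul_right, ← e1, ← tripleTensor_op_smul_right, ← e3,
    ← tripleTensor_op_smul_left, e2, tripleTensor_smul_left]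

/-- Moving several vectors: for orthonormal `vᵢ` and orthogonal `wᵢ` with `(vᵢ, wᵢ) ∈ L₁₂`. -/
theorem tripleTensor_move_prod {n : ℕ} {v : Fin n → W₁} {w : Fin n → W₂}
    (hvw : ∀ i, WithLp.toLp 2 (v i, w i) ∈ L₁₂.carrier) (hv : Orthonormal ℂ v)
    (hw : Pairwise fun i j => ⟪w i, w j⟫_ℂ = 0)
    {m : Fock L₀₁} {p : Fock L₂₃} {A : Cl J₁} {B : Cl J₂}
    (hA : ∀ i, op (A * CliffordAlgebra.ι J₁.quadForm (J₁.conj (v i))) • m = 0)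
    (hB : ∀ i, (CliffordAlgebra.ι J₂.quadForm (J₂.conj (w i)) * B) • p = 0) :
    (∏ i, ⟪w i, w i⟫_ℂ) • tripleTensor L₀₁ L₁₂ L₂₃
        (op (A * (List.ofFn fun i => CliffordAlgebra.ι J₁.quadForm (v i)).prod) • m)
        (Fock.vacuum L₁₂) (B • p)
      = tripleTensor L₀₁ L₁₂ L₂₃ (op A • m) (Fock.vacuum L₁₂)
        (((List.ofFn fun i => CliffordAlgebra.ι J₂.quadForm (w i)).prod * B) • p) := by
  induction n generalizing A with
  | zero => simp
  | succ n ih =>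
    have hA' : ∀ i : Fin n, op (A * CliffordAlgebra.ι J₁.quadForm (v 0)
        * CliffordAlgebra.ι J₁.quadForm (J₁.conj (v i.succ))) • m = 0 := fun i => by
      rw [mul_assoc, Cl.ι_mul_ι, J₁.form_comm, form_conj_left, hv.2 (Fin.succ_ne_zero i), map_zero,
        zero_sub, mul_neg, op_neg, neg_smul, ← mul_assoc, op_mul, mul_smul _ _ m, hA, smul_zero,
        neg_zero]
    have h1 := ih (v := fun i => v i.succ) (w := fun i => w i.succ) (fun i => hvw i.succ)
      (hv.comp _ (Fin.succ_injective n)) (fun i j hij => hw fun h => hij (Fin.succ_injective n h))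
      hA' (fun i => hB i.succ)
    have h2 := tripleTensor_move (hvw 0) (hA 0)
      (ι_mul_prod_smul_eq_zero (hB 0) (fun i : Fin n => w i.succ) fun i => by
        rw [form_conj_left, hw (Fin.succ_ne_zero i).symm])
    have hv0 : ⟪v 0, v 0⟫_ℂ = 1 := by
      rw [inner_self_eq_norm_sq_to_K, hv.1 0]
      simp
    rw [hv0, one_smul] at h2
    rw [Fin.prod_univ_succ, mul_smul, List.ofFn_succ, List.ofFn_succ, List.prod_cons,
      List.prod_cons, ← mul_assoc, h1, h2, mul_assoc]

end Move

/-! ### The two composites -/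

section Coherence

variable {W₀ W₁ W₂ W₃ : Type*}
  [NormedAddCommGroup W₀] [InnerProductSpace ℂ W₀]
  [NormedAddCommGroup W₁] [InnerProductSpace ℂ W₁]
  [NormedAddCommGroup W₂] [InnerProductSpace ℂ W₂]
  [NormedAddCommGroup W₃] [InnerProductSpace ℂ W₃]
  {J₀ : RealStructure W₀} {J₁ : RealStructure W₁} {J₂ : RealStructure W₂}
  {J₃ : RealStructure W₃}
  {L₀₁ : LagRel J₀ J₁} {L₁₂ : LagRel J₁ J₂} {L₂₃ : LagRel J₂ J₃}
  {L₀₂ : LagRel J₀ J₂} {L₁₃ : LagRel J₁ J₃} {L₀₃ : LagRel J₀ J₃}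

open Fock

theorem Fock.smul_gluedVacuum (a : Cl J₀) (b : Cl J₂)
    (κ : TopPower (kerSpace L₀₁.carrier L₁₂.carrier)) :
    a • op b • gluedVacuum L₀₁ L₁₂ κ = BalTensor.mk (Cl J₁) (Fock L₀₁) (Fock L₁₂)
      (op (kerHom L₀₁ L₁₂ (κ : ExteriorAlgebra ℂ _)) • a • vacuum L₀₁) (op b • vacuum L₁₂) := by
  rw [gluedVacuum_apply, BalTensor.op_smul_mk_right, BalTensor.smul_mk, smul_op_smul_comm]

/-- The value of the first composite on the orbit of `Ω₀₃`. -/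
theorem left_composite_apply {α₀₁₃ : GluingHom L₀₁ L₁₃ L₀₃} {α₁₂₃ : GluingHom L₁₂ L₂₃ L₁₃}
    (h₀₁₃ : IsGluing α₀₁₃) (h₁₂₃ : IsGluing α₁₂₃) (a : Cl J₀) (b : Cl J₃)
    (κ : TopPower (kerSpace L₀₁.carrier L₁₃.carrier))
    (μ : TopPower (kerSpace L₁₂.carrier L₂₃.carrier))
    {t : Fock L₀₃ ⊗[ℂ] (TopPower (kerSpace L₀₁.carrier L₁₃.carrier) ⊗[ℂ]
      TopPower (kerSpace L₁₂.carrier L₂₃.carrier))}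
    (ht : t = (a • op b • vacuum L₀₃) ⊗ₜ (κ ⊗ₜ μ)) :
    BalTensor.assocHom J₁.quadForm J₂.quadForm (Fock L₀₁) (Fock L₁₂) (Fock L₂₃)
      (BalTensor.idTensor (Fock L₀₁) α₁₂₃
        (Twist.moveRight (Fock L₀₁) (Fock L₁₃) (kerSpace L₁₂.carrier L₂₃.carrier)
          (LinearMap.rTensor (TopPower (kerSpace L₁₂.carrier L₂₃.carrier)) α₀₁₃.toLinearMap
            (Twist.assoc (Fock L₀₃) (kerSpace L₀₁.carrier L₁₃.carrier)
              (kerSpace L₁₂.carrier L₂₃.carrier) t))))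
      = tripleTensor L₀₁ L₁₂ L₂₃ (op (kerHom L₀₁ L₁₃ (κ : ExteriorAlgebra ℂ _)) • a • vacuum L₀₁)
        (vacuum L₁₂) (kerHom L₁₂ L₂₃ (μ : ExteriorAlgebra ℂ _) •
          op ((CliffordAlgebra.involute ^ (Module.finrank ℂ (kerSpace L₁₂.carrier L₂₃.carrier)
            + Module.finrank ℂ (kerSpace L₀₁.carrier L₁₃.carrier)) :
              Cl J₃ →ₐ[ℂ] Cl J₃) b) • vacuum L₂₃) := by
  subst ht
  have e1 : LinearMap.rTensor (TopPower (kerSpace L₁₂.carrier L₂₃.carrier)) α₀₁₃.toLinearMap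
      (Twist.assoc (Fock L₀₃) (kerSpace L₀₁.carrier L₁₃.carrier)
        (kerSpace L₁₂.carrier L₂₃.carrier) ((a • op b • vacuum L₀₃) ⊗ₜ (κ ⊗ₜ μ)))
      = α₀₁₃.toLinearMap (Twist.tmul _ _ (a • op b • vacuum L₀₃) κ) ⊗ₜ μ := rfl
  have e2 := h₁₂₃.apply_smul 1 ((CliffordAlgebra.involute ^
    Module.finrank ℂ (kerSpace L₀₁.carrier L₁₃.carrier) : Cl J₃ →ₐ[ℂ] Cl J₃) b) μ
  rw [smul_gluedVacuum, one_smul, one_smul, ← AlgHom.mul_apply, ← pow_add] at e2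
  rw [e1, h₀₁₃.apply_smul, smul_gluedVacuum, Twist.moveRight_mk]
  refine (congrArg _ (congrArg (BalTensor.mk (Cl J₁) (Fock L₀₁) _ _) e2)).trans ?_
  rw [BalTensor.assocHom_mk]
  exact tripleTensor_op_smul_right _ _ _ _

/-- The value of the second composite on the orbit of `Ω₀₃`; the sign from the
exchange of the determinant lines cancels the one from moving `κ ∈ Λ^top K₀₁₂` past the Clifford
element of `μ ∈ Λ^top K₀₂₃`. -/
theorem right_composite_apply {α₀₁₂ : GluingHom L₀₁ L₁₂ L₀₂} {α₀₂₃ : GluingHom L₀₂ L₂₃ L₀₃}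
    (h₀₁₂ : IsGluing α₀₁₂) (h₀₂₃ : IsGluing α₀₂₃) (a : Cl J₀) (b : Cl J₃)
    (κ : TopPower (kerSpace L₀₁.carrier L₁₂.carrier))
    (μ : TopPower (kerSpace L₀₂.carrier L₂₃.carrier)) (c : ℂ)
    {t : Fock L₀₃ ⊗[ℂ] (TopPower (kerSpace L₀₂.carrier L₂₃.carrier) ⊗[ℂ]
      TopPower (kerSpace L₀₁.carrier L₁₂.carrier))}
    (ht : t = (c * (-1 : ℂ) ^ (Module.finrank ℂ (kerSpace L₀₁.carrier L₁₂.carrier)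
      * Module.finrank ℂ (kerSpace L₀₂.carrier L₂₃.carrier))) •
        ((a • op b • vacuum L₀₃) ⊗ₜ (μ ⊗ₜ κ))) :
    BalTensor.tensorId α₀₁₂ (Fock L₂₃)
      (Twist.moveLeft (Fock L₀₂) (kerSpace L₀₁.carrier L₁₂.carrier) L₂₃
        (LinearMap.rTensor (TopPower (kerSpace L₀₁.carrier L₁₂.carrier)) α₀₂₃.toLinearMap
          (Twist.assoc (Fock L₀₃) (kerSpace L₀₂.carrier L₂₃.carrier)
            (kerSpace L₀₁.carrier L₁₂.carrier) t)))
      = c • tripleTensor L₀₁ L₁₂ L₂₃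
        (op (kerHom L₀₁ L₁₂ (κ : ExteriorAlgebra ℂ _)) • a • vacuum L₀₁)
        (vacuum L₁₂) (kerHom L₀₂ L₂₃ (μ : ExteriorAlgebra ℂ _) •
          op ((CliffordAlgebra.involute ^ (Module.finrank ℂ (kerSpace L₀₁.carrier L₁₂.carrier)
            + Module.finrank ℂ (kerSpace L₀₂.carrier L₂₃.carrier)) :
              Cl J₃ →ₐ[ℂ] Cl J₃) b) • vacuum L₂₃) := by
  subst ht
  have e1 : LinearMap.rTensor (TopPower (kerSpace L₀₁.carrier L₁₂.carrier)) α₀₂₃.toLinearMap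
      (Twist.assoc (Fock L₀₃) (kerSpace L₀₂.carrier L₂₃.carrier)
        (kerSpace L₀₁.carrier L₁₂.carrier) ((a • op b • vacuum L₀₃) ⊗ₜ (μ ⊗ₜ κ)))
      = α₀₂₃.toLinearMap (Twist.tmul _ _ (a • op b • vacuum L₀₃) μ) ⊗ₜ κ := rfl
  have e2 : ∀ (m : Fock L₀₂) (n : Fock L₂₃), Twist.moveLeft (Fock L₀₂)
      (kerSpace L₀₁.carrier L₁₂.carrier) L₂₃ (BalTensor.mk (Cl J₂) (Fock L₀₂) (Fock L₂₃) m n ⊗ₜ κ)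
      = BalTensor.mk (Cl J₂) _ (Fock L₂₃) (Twist.tmul _ _ m κ)
        ((parity L₂₃ ^ Module.finrank ℂ (kerSpace L₀₁.carrier L₁₂.carrier)) n) :=
    fun _ _ => rfl
  have e3 : op ((CliffordAlgebra.involute ^
        Module.finrank ℂ (kerSpace L₀₁.carrier L₁₂.carrier) : Cl J₂ →ₐ[ℂ] Cl J₂)
          (kerHom L₀₂ L₂₃ (μ : ExteriorAlgebra ℂ _))) • vacuum L₁₂
      = (-1 : ℂ) ^ (Module.finrank ℂ (kerSpace L₀₁.carrier L₁₂.carrier)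
          * Module.finrank ℂ (kerSpace L₀₂.carrier L₂₃.carrier)) •
        op (kerHom L₀₂ L₂₃ (μ : ExteriorAlgebra ℂ _)) • vacuum L₁₂ := by
    rw [kerHom, involute_pow_isotropicHom _ μ.2, op_smul, smul_assoc]
  have e4 := h₀₁₂.apply_smul a (kerHom L₀₂ L₂₃ (μ : ExteriorAlgebra ℂ _)) κ
  rw [smul_gluedVacuum, e3] at e4
  have hsign : ∀ n : ℕ, (-1 : ℂ) ^ n * (-1) ^ n = 1 := fun n => by
    rw [← mul_pow, neg_one_mul, neg_neg, one_pow]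
  rw [LinearMap.map_smul, LinearMap.map_smul, LinearMap.map_smul, LinearMap.map_smul, mul_smul]
  refine congrArg (c • ·) ((smul_right_injective _ (pow_ne_zero _ (neg_ne_zero.2 one_ne_zero))
    (?_ : (-1 : ℂ) ^ (Module.finrank ℂ (kerSpace L₀₁.carrier L₁₂.carrier)
      * Module.finrank ℂ (kerSpace L₀₂.carrier L₂₃.carrier)) • _ = _)))
  rw [smul_smul, hsign, one_smul]
  rw [e1, h₀₂₃.apply_smul, smul_gluedVacuum, e2, parity_pow_op_smul_vacuum, ← AlgHom.mul_apply,
    ← pow_add, ← smul_op_smul_comm]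
  refine (congrArg (fun x => BalTensor.mk (Cl J₂)
    (BalTensor (Cl J₁) (Fock L₀₁) (Fock L₁₂)) (Fock L₂₃) x (op ((CliffordAlgebra.involute ^
      (Module.finrank ℂ (kerSpace L₀₁.carrier L₁₂.carrier)
        + Module.finrank ℂ (kerSpace L₀₂.carrier L₂₃.carrier)) : Cl J₃ →ₐ[ℂ] Cl J₃) b) •
          vacuum L₂₃)) e4).trans ?_
  exact (tripleTensor_smul_mid _ _ _ _).trans (congrArg _ (tripleTensor_op_smul_right _ _ _ _))

/-- A vector `v` with `(0, v) ∈ L₀₁` that is orthogonal to `K₀₁₂`: its conjugate kills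
`Ω₀₁ · κ` for `κ ∈ ΛK₀₁₂`. -/
theorem Fock.op_kerHom_mul_ι_conj_smul {v : W₁} (hv : WithLp.toLp 2 (0, v) ∈ L₀₁.carrier)
    (hv' : v ∈ (kerSpace L₀₁.carrier L₁₂.carrier)ᗮ)
    (x : ExteriorAlgebra ℂ (kerSpace L₀₁.carrier L₁₂.carrier)) (a : Cl J₀) :
    op (kerHom L₀₁ L₁₂ x * CliffordAlgebra.ι J₁.quadForm (J₁.conj v)) • a • vacuum L₀₁ = 0 := by
  have h1 := ι_mul_isotropicHom (J := J₁) quadForm_kerSpace_left (z := J₁.conj v)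
    (fun e => by
      rw [form_conj_left]
      exact Submodule.inner_left_of_mem_orthogonal e.2 hv')
    (CliffordAlgebra.involute x)
  rw [CliffordAlgebra.involute_involute] at h1
  have h2 := ι_smul_vacuum (conj_mem_orthogonal hv)
  rw [map_zero, map_zero, zero_smul, zero_eq_neg, map_neg, op_neg, neg_smul, neg_eq_zero] at h2
  rw [kerHom, ← h1, ← smul_op_smul_comm, op_mul, mul_smul, h2, smul_zero, smul_zero]

/-- A vector `w` with `(w, 0) ∈ L₂₃` that is orthogonal to `K₁₂₃`: its conjugate kills
`κ · Ω₂₃` for `κ ∈ ΛK₁₂₃`. -/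
theorem Fock.ι_conj_mul_kerHom_smul {w : W₂} (hw : WithLp.toLp 2 (w, 0) ∈ L₂₃.carrier)
    (hw' : w ∈ (kerSpace L₁₂.carrier L₂₃.carrier)ᗮ)
    (x : ExteriorAlgebra ℂ (kerSpace L₁₂.carrier L₂₃.carrier)) (b : Cl J₃) :
    (CliffordAlgebra.ι J₂.quadForm (J₂.conj w) * kerHom L₁₂ L₂₃ x) • op b • vacuum L₂₃ = 0 := by
  have h1 := ι_mul_isotropicHom (J := J₂) quadForm_kerSpace_left (z := J₂.conj w)
    (fun e => by
      rw [form_conj_left]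
      exact Submodule.inner_left_of_mem_orthogonal e.2 hw') x
  have h2 := ι_smul_vacuum (conj_mem_orthogonal hw)
  rw [map_zero, neg_zero, map_zero, op_zero, zero_smul, neg_zero] at h2
  rw [kerHom, h1, smul_op_smul_comm, mul_smul, h2, smul_zero, smul_zero]

variable [FiniteDimensional ℂ (kerSpace L₀₁.carrier L₁₂.carrier)]
  [FiniteDimensional ℂ (kerSpace L₀₁.carrier L₁₃.carrier)]
  (h₁₃ : L₁₃.carrier = relComp L₁₂.carrier L₂₃.carrier)

/-- The element `κ ∧ σ ∈ Λ^top K₀₁₃` for `κ ∈ Λ^top K₀₁₂` and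
`σ ∈ Λ^top (K₀₁₂ᗮ ∩ K₀₁₃)`. -/
def leftTop (κ : TopPower (kerSpace L₀₁.carrier L₁₂.carrier))
    (σ : TopPower (devSource L₀₁.carrier L₁₂.carrier L₁₃.carrier)) :
    TopPower (kerSpace L₀₁.carrier L₁₃.carrier) :=
  topMul (Submodule.inclusion (kerSpace_le_kerSpace_left h₁₃)) (Submodule.inclusion inf_le_right)
    (finrank_kerSpace_left h₁₃) κ σ

theorem leftTop_ne_zero {κ : TopPower (kerSpace L₀₁.carrier L₁₂.carrier)}
    {σ : TopPower (devSource L₀₁.carrier L₁₂.carrier L₁₃.carrier)} (hκ : κ ≠ 0) (hσ : σ ≠ 0) :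
    leftTop h₁₃ κ σ ≠ 0 := by
  refine topMul_ne_zero _ ((WithLp.linearEquiv 2 ℂ _).symm.toLinearMap ∘ₗ
    (splitEquiv (kerSpace_le_kerSpace_left h₁₃)).toLinearMap) ?_ ?_ hκ hσ
  · refine LinearMap.ext fun k => WithLp.ofLp_injective _ ?_
    have h : splitEquiv (kerSpace_le_kerSpace_left h₁₃)
        (Submodule.inclusion (kerSpace_le_kerSpace_left h₁₃) k) = (k, 0) := by
      rw [← LinearEquiv.eq_symm_apply]
      exact Subtype.ext (add_zero (k : W₁)).symm
    exact h
  · refine LinearMap.ext fun v => WithLp.ofLp_injective _ ?_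
    have h : splitEquiv (kerSpace_le_kerSpace_left h₁₃) (Submodule.inclusion
        (inf_le_right : devSource L₀₁.carrier L₁₂.carrier L₁₃.carrier ≤ _) v) = (0, v) := by
      rw [← LinearEquiv.eq_symm_apply]
      exact Subtype.ext (zero_add (v : W₁)).symm
    exact h

variable [FiniteDimensional ℂ (kerSpace L₁₂.carrier L₂₃.carrier)]
  [FiniteDimensional ℂ (kerSpace L₀₂.carrier L₂₃.carrier)]
  (h₀₂ : L₀₂.carrier = relComp L₀₁.carrier L₁₂.carrier)

/-- The element `ρ₀(σ) ∧ μ ∈ Λ^top K₀₂₃` for `σ ∈ Λ^top (K₀₁₂ᗮ ∩ K₀₁₃)` and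
`μ ∈ Λ^top K₁₂₃`. -/
def rightTop (σ : TopPower (devSource L₀₁.carrier L₁₂.carrier L₁₃.carrier))
    (μ : TopPower (kerSpace L₁₂.carrier L₂₃.carrier)) :
    TopPower (kerSpace L₀₂.carrier L₂₃.carrier) :=
  topMul (Submodule.inclusion (inf_le_right : devTarget L₁₂.carrier L₂₃.carrier L₀₂.carrier ≤ _) ∘ₗ
      (devIso₀ h₀₂ h₁₃).toLinearMap)
    (Submodule.inclusion (kerSpace_le_kerSpace_right h₀₂))
    (finrank_kerSpace_right h₀₂ h₁₃) σ μ

theorem topMap_devMap_topWedge (κ : TopPower (kerSpace L₀₁.carrier L₁₂.carrier))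
    (σ : TopPower (devSource L₀₁.carrier L₁₂.carrier L₁₃.carrier))
    (μ : TopPower (kerSpace L₁₂.carrier L₂₃.carrier)) :
    topMap (devMap h₀₂ h₁₃) (topWedge _ _ (leftTop h₁₃ κ σ ⊗ₜ μ))
      = topWedge _ _ (κ ⊗ₜ rightTop h₁₃ h₀₂ σ μ) := by
  refine Subtype.ext ?_
  rw [coe_topMap, coe_topWedge, coe_topWedge, map_mul, leftTop, rightTop, topMul, topMul]
  simp only [map_mul, ExteriorAlgebra.map_map_apply]
  rw [← mul_assoc]
  refine congrArg₂ (· * ·) (congrArg₂ (· * ·) ?_ ?_) ?_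
  · exact congrArg (fun f => ExteriorAlgebra.map f (κ : ExteriorAlgebra ℂ _))
      (devMap_comp_sumInl_left h₀₂ h₁₃)
  · exact congrArg (fun f => ExteriorAlgebra.map f (σ : ExteriorAlgebra ℂ _))
      (devMap_comp_sumInl_right h₀₂ h₁₃)
  · exact congrArg (fun f => ExteriorAlgebra.map f (μ : ExteriorAlgebra ℂ _))
      (devMap_comp_sumInr h₀₂ h₁₃)

/-- The orthonormal basis of `K₀₁₂ᗮ ∩ K₀₁₃` that consists of eigenvectors of `ρ₀* ρ₀`. -/
def devBasis : OrthonormalBasis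
    (Fin (Module.finrank ℂ (devSource L₀₁.carrier L₁₂.carrier L₁₃.carrier))) ℂ
    (devSource L₀₁.carrier L₁₂.carrier L₁₃.carrier) :=
  (isSymmetric_devGram h₀₂ h₁₃).eigenvectorBasis rfl

theorem inner_devIso₀_devBasis (i j) :
    ⟪devIso₀ h₀₂ h₁₃ (devBasis h₁₃ h₀₂ i), devIso₀ h₀₂ h₁₃ (devBasis h₁₃ h₀₂ j)⟫_ℂ
      = if i = j then (((isSymmetric_devGram h₀₂ h₁₃).eigenvalues rfl j : ℝ) : ℂ) else 0 := by
  rw [← inner_devGram, devBasis, LinearMap.IsSymmetric.apply_eigenvectorBasis, inner_smul_right,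
    OrthonormalBasis.inner_eq_ite, mul_ite, mul_one, mul_zero]
  rfl

theorem prod_inner_devIso₀_devBasis :
    ∏ i, ⟪(devIso₀ h₀₂ h₁₃ (devBasis h₁₃ h₀₂ i) : W₂), devIso₀ h₀₂ h₁₃ (devBasis h₁₃ h₀₂ i)⟫_ℂ
      = devDet h₀₂ h₁₃ := by
  rw [devDet_eq, (isSymmetric_devGram h₀₂ h₁₃).det_eq_prod_eigenvalues rfl]
  refine Finset.prod_congr rfl fun i _ => ?_
  exact (inner_devIso₀_devBasis h₁₃ h₀₂ i i).trans (if_pos rfl)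

theorem devDet_ne_zero : devDet h₀₂ h₁₃ ≠ 0 := by
  rw [← prod_inner_devIso₀_devBasis]
  refine Finset.prod_ne_zero_iff.2 fun i _ h => ?_
  have h' := inner_self_eq_zero.1 h
  rw [ZeroMemClass.coe_eq_zero, LinearEquiv.map_eq_zero_iff] at h'
  exact (devBasis h₁₃ h₀₂).orthonormal.ne_zero i h'

/-- The comparison of the two composites on the orbit of the vacuum: the vectors of
`K₀₁₂ᗮ ∩ K₀₁₃` are moved through `ΛL₁₂`, where they turn into their images under `ρ₀`. -/
theorem tripleTensor_leftTop (κ : TopPower (kerSpace L₀₁.carrier L₁₂.carrier))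
    (μ : TopPower (kerSpace L₁₂.carrier L₂₃.carrier)) (a : Cl J₀) (b : Cl J₃) :
    devDet h₀₂ h₁₃ • tripleTensor L₀₁ L₁₂ L₂₃
        (op (kerHom L₀₁ L₁₃ (leftTop h₁₃ κ (exteriorPower.ιMulti ℂ _ (devBasis h₁₃ h₀₂)) :
          ExteriorAlgebra ℂ _)) • a • vacuum L₀₁)
        (vacuum L₁₂) (kerHom L₁₂ L₂₃ (μ : ExteriorAlgebra ℂ _) • op b • vacuum L₂₃)
      = tripleTensor L₀₁ L₁₂ L₂₃
        (op (kerHom L₀₁ L₁₂ (κ : ExteriorAlgebra ℂ _)) • a • vacuum L₀₁) (vacuum L₁₂)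
        (kerHom L₀₂ L₂₃ (rightTop h₁₃ h₀₂ (exteriorPower.ιMulti ℂ _ (devBasis h₁₃ h₀₂)) μ :
          ExteriorAlgebra ℂ _) • op b • vacuum L₂₃) := by
  have hS : ∀ v : devSource L₀₁.carrier L₁₂.carrier L₁₃.carrier,
      J₁.quadForm (Submodule.subtype _ v) = 0 := fun v =>
    quadForm_kerSpace_left (L₁₂ := L₁₃) ⟨v, v.2.2⟩
  have hT : ∀ v : devSource L₀₁.carrier L₁₂.carrier L₁₃.carrier,
      J₂.quadForm ((Submodule.subtype _ ∘ₗ (devIso₀ h₀₂ h₁₃).toLinearMap) v) = 0 := fun v =>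
    quadForm_kerSpace_left (L₀₁ := L₀₂) ⟨devIso₀ h₀₂ h₁₃ v, (devIso₀ h₀₂ h₁₃ v).2.2⟩
  have e1 : kerHom L₀₁ L₁₃ (leftTop h₁₃ κ (exteriorPower.ιMulti ℂ _ (devBasis h₁₃ h₀₂)) :
      ExteriorAlgebra ℂ _) = kerHom L₀₁ L₁₂ (κ : ExteriorAlgebra ℂ _)
        * (List.ofFn fun i => CliffordAlgebra.ι J₁.quadForm (devBasis h₁₃ h₀₂ i : W₁)).prod := by
    rw [leftTop, topMul, map_mul, kerHom, kerHom,
      isotropicHom_map _ _ quadForm_kerSpace_left (by ext; rfl),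
      isotropicHom_map _ _ hS (by ext; rfl), isotropicHom_ιMulti]
    rfl
  have e2 : kerHom L₀₂ L₂₃ (rightTop h₁₃ h₀₂ (exteriorPower.ιMulti ℂ _ (devBasis h₁₃ h₀₂)) μ :
      ExteriorAlgebra ℂ _) = (List.ofFn fun i =>
          CliffordAlgebra.ι J₂.quadForm (devIso₀ h₀₂ h₁₃ (devBasis h₁₃ h₀₂ i) : W₂)).prod
        * kerHom L₁₂ L₂₃ (μ : ExteriorAlgebra ℂ _) := by
    rw [rightTop, topMul, map_mul, kerHom, kerHom, isotropicHom_map _ _ hT (by ext; rfl),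
      isotropicHom_map _ _ quadForm_kerSpace_left (by ext; rfl), isotropicHom_ιMulti]
    rfl
  rw [e1, e2, ← prod_inner_devIso₀_devBasis]
  refine tripleTensor_move_prod (fun i => devIso₀_mem h₀₂ h₁₃ _)
    ((devBasis h₁₃ h₀₂).orthonormal.comp_linearIsometry (Submodule.subtypeₗᵢ _))
    (fun i j hij => (inner_devIso₀_devBasis h₁₃ h₀₂ i j).trans (if_neg hij))
    (fun i => ?_) (fun i => ?_)
  · exact op_kerHom_mul_ι_conj_smul (devBasis h₁₃ h₀₂ i).2.2.1 (devBasis h₁₃ h₀₂ i).2.1 _ a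
  · exact ι_conj_mul_kerHom_smul (devIso₀ h₀₂ h₁₃ (devBasis h₁₃ h₀₂ i)).2.2.2
      (devIso₀ h₀₂ h₁₃ (devBasis h₁₃ h₀₂ i)).2.1 _ b

/-- Two linear maps out of `ΛL₀₃ ⊗ Λ^top E` are equal if they agree on the orbit of the vacuum
tensored with one nonzero element of the line `Λ^top E`. -/
theorem Fock.tensor_topPower_ext {E N : Type*} [AddCommGroup E] [Module ℂ E]
    [FiniteDimensional ℂ E] [AddCommGroup N] [Module ℂ N] {τ : TopPower E} (hτ : τ ≠ 0)
    {f g : Fock L₀₃ ⊗[ℂ] TopPower E →ₗ[ℂ] N}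
    (h : ∀ (a : Cl J₀) (b : Cl J₃),
      f ((a • op b • vacuum L₀₃) ⊗ₜ τ) = g ((a • op b • vacuum L₀₃) ⊗ₜ τ)) : f = g := by
  refine TensorProduct.ext (Fock.linearMap_ext fun a b => LinearMap.ext fun κ => ?_)
  obtain ⟨c, rfl⟩ := exists_smul_eq_of_finrank_eq_one finrank_topPower hτ κ
  rw [LinearMap.map_smul, LinearMap.map_smul]
  exact congrArg (c • ·) (h a b)

end Coherence

end

theorem theorem2p11
    {W₀ W₁ W₂ W₃ : Type*}
    [NormedAddCommGroup W₀] [InnerProductSpace ℂ W₀]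
    [NormedAddCommGroup W₁] [InnerProductSpace ℂ W₁]
    [NormedAddCommGroup W₂] [InnerProductSpace ℂ W₂]
    [NormedAddCommGroup W₃] [InnerProductSpace ℂ W₃]
    (J₀ : RealStructure W₀) (J₁ : RealStructure W₁) (J₂ : RealStructure W₂)
    (J₃ : RealStructure W₃)
    -- the given Lagrangians and their iterated compositions, which are again Lagrangians
    (L₀₁ : LagRel J₀ J₁) (L₁₂ : LagRel J₁ J₂) (L₂₃ : LagRel J₂ J₃)
    (L₀₂ : LagRel J₀ J₂) (L₁₃ : LagRel J₁ J₃) (L₀₃ : LagRel J₀ J₃)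
    (h₀₂ : L₀₂.carrier = relComp L₀₁.carrier L₁₂.carrier)
    (h₁₃ : L₁₃.carrier = relComp L₁₂.carrier L₂₃.carrier)
    (h₀₃ : L₀₃.carrier = relComp L₀₁.carrier L₁₃.carrier)
    -- the closedness conditions for each of the four compositions
    (g₀₁₂ : GluingConditions L₀₁ L₁₂) (g₁₂₃ : GluingConditions L₁₂ L₂₃)
    (g₀₁₃ : GluingConditions L₀₁ L₁₃) (g₀₂₃ : GluingConditions L₀₂ L₂₃)
    [FiniteDimensional ℂ (kerSpace L₀₁.carrier L₁₂.carrier)]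
    [FiniteDimensional ℂ (kerSpace L₁₂.carrier L₂₃.carrier)]
    [FiniteDimensional ℂ (kerSpace L₀₁.carrier L₁₃.carrier)]
    [FiniteDimensional ℂ (kerSpace L₀₂.carrier L₂₃.carrier)] :
    (∃! α₀₁₂ : GluingHom L₀₁ L₁₂ L₀₂, IsGluing α₀₁₂) ∧
    (∃! α₁₂₃ : GluingHom L₁₂ L₂₃ L₁₃, IsGluing α₁₂₃) ∧
    (∃! α₀₁₃ : GluingHom L₀₁ L₁₃ L₀₃, IsGluing α₀₁₃) ∧
    (∃! α₀₂₃ : GluingHom L₀₂ L₂₃ L₀₃, IsGluing α₀₂₃) ∧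
    ∀ (α₀₁₂ : GluingHom L₀₁ L₁₂ L₀₂) (α₁₂₃ : GluingHom L₁₂ L₂₃ L₁₃)
      (α₀₁₃ : GluingHom L₀₁ L₁₃ L₀₃) (α₀₂₃ : GluingHom L₀₂ L₂₃ L₀₃),
      IsGluing α₀₁₂ → IsGluing α₁₂₃ → IsGluing α₀₁₃ → IsGluing α₀₂₃ →
      -- the left vertical composite, followed by the associator
      BalTensor.assocHom J₁.quadForm J₂.quadForm (Fock L₀₁) (Fock L₁₂) (Fock L₂₃) ∘ₗ
        BalTensor.idTensor (Fock L₀₁) α₁₂₃ ∘ₗ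
        Twist.moveRight (Fock L₀₁) (Fock L₁₃) (kerSpace L₁₂.carrier L₂₃.carrier) ∘ₗ
        LinearMap.rTensor (TopPower (kerSpace L₁₂.carrier L₂₃.carrier)) α₀₁₃.toLinearMap ∘ₗ
        Twist.assoc (Fock L₀₃) (kerSpace L₀₁.carrier L₁₃.carrier)
          (kerSpace L₁₂.carrier L₂₃.carrier) ∘ₗ
        LinearMap.lTensor (Fock L₀₃)
          (topWedgeEquiv (kerSpace L₀₁.carrier L₁₃.carrier)
            (kerSpace L₁₂.carrier L₂₃.carrier)).symm.toLinearMap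
      =
      -- `id ⊗ Λ^top ρ / det (ρ* ρ)`, followed by the right vertical composite
      BalTensor.tensorId α₀₁₂ (Fock L₂₃) ∘ₗ
        Twist.moveLeft (Fock L₀₂) (kerSpace L₀₁.carrier L₁₂.carrier) L₂₃ ∘ₗ
        LinearMap.rTensor (TopPower (kerSpace L₀₁.carrier L₁₂.carrier)) α₀₂₃.toLinearMap ∘ₗ
        Twist.assoc (Fock L₀₃) (kerSpace L₀₂.carrier L₂₃.carrier)
          (kerSpace L₀₁.carrier L₁₂.carrier) ∘ₗ
        LinearMap.lTensor (Fock L₀₃)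
          (topSwap ∘ₗ
            (topWedgeEquiv (kerSpace L₀₁.carrier L₁₂.carrier)
              (kerSpace L₀₂.carrier L₂₃.carrier)).symm.toLinearMap) ∘ₗ
        LinearMap.lTensor (Fock L₀₃) ((devDet h₀₂ h₁₃)⁻¹ • topMap (devMap h₀₂ h₁₃)) := by
  have h₀₃' : L₀₃.carrier = relComp L₀₂.carrier L₂₃.carrier := by
    rw [h₀₃, h₁₃, h₀₂, relComp_assoc]
  refine ⟨existsUnique_isGluing h₀₂, existsUnique_isGluing h₁₃, existsUnique_isGluing h₀₃,
    existsUnique_isGluing h₀₃', fun α₀₁₂ α₁₂₃ α₀₁₃ α₀₂₃ i₀₁₂ i₁₂₃ i₀₁₃ i₀₂₃ => ?_⟩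
  -- all determinant lines are spanned by the wedge products of bases; on `K₀₁₂ᗮ ∩ K₀₁₃` the basis
  -- diagonalizes `ρ₀* ρ₀`
  let κ := exteriorPower.ιMulti ℂ _ (Module.finBasis ℂ (kerSpace L₀₁.carrier L₁₂.carrier))
  let μ := exteriorPower.ιMulti ℂ _ (Module.finBasis ℂ (kerSpace L₁₂.carrier L₂₃.carrier))
  have hκ : κ ≠ 0 := ιMulti_basis_ne_zero _
  have hμ : μ ≠ 0 := ιMulti_basis_ne_zero _
  have hσ := ιMulti_basis_ne_zero (devBasis h₁₃ h₀₂).toBasis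
  rw [OrthonormalBasis.coe_toBasis] at hσ
  -- both composites twist the right action by the same total degree
  have hdeg : Module.finrank ℂ (kerSpace L₁₂.carrier L₂₃.carrier)
        + Module.finrank ℂ (kerSpace L₀₁.carrier L₁₃.carrier)
      = Module.finrank ℂ (kerSpace L₀₁.carrier L₁₂.carrier)
        + Module.finrank ℂ (kerSpace L₀₂.carrier L₂₃.carrier) := by
    rw [finrank_kerSpace_left h₁₃, finrank_kerSpace_right h₀₂ h₁₃]
    ring
  refine Fock.tensor_topPower_ext (topWedge_tmul_ne_zero (leftTop_ne_zero h₁₃ hκ hσ) hμ)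
    fun a b => ?_
  have e1 := lTensor_topWedgeEquiv_symm (E := kerSpace L₀₁.carrier L₁₃.carrier)
    (F := kerSpace L₁₂.carrier L₂₃.carrier) (a • MulOpposite.op b • Fock.vacuum L₀₃)
    (leftTop h₁₃ κ (exteriorPower.ιMulti ℂ _ (devBasis h₁₃ h₀₂))) μ
  have e2 := lTensor_topSwap_topMap (E := kerSpace L₀₁.carrier L₁₂.carrier)
    (F := kerSpace L₀₂.carrier L₂₃.carrier)
    (topMap_devMap_topWedge h₁₃ h₀₂ κ (exteriorPower.ιMulti ℂ _ (devBasis h₁₃ h₀₂)) μ)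
    (devDet h₀₂ h₁₃)⁻¹ (a • MulOpposite.op b • Fock.vacuum L₀₃)
  refine (left_composite_apply i₀₁₃ i₁₂₃ a b _ _ e1).trans
    (Eq.trans ?_ (right_composite_apply i₀₁₂ i₀₂₃ a b _ _ _ e2).symm)
  rw [eq_inv_smul_iff₀ (devDet_ne_zero h₁₃ h₀₂), hdeg]
  exact tripleTensor_leftTop h₁₃ h₀₂ κ μ a _
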